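/- **Setting.** Let $R$ be a ring with $1$ (not necessarily commutative) with decidable equality, and let $f\in R[x]$ be given by a straight-line program of size $L$: a list of $L$ instructions, each of which loads a constant of $R$, loads $x$, or adds, subtracts or multiplies two earlier results; $f$ is the result of the last one. Let $T\ge \#f$ (the number of nonzero terms of $f$) and $D>\deg f$ be natural numbers. For $p\ge 1$ and $g\in R[x]$ let $g_{(p)}=g \bmod (x^p-1)$. **Algorithm UIPoly** $(f,T,D)$. 1. Put $N_1=\max\{1,\lceil (T-1)\log_2D\rceil\}$, $N_2=\lceil T\log_2D\rceil$, $N=\max\{4N_1,N_1+N_2-1\}$. Compute the first $N$ primes $p_1,\dots,p_N$ and the smallest $K$ with $p_1\cdots p_K\ge D$. Probe $f_j=f_{(p_j)}$ for $j\le N$; put $h=0$. 2. Let $j_0$ be the smallest $j\le N$ for which $\#f_j$ is maximal. If $\#f_{j_0}=0$, return $h$. 3. Put $p=p_{j_0}$ and $g_k=(f-h)_{(p\,p_k)}$ for $k\le K$ (probing $f$). Let $U$ be the set of all terms $ax^{\beta}$, $0\le\beta<D$, obtained as follows: $ax^d$ is a nonzero term of $f_{j_0}$; for every $k\le K$, the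 nonzero terms of $g_k$ with exponent $\equiv d \pmod p$ are a single term, of the form $ax^{b_k}$; and $\beta$ is the solution modulo $p_1\cdots p_K$ of $\beta\equiv b_k \pmod{p_k}$, $k\le K$. 4. Let $s$ be the sum of those $u\in U$ for which $\#(f_j-u_{(p_j)})<\#f_j$ holds for at least $N_2$ of the indices $j\le N_1+N_2-1$. Replace $h$ by $h+s$ and $T$ by $T-\#s$, recompute $N_1,N_2,N$ as in 1, replace $f_j$ by $f_j-s_{(p_j)}$ for $j\le N$, and go to 2. **Costs.** *Ring operations* are additions, subtractions, multiplications and equality tests in $R$. A probe $f_{(m)}$ executes the straight-line program in $R[x]/(x^m-1)$ on vectors of $m$ coefficients; a product there is computed by a fixed constant-free straight-line program over $R$, which depends on $m$ only and is correct over every ring. Probes are measured in ring operations alone. *Bit operations* are those of the integer arithmetic and of the addressing of coefficients outside the probes: additions, subtractions and comparisons of integers are charged the total bit length $n$ of the operands, multiplications and divisions with remainder $n(\log n)^2$, up to constant factors, and an access to a coefficient is charged the bit length of its index. $O^\sim(\varphi)$ stands for $O(\varphi\,(\log(\varphi+3))^{k})$ with some constant exponent $k$. **Theorem.** For every such $R$,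 $f$, $T$, $D$, Algorithm UIPoly (which is deterministic) terminates and returns exactly the terms of $f$, each of them once. Moreover, with a suitable choice of the multiplication programs modulo $x^m-1$ (independent of $R$, $f$, $T$, $D$), it uses, for all $L\ge1$, $T\ge 1$ and $D\ge 2$, $$O^\sim\bigl(LT^2\log^2D+LT\log^3D\bigr)$$ ring operations and $$O^\sim\bigl(T\log^2D+T^2\log D\bigr)$$ bit operations; all implied constants and exponents are absolute, in particular independent of $R$. -/

import Mathlib

open Polynomial

universe u

/-! ### Straight-line programs -/

/-- One line of a straight-line program whose constants lie in `K` and whose inputs are indexed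
by `ι`. The line may refer to any of the `n` lines that precede it. -/
inductive SLPLine (K : Type*) (ι : Type*) (n : ℕ) where
  | const (c : K)
  | input (i : ι)
  | add (a b : Fin n)
  | sub (a b : Fin n)
  | mul (a b : Fin n)

/-- Straight-line programs with exactly `n` lines; `n` is the size of the program. -/
inductive SLP (K : Type*) (ι : Type*) : ℕ → Type _ where
  | nil : SLP K ι 0
  | snoc {n : ℕ} (P : SLP K ι n) (l : SLPLine K ι n) : SLP K ι (n + 1)

namespace SLP

/-- The value of a line, given the values `v` of the lines before it. -/
def lineEval {K ι A : Type*} [Ring A] (κ : K → A) (x : ι → A) {n : ℕ} (v : Fin n → A) :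
    SLPLine K ι n → A
  | .const c => κ c
  | .input i => x i
  | .add a b => v a + v b
  | .sub a b => v a - v b
  | .mul a b => v a * v b

/-- The values of all lines of a program in a ring `A`: constants are interpreted by `κ` and
inputs by `x`. -/
def eval {K ι A : Type*} [Ring A] (κ : K → A) (x : ι → A) : {n : ℕ} → SLP K ι n → Fin n → A
  | _, .nil => Fin.elim0
  | _, .snoc P l => Fin.snoc (α := fun _ => A) (eval κ x P) (lineEval κ x (eval κ x P) l)

/-- The output of a program is the value of its last line (and `0` if there is no line). -/
def output {A : Type*} [Zero A] {n : ℕ} (v : Fin n → A) : A :=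
  if h : 0 < n then v ⟨n - 1, Nat.sub_lt h Nat.one_pos⟩ else 0

/-- The univariate polynomial computed by a straight-line program over `R` with the single
input `X`. -/
noncomputable def toPoly {R : Type*} [Ring R] {L : ℕ} (P : SLP R Unit L) : R[X] :=
  output (P.eval (fun c => (C c : R[X])) (fun _ => X))

end SLP

/-- A program for the multiplication in `A[x]/(x^p - 1)`: a straight-line program without
constants that, over every ring `A`, computes the `p` coefficients of the product from the `2p`
coefficients of the two factors. -/
structure CyclicMul (p : ℕ) where
  size : ℕ
  prog : SLP Empty (Fin p ⊕ Fin p) size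
  out : Fin p → Fin size
  correct : ∀ (A : Type u) [Ring A] (a b : Fin p → A) (k : Fin p),
    prog.eval Empty.elim (Sum.elim a b) (out k) =
      ∑ i : Fin p, ∑ j : Fin p, if ((i : ℕ) + (j : ℕ)) % p = (k : ℕ) then a i * b j else 0

/-! ### Counting operations

Algorithms are written in a small language of counted computations. A computation carries its
result, the number of ring operations (`+`, `-`, `*` and equality tests in the ring) and the
number of bit operations it has used. All integer arithmetic of the algorithm goes through the
primitives below. -/

/-- A result together with the ring operations and the bit operations spent on it. -/
structure Counted (α : Type*) where
  val : α
  ringOps : ℕ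
  bitOps : ℕ

namespace Counted

/-- A computation that is free of charge. -/
def pure {α : Type*} (a : α) : Counted α := ⟨a, 0, 0⟩

/-- Sequential composition; costs add up. -/
def bind {α β : Type*} (x : Counted α) (g : α → Counted β) : Counted β :=
  ⟨(g x.val).val, x.ringOps + (g x.val).ringOps, x.bitOps + (g x.val).bitOps⟩

end Counted

infixl:55 " ⊳ " => Counted.bind

namespace UIPoly

open Counted

/-- Bit cost of a linear-time operation (addition, subtraction, comparison) on `a` and `b`. -/
def linCost (a b : ℕ) : ℕ := Nat.size a + Nat.size b + 1

/-- Bit cost `n (log n)^2` of a multiplication or a division with remainder, where `n` is the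
total bit length of the operands (the cost of fast integer arithmetic). -/
def mulCost (a b : ℕ) : ℕ := linCost a b * Nat.size (linCost a b) ^ 2

def natAdd (a b : ℕ) : Counted ℕ := ⟨a + b, 0, linCost a b⟩
def natSub (a b : ℕ) : Counted ℕ := ⟨a - b, 0, linCost a b⟩
def natMax (a b : ℕ) : Counted ℕ := ⟨max a b, 0, linCost a b⟩
def natLt (a b : ℕ) : Counted Bool := ⟨decide (a < b), 0, linCost a b⟩
def natEq (a b : ℕ) : Counted Bool := ⟨decide (a = b), 0, linCost a b⟩
def natMul (a b : ℕ) : Counted ℕ := ⟨a * b, 0, mulCost a b⟩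
def natMod (a b : ℕ) : Counted ℕ := ⟨a % b, 0, mulCost a b⟩

/-- `⌈log₂ a⌉`, that is the bit length of `a - 1` for `a ≥ 1`. -/
def natClog (a : ℕ) : Counted ℕ := ⟨Nat.clog 2 a, 0, linCost a 1⟩

/-- `a ^ n` by `n` multiplications. -/
def natPow (a : ℕ) : ℕ → Counted ℕ
  | 0 => pure 1
  | n + 1 => natPow a n ⊳ fun b => natMul b a

section RingOps

variable {R : Type*} [Ring R] [DecidableEq R]

def ringSub (a b : R) : Counted R := ⟨a - b, 1, 0⟩
def ringEq (a b : R) : Counted Bool := ⟨decide (a = b), 1, 0⟩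
def isZero (a : R) : Counted Bool := ⟨decide (a = 0), 1, 0⟩

/-- Random access to an array of ring elements: the bit length of the address is charged. -/
def read (a : ℕ → R) (i : ℕ) : Counted R := ⟨a i, 0, Nat.size i + 1⟩
def write (a : ℕ → R) (i : ℕ) (c : R) : Counted (ℕ → R) :=
  ⟨Function.update a i c, 0, Nat.size i + 1⟩

end RingOps

/-! ### Probes -/

section Probe

variable {R : Type*} [Ring R] [DecidableEq R]

/-- Number of nonzero entries among the first `n` entries of `a`: one zero test for every entry,
and one increment of the counter for every nonzero entry. -/
def countTerms (a : ℕ → R) : ℕ → Counted ℕ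
  | 0 => pure 0
  | i + 1 => countTerms a i ⊳ fun c => isZero (a i) ⊳ fun z => if z then pure c else natAdd c 1

end Probe



variable {R : Type u} [Ring R] [DecidableEq R]

/-- One line of a straight-line program, executed in `R[x]/(x^p - 1)`; an element of this ring is
given by its `p` coefficients. -/
def lineMod (M : ∀ p : ℕ, CyclicMul.{u} p) (p : ℕ) {n : ℕ} (v : Fin n → Fin p → R) :
    SLPLine R Unit n → Counted (Fin p → R)
  | .const c => pure fun i => if (i : ℕ) = 0 then c else 0
  | .input _ => pure fun i => if (i : ℕ) = 1 % p then 1 else 0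
  | .add a b => ⟨fun i => v a i + v b i, p, 0⟩
  | .sub a b => ⟨fun i => v a i - v b i, p, 0⟩
  | .mul a b =>
      ⟨fun k => (M p).prog.eval Empty.elim (Sum.elim (v a) (v b)) ((M p).out k), (M p).size, 0⟩

/-- A straight-line program, executed line by line in `R[x]/(x^p - 1)`. -/
def evalMod (M : ∀ p : ℕ, CyclicMul.{u} p) (p : ℕ) :
    {n : ℕ} → SLP R Unit n → Counted (Fin n → Fin p → R)
  | _, .nil => pure Fin.elim0
  | _, .snoc P l => evalMod M p P ⊳ fun v => lineMod M p v l ⊳ fun w =>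
      pure (Fin.snoc (α := fun _ => Fin p → R) v w)

/-- The probe `f mod (x^p - 1)` of the polynomial `f` computed by `P`, as the array of its
coefficients. -/
def probe (M : ∀ p : ℕ, CyclicMul.{u} p) {L : ℕ} (P : SLP R Unit L) (p : ℕ) : Counted (ℕ → R) :=
  evalMod M p P ⊳ fun v => pure fun i => if h : i < p then SLP.output v ⟨i, h⟩ else 0

/-- A polynomial modulo `x^p - 1`, given by its coefficients, with its number of terms. -/
structure Image (R : Type*) where
  p : ℕ
  coeff : ℕ → R
  terms : ℕ

/-- The images of `f` modulo `x^p - 1` for the `p` in a list. -/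
def images (M : ∀ p : ℕ, CyclicMul.{u} p) {L : ℕ} (P : SLP R Unit L) :
    List ℕ → Counted (List (Image R))
  | [] => pure []
  | p :: ps => probe M P p ⊳ fun a => countTerms a p ⊳ fun t => images M P ps ⊳ fun l =>
      pure (⟨p, a, t⟩ :: l)

/-- The first image in `b :: l` that has the largest number of terms. -/
def best (b : Image R) : List (Image R) → Counted (Image R)
  | [] => pure b
  | f :: fs => natLt b.terms f.terms ⊳ fun lt => best (if lt then f else b) fs

/-- Coefficient at `x^r` and number of terms of the polynomial `f - c x^r`. -/
def subTerm (f : Image R) (r : ℕ) (c : R) : Counted (R × ℕ) :=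
  read f.coeff r ⊳ fun v => ringSub v c ⊳ fun w => isZero v ⊳ fun z => isZero w ⊳ fun z' =>
    if z && !z' then natAdd f.terms 1 ⊳ fun t => pure (w, t)
    else if !z && z' then natSub f.terms 1 ⊳ fun t => pure (w, t)
    else pure (w, f.terms)

/-! ### Parameters and primes -/

/-- `N₁ = max {1, ⌈(T - 1) log₂ D⌉}`, `N₂ = ⌈T log₂ D⌉`, `N = max {4 N₁, N₁ + N₂ - 1}`. -/
def params (T D : ℕ) : Counted (ℕ × ℕ × ℕ) :=
  natSub T 1 ⊳ fun T' => natPow D T' ⊳ fun A => natClog A ⊳ fun a => natMax 1 a ⊳ fun N₁ =>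
  natPow D T ⊳ fun B => natClog B ⊳ fun N₂ =>
  natMul 4 N₁ ⊳ fun m => natAdd N₁ N₂ ⊳ fun s => natSub s 1 ⊳ fun s' => natMax m s' ⊳ fun N =>
  pure (N₁, N₂, N)

/-- The ceilings in `params` are those of the real numbers `n log₂ D`. -/
theorem clog_pow_eq_ceil (n D : ℕ) :
    Nat.clog 2 (D ^ n) = ⌈(n : ℝ) * Real.logb 2 D⌉₊ := by
  have h := Real.natCeil_logb_natCast 2 (D ^ n)
  rw [← h]
  push_cast
  rw [Real.logb_pow]

/-- Trial division of `m` by `d, d + 1, …` up to the square root of `m`. -/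
def trial (m : ℕ) : (fuel : ℕ) → (d : ℕ) → Counted Bool
  | 0, _ => pure true
  | fuel + 1, d => natMul d d ⊳ fun q => natLt m q ⊳ fun big =>
      if big then pure true
      else natMod m d ⊳ fun r => natEq r 0 ⊳ fun z =>
        if z then pure false else natAdd d 1 ⊳ fun d' => trial m fuel d'

/-- The first `k` primes `≥ m` (for `m ≥ 2`). -/
def primesFrom : (fuel : ℕ) → (m k : ℕ) → Counted (List ℕ)
  | 0, _, _ => pure []
  | fuel + 1, m, k => natEq k 0 ⊳ fun z =>
      if z then pure []
      else trial m m 2 ⊳ fun b => natAdd m 1 ⊳ fun m' =>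
        if b then natSub k 1 ⊳ fun k' => primesFrom fuel m' k' ⊳ fun l => pure (m :: l)
        else primesFrom fuel m' k

/-- The first `N` primes. The bound `2 ^ (N + 1)` on the number of candidates only serves to make
the recursion total: it exceeds the `N`-th prime. -/
def firstPrimes (N : ℕ) : Counted (List ℕ) := primesFrom (2 ^ (N + 1)) 2 N

/-- The shortest initial segment of a list of primes for which `A` times its product is `≥ D`. -/
def crtPrimes (D : ℕ) : List ℕ → (A : ℕ) → Counted (List ℕ)
  | [], _ => pure []
  | q :: qs, A => natLt A D ⊳ fun b =>
      if b then natMul A q ⊳ fun A' => crtPrimes D qs A' ⊳ fun l => pure (q :: l) else pure []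

/-! ### Candidate terms

A term `c x^e` is the pair `(e, c)`. -/

/-- Subtraction of the polynomial `h`, given by its terms, modulo `x^m - 1`. -/
def subSparse (m : ℕ) : List (ℕ × R) → (ℕ → R) → Counted (ℕ → R)
  | [], a => pure a
  | (e, c) :: h, a => natMod e m ⊳ fun r => read a r ⊳ fun v => ringSub v c ⊳ fun w =>
      write a r w ⊳ fun a' => subSparse m h a'

/-- The probes `(f - h) mod (x^(p q) - 1)` for the primes `q` in a list. -/
def cofactorImages (M : ∀ p : ℕ, CyclicMul.{u} p) {L : ℕ} (P : SLP R Unit L) (h : List (ℕ × R))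
    (p : ℕ) : List ℕ → Counted (List (ℕ × (ℕ → R)))
  | [] => pure []
  | q :: qs => natMul p q ⊳ fun m => probe M P m ⊳ fun a => subSparse m h a ⊳ fun g =>
      cofactorImages M P h p qs ⊳ fun l => pure ((q, g) :: l)

/-- The nonzero terms of `g` with exponents `b, b + p, b + 2 p, …` (`n` exponents in all). -/
def blockTerms (g : ℕ → R) (p : ℕ) : (n b : ℕ) → Counted (List (ℕ × R))
  | 0, _ => pure []
  | n + 1, b => read g b ⊳ fun v => isZero v ⊳ fun z => natAdd b p ⊳ fun b' =>
      blockTerms g p n b' ⊳ fun l => pure (if z then l else (b, v) :: l)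

/-- Some `t < n` with `(b + m t) mod q = e`, if there is one. -/
def crtSearch (b m q e : ℕ) : (n : ℕ) → Counted ℕ
  | 0 => pure 0
  | t + 1 => natMul m t ⊳ fun y => natAdd b y ⊳ fun y' => natMod y' q ⊳ fun r =>
      natEq r e ⊳ fun ok => if ok then pure t else crtSearch b m q e t

/-- Chinese remaindering: from `β` modulo `A` to the residue modulo `A q` that is `e` modulo `q`. -/
def crtStep (β A q e : ℕ) : Counted ℕ :=
  natMod β q ⊳ fun b => natMod A q ⊳ fun m => crtSearch b m q e q ⊳ fun t =>
    natMul A t ⊳ fun y => natAdd β y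

/-- Given the term `a x^d` of `f mod (x^p - 1)` and the images of `f` modulo `x^(p q) - 1`: if in
each of them the terms whose exponent is `d` modulo `p` are just one term `a x^b`, the solution `β`
of the congruences `β ≡ b` modulo the `q`. -/
def liftExponent (p d : ℕ) (a : R) : List (ℕ × (ℕ → R)) → (β A : ℕ) → Counted (Option ℕ)
  | [], β, _ => pure (some β)
  | (q, g) :: gs, β, A => blockTerms g p q d ⊳ fun l =>
      match l with
      | [(b, v)] => ringEq v a ⊳ fun ok =>
          if ok then natMod b q ⊳ fun e => crtStep β A q e ⊳ fun β' => natMul A q ⊳ fun A' =>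
            liftExponent p d a gs β' A'
          else pure none
      | _ => pure none

/-- Insertion of a term into a set of terms. -/
def insertTerm (w : ℕ × R) : List (ℕ × R) → Counted (List (ℕ × R))
  | [] => pure [w]
  | y :: ys => natEq w.1 y.1 ⊳ fun b => ringEq w.2 y.2 ⊳ fun c =>
      if b && c then pure (y :: ys) else insertTerm w ys ⊳ fun l => pure (y :: l)

/-- The candidate terms that come from the terms of `f` of exponent less than `n`; for `n = f.p`
this is the result of the algorithm UTerms. -/
def uTerms (D : ℕ) (f : Image R) (gs : List (ℕ × (ℕ → R))) : (n : ℕ) → Counted (List (ℕ × R))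
  | 0 => pure []
  | d + 1 => uTerms D f gs d ⊳ fun U => read f.coeff d ⊳ fun a => isZero a ⊳ fun z =>
      if z then pure U
      else liftExponent f.p d a gs 0 1 ⊳ fun o =>
        match o with
        | none => pure U
        | some β => natLt β D ⊳ fun ok => if ok then insertTerm (β, a) U else pure U

/-! ### Reduction of an exponent modulo many primes -/

/-- Binary trees of products of primes. -/
inductive ProdTree where
  | nil
  | leaf (p : ℕ)
  | node (m : ℕ) (l r : ProdTree)

/-- The product of the leaves, as stored in the root. -/
def ProdTree.prod : ProdTree → ℕ
  | .nil => 1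
  | .leaf p => p
  | .node m _ _ => m

/-- The two halves of a list. -/
def splitHalf (l : List ℕ) : Counted (List ℕ × List ℕ) :=
  ⟨(l.take (l.length / 2), l.drop (l.length / 2)), 0, l.length + 1⟩

/-- The product tree of a list of length at most `fuel`. -/
def prodTree : (fuel : ℕ) → List ℕ → Counted ProdTree
  | _, [] => pure .nil
  | _, [p] => pure (.leaf p)
  | 0, _ => pure .nil
  | fuel + 1, l => splitHalf l ⊳ fun s => prodTree fuel s.1 ⊳ fun x => prodTree fuel s.2 ⊳ fun y =>
      natMul x.prod y.prod ⊳ fun m => pure (.node m x y)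

/-- The residues of `e` modulo the leaves of a product tree, in order, followed by `acc`. -/
def residues : (e : ℕ) → ProdTree → (acc : List ℕ) → Counted (List ℕ)
  | _, .nil, acc => pure acc
  | e, .leaf p, acc => natMod e p ⊳ fun r => pure (r :: acc)
  | e, .node _ x y, acc => natMod e y.prod ⊳ fun ey => natMod e x.prod ⊳ fun ex =>
      residues ey y acc ⊳ fun acc' => residues ex x acc'

/-! ### Term testing and updates -/

/-- The number of `j` such that `f_j - c x^(r_j)` has fewer terms than `f_j`. -/
def countDrops (c : R) : List (Image R) → List ℕ → Counted ℕ
  | f :: fs, r :: rs => countDrops c fs rs ⊳ fun n => subTerm f r c ⊳ fun w =>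
      natLt w.2 f.terms ⊳ fun b => if b then natAdd n 1 else pure n
  | _, _ => pure 0

/-- The candidates `w` for which at least `N₂` of the images lose a term when `w` is subtracted. -/
def select (fs : List (Image R)) (t : ProdTree) (N₂ : ℕ) : List (ℕ × R) → Counted (List (ℕ × R))
  | [] => pure []
  | w :: U => residues w.1 t [] ⊳ fun rs => countDrops w.2 fs rs ⊳ fun n => natLt n N₂ ⊳ fun b =>
      select fs t N₂ U ⊳ fun s => pure (if b then s else w :: s)

/-- Replacement of every `f_j` by `f_j - c x^(r_j)`. -/
def subAll (c : R) : List (Image R) → List ℕ → Counted (List (Image R))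
  | f :: fs, r :: rs => subTerm f r c ⊳ fun w => write f.coeff r w.1 ⊳ fun a =>
      subAll c fs rs ⊳ fun l => pure (⟨f.p, a, w.2⟩ :: l)
  | _, _ => pure []

/-- Replacement of every `f_j` by `f_j - s mod (x^(p_j) - 1)`; `t` is the product tree of
the `p_j`. -/
def update (t : ProdTree) : (s : List (ℕ × R)) → List (Image R) → Counted (List (Image R))
  | [], fs => pure fs
  | (e, c) :: s, fs => residues e t [] ⊳ fun rs => subAll c fs rs ⊳ fun fs' => update t s fs'

/-- The product tree of the primes of a list of images. -/
def imageTree (fs : List (Image R)) : Counted ProdTree := prodTree fs.length (fs.map Image.p)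

/-- The length of a list of terms. -/
def numTerms (s : List (ℕ × R)) : Counted ℕ := ⟨s.length, 0, s.length + 1⟩

/-! ### The algorithm -/

/-- The main loop: `qs` are the primes for Chinese remaindering, `fs` the images of `f - h` modulo
`x^(p_j) - 1`, `1 ≤ j ≤ N`, and `T` bounds the number of terms of `f - h`. The loop stops when all
images vanish; `fuel` only makes the recursion total. -/
def loop (M : ∀ p : ℕ, CyclicMul.{u} p) {L : ℕ} (P : SLP R Unit L) (D : ℕ) (qs : List ℕ) :
    (fuel : ℕ) → (fs : List (Image R)) → (T N₁ N₂ : ℕ) → (h : List (ℕ × R)) →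
      Counted (List (ℕ × R))
  | 0, _, _, _, _, h => pure h
  | _ + 1, [], _, _, _, h => pure h
  | fuel + 1, f₀ :: fs, T, N₁, N₂, h =>
      best f₀ fs ⊳ fun f => natEq f.terms 0 ⊳ fun done =>
      if done then pure h
      else
        cofactorImages M P h f.p qs ⊳ fun gs =>
        uTerms D f gs f.p ⊳ fun U =>
        natAdd N₁ N₂ ⊳ fun m => natSub m 1 ⊳ fun m' =>
        imageTree ((f₀ :: fs).take m') ⊳ fun t =>
        select ((f₀ :: fs).take m') t N₂ U ⊳ fun s =>
        numTerms s ⊳ fun k => natSub T k ⊳ fun T' =>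
        params T' D ⊳ fun N =>
        imageTree ((f₀ :: fs).take N.2.2) ⊳ fun t' =>
        update t' s ((f₀ :: fs).take N.2.2) ⊳ fun fs' =>
        loop M P D qs fuel fs' T' N.1 N.2.1 (h ++ s)

end UIPoly

/-- Algorithm UIPoly. Input: a straight-line program `P` for a univariate polynomial `f`, a bound
`T` for the number of terms and a bound `D` for the degree of `f`. Output: the list of the terms
`(e, c)` of `f`. The products in `R[x]/(x^p - 1)` that a probe requires are computed by the
programs `M`. -/
def uiPoly {R : Type u} [Ring R] [DecidableEq R] (M : ∀ p : ℕ, CyclicMul.{u} p) {L : ℕ}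
    (P : SLP R Unit L) (T D : ℕ) : Counted (List (ℕ × R)) :=
  UIPoly.params T D ⊳ fun N => UIPoly.firstPrimes N.2.2 ⊳ fun ps =>
  UIPoly.crtPrimes D ps 1 ⊳ fun qs => UIPoly.images M P ps ⊳ fun fs =>
  UIPoly.loop M P D qs (T + 1) fs T N.1 N.2.1 []

/-- The bound `C φ (log φ)^k` behind the soft-Oh notation `O^∼(φ)`; the shift by `3` keeps the
logarithm above `1`. -/
noncomputable def softBound (C k : ℕ) (φ : ℝ) : ℝ := C * φ * Real.log (φ + 3) ^ k

/-!
Why the algorithm is correct. Let `g = f - h` be the part of `f` that is still missing; it has at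
most `T` terms, all of degree less than `D`. Two exponents that are congruent modulo `p` have a
difference divisible by `p`, so the product of all primes modulo which an exponent `e` collides with
some other exponent of `g` divides a product of nonzero numbers less than `D`. Hence an exponent of
`g` collides modulo fewer than `N₁` primes, and any exponent less than `D` modulo fewer than `N₂`
primes (`two_pow_card_collides_le`, `card_collides_lt`). Modulo a prime without collision at `e` the
coefficient of `x ^ e` can be read off the image of `g`, so that true terms pass the test of step 4
and other candidates fail it (`le_drops`, `coeff_eq_of_le_drops`). Counting the collisions of all
exponents modulo `4 N₁` primes shows that some prime leaves more than three quarters of the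
exponents isolated; as a class of colliding exponents contributes at most one term to the image,
the prime whose image has the most terms still leaves more than half of them isolated
(`half_not_collide`). Isolated terms are recovered from the images modulo `x ^ (p p_k) - 1` by
Chinese remaindering (`val_liftExponent`). So every round finds at least half of the missing terms
and nothing else (`isPart_round`), and the loop ends with `h = f` (`val_loop`).

Why it is fast. There are logarithmically many rounds. Chebyshev's lower bound for the number of
primes (`le_size_mul_primeCounting`) keeps the first `N = O(T log D)` primes below
`O(N log N)`; the residues of an exponent modulo all of them are computed with product trees
(`bitOps_residues_le`). All costs are estimated as monomials in `T`, `L` and the bit length `ℓ` of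
`D`, times powers of `Λ = 1000 * (T * ℓ).size` (`IsScale`), which absorb all logarithmic factors
(`bitOps_uiPoly_le`, `ringOps_uiPoly_le`, `le_softBound`).

The ring operations also need multiplication programs modulo `x ^ m - 1` of quasi-linear size over
an arbitrary ring, where neither roots of unity nor division by the length of a Fourier transform
is available. As in the algorithms of Schönhage and Strassen and of Cantor and Kaltofen, powers of
`X` serve as roots of unity modulo `X ^ N - 1` for `N` a power of `r ∈ {2, 3}`, which yields a power
of `r` times the product (`PolyMulCost.step`, `exists_polyMulCost`). Instead of passing to the
quotient by a cyclotomic polynomial, everything is multiplied by `1 - X ^ (N / r)`, which kills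
the unwanted sums of roots of unity (`wrap_sum_eq_zero`). A power of `2` times the product and a
power of `3` times the product are combined by Bézout coefficients (`derives_cyclic`). The
computation is carried out in a free ring and transported to all rings by homomorphisms
(`exists_cyclicMul`).
-/

/-! ### Straight-line derivations -/

/-- `Derives S n T`: all elements of `T` can be computed from elements of `S` by at most `n`
additions, subtractions and multiplications. -/
inductive Derives {F : Type*} [Ring F] : Set F → ℕ → Set F → Prop where
  | refl {S T : Set F} (n : ℕ) (h : T ⊆ S) : Derives S n T
  | step {S T : Set F} {n : ℕ} {a b c : F} (ha : a ∈ S) (hb : b ∈ S)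
      (hc : c = a + b ∨ c = a - b ∨ c = a * b) (h : Derives (insert c S) n T) :
      Derives S (n + 1) T

namespace Derives

variable {F : Type*} [Ring F] {S S' T U : Set F} {m n : ℕ}

theorem mono (h : Derives S n T) (hS : S ⊆ S') (hn : n ≤ m) : Derives S' m T := by
  induction h generalizing S' m with
  | refl n h => exact .refl m (h.trans hS)
  | step ha hb hc h ih =>
    obtain ⟨m, rfl⟩ : ∃ k, m = k + 1 := ⟨m - 1, by omega⟩
    exact .step (hS ha) (hS hb) hc (ih (Set.insert_subset_insert hS) (by omega))

theorem subset (h : Derives S n T) (hU : U ⊆ T) : Derives S n U := by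
  induction h with
  | refl n h => exact .refl n (hU.trans h)
  | step ha hb hc h ih => exact .step ha hb hc (ih hU)

theorem trans (h : Derives S n T) (h' : Derives T m U) : Derives S (n + m) U := by
  induction h with
  | refl n h => exact h'.mono h (by omega)
  | @step S T n a b c ha hb hc h ih =>
    rw [show n + 1 + m = n + m + 1 by omega]
    exact .step ha hb hc (ih h')

theorem keep (h : Derives S n T) : Derives S n (S ∪ T) := by
  induction h with
  | refl n h => exact .refl n (Set.union_subset subset_rfl h)
  | step ha hb hc h ih =>
    exact .step ha hb hc (ih.subset (Set.union_subset_union_left _ (Set.subset_insert _ _)))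

theorem union (h : Derives S n T) (h' : Derives S m U) : Derives S (n + m) (T ∪ U) :=
  (h.keep.trans (h'.mono Set.subset_union_left le_rfl).keep).subset
    (Set.union_subset_union_left _ Set.subset_union_right)

theorem biUnion {ι : Type*} {s : Finset ι} {T : ι → Set F}
    (h : ∀ i ∈ s, Derives S n (T i)) : Derives S (s.card * n) (⋃ i ∈ s, T i) := by
  classical
  induction s using Finset.induction_on with
  | empty => simpa using Derives.refl (S := S) (T := ∅) 0 (Set.empty_subset _)
  | insert a s ha ih =>
    rw [Finset.card_insert_of_notMem ha, Finset.set_biUnion_insert, add_mul, one_mul, add_comm]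
    exact (h a (by simp)).union (ih fun i hi => h i (by simp [hi]))

theorem add {a b : F} (ha : a ∈ S) (hb : b ∈ S) : Derives S 1 {a + b} :=
  .step ha hb (.inl rfl) (.refl 0 (by simp))

theorem sub {a b : F} (ha : a ∈ S) (hb : b ∈ S) : Derives S 1 {a - b} :=
  .step ha hb (.inr (.inl rfl)) (.refl 0 (by simp))

theorem mul {a b : F} (ha : a ∈ S) (hb : b ∈ S) : Derives S 1 {a * b} :=
  .step ha hb (.inr (.inr rfl)) (.refl 0 (by simp))

/-- A sum of `r` available elements costs `r` additions. -/
theorem sum (h0 : (0 : F) ∈ S) {f : ℕ → F} (r : ℕ) (hf : ∀ l < r, f l ∈ S) :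
    Derives S r {∑ l ∈ Finset.range r, f l} := by
  induction r with
  | zero => exact .refl 0 (by simpa using h0)
  | succ r ih =>
    rw [Finset.sum_range_succ]
    exact (ih fun l hl => hf l (by omega)).keep.trans
      (add (by simp) (Or.inl (hf r (by omega))))

/-- Multiples by natural numbers, by repeated doubling. -/
theorem nsmul (h0 : (0 : F) ∈ S) {a : F} (ha : a ∈ S) (n : ℕ) :
    Derives S (2 * n.size) {n • a} := by
  induction n using Nat.strong_induction_on with
  | _ n ih =>
    rcases Nat.eq_zero_or_pos n with rfl | hn
    · exact .refl _ (by simpa using h0)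
    · have h1 := ih (n / 2) (by omega)
      have hs : n.size = (n / 2).size + 1 := by
        have hb : n.size ≤ (n / 2).size + 1 := by
          rw [Nat.size_le, pow_succ]
          have := Nat.lt_size_self (n / 2)
          omega
        have hb' : (n / 2).size + 1 ≤ n.size := by
          have : (n / 2).size ≤ n.size - 1 := by
            rw [Nat.size_le]
            have h3 := Nat.lt_size_self n
            have h4 : 0 < n.size := Nat.size_pos.2 hn
            obtain ⟨k, hk⟩ : ∃ k, n.size = k + 1 := ⟨n.size - 1, by omega⟩
            rw [hk] at h3 ⊢
            rw [pow_succ] at h3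
            simp only [Nat.add_sub_cancel]
            omega
          have h4 : 0 < n.size := Nat.size_pos.2 hn
          omega
        omega
      have h2 : Derives (S ∪ {(n / 2) • a}) 1 {(2 * (n / 2)) • a} := by
        rw [two_mul, add_smul]
        exact add (by simp) (by simp)
      have h3 : Derives (S ∪ {(n / 2) • a} ∪ {(2 * (n / 2)) • a}) 1 {n • a} := by
        rcases Nat.mod_two_eq_zero_or_one n with h | h
        · exact .refl _ (by rw [show 2 * (n / 2) = n by omega]; simp)
        · have : n • a = (2 * (n / 2)) • a + a := by
            conv_lhs => rw [show n = 2 * (n / 2) + 1 by omega]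
            rw [add_smul, one_smul]
          rw [this]
          exact add (by simp) (by simp [ha])
      have := (h1.keep.trans (h2.keep.trans h3))
      exact this.mono subset_rfl (by omega)

/-- Multiples by integers, by repeated doubling. -/
theorem zsmul (h0 : (0 : F) ∈ S) {a : F} (ha : a ∈ S) (n : ℤ) :
    Derives S (2 * n.natAbs.size + 1) {n • a} := by
  obtain ⟨k, rfl | rfl⟩ := Int.eq_nat_or_neg n
  · rw [natCast_zsmul, Int.natAbs_natCast]
    exact (nsmul h0 ha k).mono subset_rfl (by omega)
  · rw [Int.natAbs_neg, Int.natAbs_natCast, neg_smul, natCast_zsmul, ← zero_sub]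
    exact (nsmul h0 ha k).keep.trans (sub (Or.inl h0) (Or.inr rfl))

end Derives

/-- The values of a program over `K` with constants `κ` and inputs `x`, extended by a derivation
of `n` steps. -/
theorem Derives.exists_slp {F : Type*} [Ring F] {K ι : Type*} {κ : K → F} {x : ι → F} {S T : Set F}
    {n : ℕ} (h : Derives S n T) {m : ℕ} (P : SLP K ι m) (hP : S ⊆ Set.range (P.eval κ x)) :
    ∃ (m' : ℕ) (P' : SLP K ι m'), m' ≤ m + n ∧ T ⊆ Set.range (P'.eval κ x) := by
  induction h generalizing m with
  | refl n h => exact ⟨m, P, by omega, h.trans hP⟩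
  | @step S T n a b c ha hb hc h ih =>
    obtain ⟨i, rfl⟩ := hP ha
    obtain ⟨j, rfl⟩ := hP hb
    have key : ∀ l : SLPLine K ι m, SLP.lineEval κ x (P.eval κ x) l = c →
        ∃ (m' : ℕ) (P' : SLP K ι m'), m' ≤ m + (n + 1) ∧ T ⊆ Set.range (P'.eval κ x) := by
      intro l hl
      obtain ⟨m', P', hm, hT⟩ := ih (P.snoc l) (by
        rintro y (rfl | hy)
        · exact ⟨Fin.last m, by simp [SLP.eval, hl]⟩
        · obtain ⟨k, rfl⟩ := hP hy
          exact ⟨k.castSucc, by simp [SLP.eval]⟩)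
      exact ⟨m', P', by omega, hT⟩
    rcases hc with hc | hc | hc
    · exact key (.add i j) hc.symm
    · exact key (.sub i j) hc.symm
    · exact key (.mul i j) hc.symm

/-- Straight-line programs commute with ring homomorphisms. -/
theorem SLP.eval_map {K ι A B : Type*} [Ring A] [Ring B] (φ : A →+* B) (κ : K → A) (x : ι → A)
    {n : ℕ} (P : SLP K ι n) (i : Fin n) :
    φ (P.eval κ x i) = P.eval (fun c => φ (κ c)) (fun j => φ (x j)) i := by
  induction P with
  | nil => exact i.elim0
  | snoc P l ih =>
    refine Fin.lastCases ?_ (fun j => ?_) i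
    · simp only [SLP.eval, Fin.snoc_last]
      cases l <;> simp [SLP.lineEval, ih]
    · simp only [SLP.eval, Fin.snoc_castSucc, ih]

/-! ### Polynomials modulo `X ^ N - 1` -/

/-- The coefficients of `q` modulo `X ^ N - 1`: the sums of the coefficients of `q` over the
residue classes of the exponents. It vanishes at all `i ≥ N`. -/
noncomputable def wrap {F : Type*} [Ring F] (N : ℕ) : F[X] →+ (ℕ → F) where
  toFun q i := q.sum fun e c => if e % N = i then c else 0
  map_zero' := by ext; simp
  map_add' p q := by
    ext i
    exact Polynomial.sum_add_index p q _ (by simp) (by intro e a b; split_ifs <;> simp)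

section Wrap

variable {F : Type*} [Ring F] {N : ℕ}

theorem wrap_apply (q : F[X]) (i : ℕ) :
    wrap N q i = ∑ e ∈ q.support with e % N = i, q.coeff e := by
  simp [wrap, Polynomial.sum_def, Finset.sum_filter]

theorem wrap_monomial (e : ℕ) (c : F) (i : ℕ) :
    wrap N (monomial e c) i = if e % N = i then c else 0 :=
  Polynomial.sum_monomial_index (n := e) c (fun e c => if e % N = i then c else 0) (by simp)

theorem wrap_eq_zero_of_le (hN : 0 < N) (q : F[X]) {i : ℕ} (hi : N ≤ i) : wrap N q i = 0 := by
  rw [wrap_apply, Finset.sum_eq_zero]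
  intro e he
  have := Nat.mod_lt e hN
  simp at he
  omega

theorem wrap_eq_coeff {q : F[X]} (hq : ∀ e, N ≤ e → q.coeff e = 0) : wrap N q = q.coeff := by
  ext i
  rw [wrap_apply]
  have : ∀ e ∈ q.support, e % N = e := by
    intro e he
    rw [Nat.mod_eq_of_lt]
    by_contra h
    exact (mem_support_iff.1 he) (hq e (by omega))
  rw [Finset.sum_filter, Finset.sum_congr rfl (g := fun e => if e = i then q.coeff e else 0)
    (fun e he => by rw [this e he])]
  simp only [Finset.sum_ite_eq', mem_support_iff]
  split_ifs with h
  · rfl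
  · simpa using Eq.symm (by simpa using h : q.coeff i = 0)

theorem wrap_X_pow_mul (hN : 0 < N) (k : ℕ) (q : F[X]) {i : ℕ} (hi : i < N) :
    wrap N (X ^ k * q) i = wrap N q ((i + (N - k % N)) % N) := by
  induction q using Polynomial.induction_on' with
  | add p q hp hq => simp only [mul_add, map_add, Pi.add_apply, hp, hq]
  | monomial e c =>
    rw [X_pow_mul_monomial, wrap_monomial, wrap_monomial]
    refine if_congr ?_ rfl rfl
    have hk := Nat.mod_lt k hN
    rw [show ((i + (N - k % N)) % N) = (i + (N - k % N)) % N from rfl]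
    have e1 : ((e + k) % N = i) ↔ e + k ≡ i [MOD N] := by
      rw [Nat.ModEq, Nat.mod_eq_of_lt hi]
    have e2 : (e % N = (i + (N - k % N)) % N) ↔ e ≡ i + (N - k % N) [MOD N] := Iff.rfl
    rw [e1, e2]
    have hkk : k + (N - k % N) ≡ 0 [MOD N] := by
      have h1 : k = N * (k / N) + k % N := (Nat.div_add_mod k N).symm
      have : k + (N - k % N) = N * (k / N + 1) := by rw [mul_add, mul_one]; omega
      rw [this]
      exact (Nat.modEq_zero_iff_dvd.2 ⟨_, rfl⟩)
    constructor
    · intro h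
      have h2 := h.add_right (N - k % N)
      rw [add_assoc] at h2
      exact ((hkk.add_left e).symm.trans h2)
    · intro h
      have h2 := h.add_right k
      refine h2.trans ?_
      rw [add_assoc, add_comm (N - k % N)]
      exact hkk.add_left i

theorem wrap_X_pow_mul_congr {a b : ℕ} (h : a % N = b % N) (q : F[X]) :
    wrap N (X ^ a * q) = wrap N (X ^ b * q) := by
  ext i
  induction q using Polynomial.induction_on' with
  | add p q hp hq => simp only [mul_add, map_add, Pi.add_apply, hp, hq]
  | monomial e c =>
    rw [X_pow_mul_monomial, X_pow_mul_monomial, wrap_monomial, wrap_monomial]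
    have : (e + a) % N = (e + b) % N := Nat.ModEq.add_left e h
    rw [this]

theorem range_wrap_X_pow_mul_subset (hN : 0 < N) (k : ℕ) (q : F[X]) :
    Set.range (wrap N (X ^ k * q)) ⊆ Set.range (wrap N q) := by
  rintro _ ⟨i, rfl⟩
  rcases lt_or_ge i N with hi | hi
  · exact ⟨_, (wrap_X_pow_mul hN k q hi).symm⟩
  · exact ⟨i, by rw [wrap_eq_zero_of_le hN _ hi, wrap_eq_zero_of_le hN _ hi]⟩

theorem zero_mem_range_wrap (hN : 0 < N) (q : F[X]) : (0 : F) ∈ Set.range (wrap N q) :=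
  ⟨N, wrap_eq_zero_of_le hN q le_rfl⟩

theorem zero_mem_range_coeff (q : F[X]) : (0 : F) ∈ Set.range q.coeff :=
  ⟨q.natDegree + 1, coeff_eq_zero_of_natDegree_lt (by omega)⟩

/-- The coefficients of a product modulo `X ^ N - 1` are cyclic convolutions. -/
theorem wrap_mul (hN : 0 < N) (p q : F[X]) (k : ℕ) :
    wrap N (p * q) k = ∑ i ∈ Finset.range N, ∑ j ∈ Finset.range N,
      if (i + j) % N = k then wrap N p i * wrap N q j else 0 := by
  induction p using Polynomial.induction_on' with
  | add p p' hp hp' =>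
    simp only [add_mul, map_add, Pi.add_apply, hp, hp', ← Finset.sum_add_distrib]
    refine Finset.sum_congr rfl fun i _ => Finset.sum_congr rfl fun j _ => ?_
    split_ifs <;> simp
  | monomial e c =>
    induction q using Polynomial.induction_on' with
    | add q q' hq hq' =>
      simp only [mul_add, map_add, Pi.add_apply, hq, hq', ← Finset.sum_add_distrib]
      refine Finset.sum_congr rfl fun i _ => Finset.sum_congr rfl fun j _ => ?_
      split_ifs <;> simp
    | monomial e' c' =>
      rw [monomial_mul_monomial, wrap_monomial]
      rw [Finset.sum_eq_single (e % N), Finset.sum_eq_single (e' % N)]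
      · simp [wrap_monomial, Nat.add_mod]
      · intro j _ hj
        simp [wrap_monomial, hj.symm]
      · intro h; exact absurd (Finset.mem_range.2 (Nat.mod_lt _ hN)) h
      · intro i _ hi
        simp [wrap_monomial, hi.symm]
      · intro h; exact absurd (Finset.mem_range.2 (Nat.mod_lt _ hN)) h

theorem wrap_mul_congr (hN : 0 < N) {p p' q q' : F[X]} (hp : wrap N p = wrap N p')
    (hq : wrap N q = wrap N q') : wrap N (p * q) = wrap N (p' * q') := by
  ext k
  rw [wrap_mul hN, wrap_mul hN, hp, hq]

theorem wrap_eq_coeff_add_coeff {q : F[X]} (hq : ∀ e, 2 * N ≤ e → q.coeff e = 0)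
    {i : ℕ} (hi : i < N) : wrap N q i = q.coeff i + q.coeff (i + N) := by
  have h2 : q = ∑ e ∈ Finset.range (2 * N), monomial e (q.coeff e) := by
    ext k
    rw [finsetSum_coeff]
    simp only [coeff_monomial]
    rw [Finset.sum_ite_eq']
    split_ifs with h
    · rfl
    · exact hq k (by simpa using h)
  conv_lhs => rw [h2]
  rw [map_sum, Finset.sum_apply]
  simp only [wrap_monomial]
  rw [two_mul, Finset.sum_range_add, Finset.sum_eq_single i, Finset.sum_eq_single i]
  · rw [if_pos (Nat.mod_eq_of_lt hi), add_comm N i, Nat.add_mod_right,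
      if_pos (Nat.mod_eq_of_lt hi)]
  · intro j hj hji
    rw [add_comm, Nat.add_mod_right, Nat.mod_eq_of_lt (by simpa using hj), if_neg hji]
  · simp [hi]
  · intro j hj hji
    rw [Nat.mod_eq_of_lt (by simpa using hj), if_neg hji]
  · simp [hi]

/-- The representative of degree less than `N` modulo `X ^ N - 1`. -/
noncomputable def wrapPoly (N : ℕ) (q : F[X]) : F[X] :=
  ∑ i ∈ Finset.range N, monomial i (wrap N q i)

theorem coeff_wrapPoly (hN : 0 < N) (q : F[X]) : (wrapPoly N q).coeff = wrap N q := by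
  ext k
  rw [wrapPoly, finsetSum_coeff]
  simp only [coeff_monomial]
  rw [Finset.sum_ite_eq']
  split_ifs with h
  · rfl
  · exact (wrap_eq_zero_of_le hN q (by simpa using h)).symm

theorem wrap_wrapPoly (hN : 0 < N) (q : F[X]) : wrap N (wrapPoly N q) = wrap N q := by
  rw [wrap_eq_coeff, coeff_wrapPoly hN]
  intro e he
  rw [coeff_wrapPoly hN, wrap_eq_zero_of_le hN q he]

end Wrap

/-! ### Fourier transforms modulo `X ^ N - 1` -/

section Dft

variable {F : Type*} [Ring F]

/-- The discrete Fourier transform of length `r ^ b`, with `X ^ g` as root of unity. -/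
noncomputable def dft (r b g : ℕ) (α : ℕ → F[X]) (j : ℕ) : F[X] :=
  ∑ i ∈ Finset.range (r ^ b), X ^ (g * (i * j)) * α i

theorem sum_range_mul_eq {M : Type*} [AddCommMonoid M] (r n : ℕ) (f : ℕ → M) :
    ∑ i ∈ Finset.range (n * r), f i =
      ∑ l ∈ Finset.range r, ∑ i ∈ Finset.range n, f (r * i + l) := by
  induction n with
  | zero => simp
  | succ n ih =>
    rw [add_mul, one_mul, Finset.sum_range_add, ih, ← Finset.sum_add_distrib]
    refine Finset.sum_congr rfl fun l _ => ?_
    rw [Finset.sum_range_succ, mul_comm n r]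

theorem dft_succ (r b g : ℕ) (α : ℕ → F[X]) (j : ℕ) :
    dft r (b + 1) g α j =
      ∑ l ∈ Finset.range r, X ^ (g * (l * j)) * dft r b (g * r) (fun i => α (r * i + l)) j := by
  unfold dft
  rw [pow_succ, sum_range_mul_eq]
  refine Finset.sum_congr rfl fun l _ => ?_
  rw [Finset.mul_sum]
  refine Finset.sum_congr rfl fun i _ => ?_
  rw [← mul_assoc (X ^ (g * (l * j))), ← pow_add]
  congr 2
  ring

theorem wrap_dft_mod {N r b g : ℕ} (hN : g * r ^ b = N) (α : ℕ → F[X]) (j : ℕ) :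
    wrap N (dft r b g α j) = wrap N (dft r b g α (j % r ^ b)) := by
  unfold dft
  rw [map_sum, map_sum]
  refine Finset.sum_congr rfl fun i _ => wrap_X_pow_mul_congr ?_ _
  rw [← hN, Nat.mul_mod_mul_left, Nat.mul_mod_mul_left, ← Nat.mul_mod_mod]

/-- The fast Fourier transform: multiplications by powers of `X` only permute the coefficients. -/
theorem derives_dft {N r : ℕ} (hN0 : 0 < N) {S : Set F} (h0 : (0 : F) ∈ S) :
    ∀ (b g : ℕ) (α : ℕ → F[X]), g * r ^ b = N →
      (∀ i < r ^ b, Set.range (wrap N (α i)) ⊆ S) →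
      Derives S (b * r ^ b * r * N) (⋃ j, Set.range (wrap N (dft r b g α j))) := by
  intro b
  induction b with
  | zero =>
    intro g α _ hα
    refine .refl _ (Set.iUnion_subset fun j => ?_)
    simpa [dft] using hα 0 (by simp)
  | succ b ih =>
    intro g α hN hα
    set U : ℕ → Set F := fun l =>
      ⋃ j, Set.range (wrap N (dft r b (g * r) (fun i => α (r * i + l)) j)) with hU
    have h1 : Derives S (r * (b * r ^ b * r * N)) (⋃ l ∈ Finset.range r, U l) := by
      have := Derives.biUnion (S := S) (s := Finset.range r) (T := U)
        (n := b * r ^ b * r * N) (fun l hl => ih (g * r) _ (by rw [← hN]; ring) (fun i hi => hα _ (by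
          have hl' := Finset.mem_range.1 hl
          calc r * i + l < r * i + r := by omega
            _ = r * (i + 1) := by ring
            _ ≤ r * r ^ b := Nat.mul_le_mul_left _ hi
            _ = r ^ (b + 1) := by ring)))
      simpa using this
    have h2 : Derives (S ∪ ⋃ l ∈ Finset.range r, U l) (r ^ (b + 1) * (N * r))
        (⋃ j ∈ Finset.range (r ^ (b + 1)), ⋃ i ∈ Finset.range N,
          {wrap N (dft r (b + 1) g α j) i}) := by
      have := Derives.biUnion (S := S ∪ ⋃ l ∈ Finset.range r, U l)
        (s := Finset.range (r ^ (b + 1)))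
        (T := fun j => ⋃ i ∈ Finset.range N, {wrap N (dft r (b + 1) g α j) i}) (n := N * r)
        (fun j _ => by
          have := Derives.biUnion (S := S ∪ ⋃ l ∈ Finset.range r, U l)
            (s := Finset.range N) (T := fun i => {wrap N (dft r (b + 1) g α j) i}) (n := r)
            (fun i _ => by
              rw [dft_succ, map_sum, Finset.sum_apply]
              refine Derives.sum (F := F) (Or.inl h0) r fun l hl => Or.inr ?_
              simp only [Set.mem_iUnion, hU]
              exact ⟨l, by simpa using hl, j, range_wrap_X_pow_mul_subset hN0 _ _ ⟨i, rfl⟩⟩)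
          simpa using this)
      simpa using this
    have h3 := (h1.keep.trans h2).keep
    refine (h3.subset ?_).mono subset_rfl (le_of_eq ?_)
    · refine Set.iUnion_subset fun j => ?_
      rintro _ ⟨i, rfl⟩
      rcases lt_or_ge i N with hi | hi
      · right
        rw [wrap_dft_mod hN]
        simp only [Set.mem_iUnion]
        refine ⟨j % r ^ (b + 1), ?_, i, by simpa using hi, rfl⟩
        refine Finset.mem_range.2 (Nat.mod_lt _ ?_)
        rcases Nat.eq_zero_or_pos (r ^ (b + 1)) with h | h
        · rw [h, mul_zero] at hN; omega
        · exact h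
      · left; rwa [wrap_eq_zero_of_le hN0 _ hi]
    · ring

theorem sum_range_shift {M : Type*} [AddCommGroup M] {s : ℕ} {φ : ℕ → M}
    (hφ : ∀ j, φ (j + s) = φ j) (k : ℕ) :
    ∑ j ∈ Finset.range s, φ (j + k) = ∑ j ∈ Finset.range s, φ j := by
  induction k with
  | zero => rfl
  | succ k ih =>
    rw [← ih]
    have h1 := Finset.sum_range_succ (fun j => φ (j + k)) s
    have h2 := Finset.sum_range_succ' (fun j => φ (j + k)) s
    rw [h1] at h2
    have h3 : φ (s + k) = φ (0 + k) := by rw [zero_add, add_comm, hφ]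
    rw [h3] at h2
    have := add_right_cancel h2
    rw [this]
    exact Finset.sum_congr rfl fun j _ => by rw [show j + (k + 1) = j + 1 + k by ring]

/-- Orthogonality of the powers of `X`, which is a root of unity of order `N` modulo `X ^ N - 1`.
The factor `1 - X ^ (N / r)` replaces the reduction modulo the cyclotomic polynomial. -/
theorem wrap_sum_eq_zero {N r b g : ℕ} (hr : r.Prime) (hN : g * r ^ (b + 1) = N) {d : ℕ}
    (hd : ¬ r ^ (b + 1) ∣ d) (q : F[X]) :
    wrap N ((1 - X ^ (g * r ^ b)) * ∑ j ∈ Finset.range (r ^ (b + 1)), X ^ (g * (d * j)) * q) =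
      0 := by
  obtain ⟨j₀, hj₀⟩ : ∃ j₀, d * j₀ ≡ r ^ b [MOD r ^ (b + 1)] := by
    obtain ⟨a, ha, hga⟩ := (Nat.dvd_prime_pow hr).1 (Nat.gcd_dvd_right d (r ^ (b + 1)))
    have hab : a ≤ b := by
      by_contra h
      have : a = b + 1 := by omega
      exact hd (by rw [← this, ← hga]; exact Nat.gcd_dvd_left _ _)
    have hpos : 1 < r ^ (b + 1) := Nat.one_lt_pow (by omega) hr.one_lt
    obtain ⟨m, -, hm⟩ := Nat.exists_mul_mod_eq_gcd (n := d) (k := r ^ (b + 1)) (by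
      rw [hga]; exact Nat.pow_lt_pow_right hr.one_lt (by omega))
    refine ⟨m * r ^ (b - a), ?_⟩
    have h1 : d * m ≡ r ^ a [MOD r ^ (b + 1)] := by
      rw [← hga, ← hm]; exact (Nat.mod_modEq _ _).symm
    have h2 := h1.mul_right (r ^ (b - a))
    rwa [← pow_add, Nat.add_sub_cancel' hab, mul_assoc] at h2
  rw [sub_mul, one_mul, map_sub, sub_eq_zero, Finset.mul_sum, map_sum, map_sum]
  have hper : ∀ j, wrap N (X ^ (g * (d * (j + r ^ (b + 1)))) * q) =
      wrap N (X ^ (g * (d * j)) * q) := fun j => wrap_X_pow_mul_congr (by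
    rw [← hN, Nat.mul_mod_mul_left, Nat.mul_mod_mul_left, mul_add, Nat.add_mul_mod_self_right]) _
  have := sum_range_shift (φ := fun j => wrap N (X ^ (g * (d * j)) * q)) hper j₀
  rw [← this]
  refine Finset.sum_congr rfl fun j _ => ?_
  rw [← mul_assoc (X ^ (g * r ^ b)), ← pow_add]
  refine wrap_X_pow_mul_congr ?_ _
  rw [← hN, ← mul_add, Nat.mul_mod_mul_left, Nat.mul_mod_mul_left, mul_add]
  congr 1
  rw [add_comm]
  exact hj₀.add_right _

theorem wrap_sum_eq_nsmul {N s g d : ℕ} (hN : g * s = N) (hd : s ∣ d) (q : F[X]) :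
    wrap N (∑ j ∈ Finset.range s, X ^ (g * (d * j)) * q) = s • wrap N q := by
  rw [map_sum, Finset.sum_congr rfl (g := fun _ => wrap N q), Finset.sum_const, Finset.card_range]
  intro j _
  have := wrap_X_pow_mul_congr (F := F) (N := N) (a := g * (d * j)) (b := 0) (by
    obtain ⟨e, rfl⟩ := hd
    rw [← hN, show g * (s * e * j) = g * s * (e * j) by ring]
    simp) q
  simpa using this

end Dft

/-! ### Fast multiplication of polynomials -/

section PolyMul

variable {F : Type*} [Ring F]

/-- The `i`-th block of `t` consecutive coefficients of `a`, as a polynomial of degree less than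
`t`; thus `a = ∑ X ^ (t * i) * block t a i`. -/
noncomputable def block (t : ℕ) (a : F[X]) (i : ℕ) : F[X] :=
  ∑ l ∈ Finset.range t, monomial l (a.coeff (t * i + l))

/-- The `i`-th coefficient of the product of `a` and `b`, read as polynomials in `Y = X ^ t` whose
coefficients are their blocks. -/
noncomputable def blockMul (t : ℕ) (a b : F[X]) (i : ℕ) : F[X] :=
  ∑ x ∈ Finset.HasAntidiagonal.antidiagonal i, block t a x.1 * block t b x.2

theorem coeff_block (t : ℕ) (a : F[X]) (i k : ℕ) :
    (block t a i).coeff k = if k < t then a.coeff (t * i + k) else 0 := by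
  rw [block, finsetSum_coeff]
  simp only [coeff_monomial]
  rw [Finset.sum_ite_eq']
  simp

theorem block_add (t : ℕ) (a b : F[X]) (i : ℕ) :
    block t (a + b) i = block t a i + block t b i := by
  ext k
  simp only [coeff_block, coeff_add]
  split_ifs <;> simp

theorem block_monomial {t : ℕ} (ht : 0 < t) (e : ℕ) (c : F) (i : ℕ) :
    block t (monomial e c) i = if i = e / t then monomial (e % t) c else 0 := by
  ext k
  have key : (k < t ∧ e = t * i + k) ↔ (i = e / t ∧ e % t = k) := by
    constructor
    · rintro ⟨hk, rfl⟩
      rw [Nat.mul_add_div ht, Nat.mul_add_mod, Nat.div_eq_of_lt hk, Nat.mod_eq_of_lt hk]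
      simp
    · rintro ⟨rfl, rfl⟩
      exact ⟨Nat.mod_lt _ ht, (Nat.div_add_mod e t).symm⟩
  rw [coeff_block, coeff_monomial, ← ite_and, if_congr key rfl rfl, ite_and]
  split_ifs <;> simp [coeff_monomial, *]

theorem block_eq_zero {t n : ℕ} {a : F[X]} (ha : ∀ e, t * n ≤ e → a.coeff e = 0) {i : ℕ}
    (hi : n ≤ i) : block t a i = 0 := by
  ext k
  rw [coeff_block, coeff_zero]
  split_ifs
  · exact ha _ (le_add_right (Nat.mul_le_mul_left t hi))
  · rfl

/-- A coefficient of a product has contributions from two neighbouring indices only, because the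
coefficients of `Y ^ i` in the block product are polynomials of degree less than `2 t`. -/
theorem coeff_mul_eq_blockMul {t : ℕ} (ht : 0 < t) (a b : F[X]) (k : ℕ) :
    (a * b).coeff k = (blockMul t a b (k / t)).coeff (k % t) +
      if 1 ≤ k / t then (blockMul t a b (k / t - 1)).coeff (k % t + t) else 0 := by
  induction a using Polynomial.induction_on' with
  | add a a' h h' =>
    simp only [blockMul, block_add, add_mul, Finset.sum_add_distrib, coeff_add] at h h' ⊢
    rw [h, h']
    split_ifs <;> simp <;> abel
  | monomial e c =>
    induction b using Polynomial.induction_on' with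
    | add b b' h h' =>
      simp only [blockMul, block_add, mul_add, Finset.sum_add_distrib, coeff_add] at h h' ⊢
      rw [h, h']
      split_ifs <;> simp <;> abel
    | monomial e' c' =>
      have key : ∀ i, blockMul t (monomial e c) (monomial e' c') i =
          if i = e / t + e' / t then monomial (e % t + e' % t) (c * c') else 0 := by
        intro i
        unfold blockMul
        simp only [block_monomial ht]
        split_ifs with h
        · rw [Finset.sum_eq_single (e / t, e' / t)]
          · simp [monomial_mul_monomial]
          · rintro ⟨u, v⟩ _ hne
            by_cases h1 : u = e / t
            · have h2 : v ≠ e' / t := fun h2 => hne (by rw [h1, h2])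
              simp [h2]
            · simp [h1]
          · intro h'; simp [h] at h'
        · refine Finset.sum_eq_zero ?_
          rintro ⟨u, v⟩ huv
          rw [Finset.HasAntidiagonal.mem_antidiagonal] at huv
          by_cases h1 : u = e / t
          · have h2 : v ≠ e' / t := fun h2 => h (by simp only at huv; omega)
            simp [h2]
          · simp [h1]
      rw [monomial_mul_monomial, coeff_monomial, key, key]
      have hk := Nat.div_add_mod k t
      have he := Nat.div_add_mod e t
      have he' := Nat.div_add_mod e' t
      have hkt := Nat.mod_lt k ht
      have het := Nat.mod_lt e ht
      have het' := Nat.mod_lt e' ht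
      by_cases hc : e + e' = k
      · have h1 := Nat.add_div (a := e) (b := e') ht
        have h2 := Nat.add_mod e e' t
        rw [hc] at h1 h2
        rw [if_pos hc]
        by_cases hcar : t ≤ e % t + e' % t
        · rw [if_pos hcar] at h1
          have g1 : ¬ k / t = e / t + e' / t := by rw [h1]; exact (Nat.lt_succ_self _).ne'
          have g2 : 1 ≤ k / t := by rw [h1]; exact Nat.le_add_left _ _
          have g3 : k / t - 1 = e / t + e' / t := by omega
          rw [if_neg g1, if_pos g2, if_pos g3]
          have : k % t + t = e % t + e' % t := by
            rw [h2, Nat.mod_eq_sub_mod hcar, Nat.mod_eq_of_lt (by omega)]; omega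
          simp [this]
        · rw [if_neg hcar] at h1
          have g1 : k / t = e / t + e' / t := by omega
          have g2 : (e % t + e' % t) % t = e % t + e' % t := Nat.mod_eq_of_lt (by omega)
          rw [if_pos g1, coeff_monomial, if_pos (by rw [h2, g2])]
          split_ifs with h3 h4
          · omega
          · simp
          · simp
      · rw [if_neg hc]
        have h1 : ¬ (k / t = e / t + e' / t ∧ e % t + e' % t = k % t) := by
          rintro ⟨h1, h2⟩
          rw [h1, mul_add] at hk
          omega
        have h2 : ¬ (1 ≤ k / t ∧ k / t - 1 = e / t + e' / t ∧ e % t + e' % t = k % t + t) := by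
          rintro ⟨h0, h1, h2⟩
          rw [show k / t = e / t + e' / t + 1 by omega, mul_add, mul_add] at hk
          omega
        have h3 : (if k / t = e / t + e' / t then monomial (e % t + e' % t) (c * c')
            else 0).coeff (k % t) = 0 := by
          rw [apply_ite (fun p : F[X] => p.coeff (k % t)), coeff_monomial, coeff_zero, ← ite_and,
            if_neg h1]
        have h4 : (if 1 ≤ k / t then (if k / t - 1 = e / t + e' / t then
            monomial (e % t + e' % t) (c * c') else 0).coeff (k % t + t) else 0) = 0 := by
          rw [apply_ite (fun p : F[X] => p.coeff (k % t + t)), coeff_monomial, coeff_zero,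
            ← ite_and, ← ite_and, if_neg (by rwa [and_assoc])]
        rw [h3, h4, add_zero]

theorem sum_range_ite_add_eq {M : Type*} [AddCommMonoid M] {s i : ℕ} (hi : i < s)
    (f : ℕ → ℕ → M) :
    (∑ u ∈ Finset.range s, ∑ v ∈ Finset.range s, if u + v = i then f u v else 0) =
      ∑ x ∈ Finset.HasAntidiagonal.antidiagonal i, f x.1 x.2 := by
  rw [← Finset.sum_product', ← Finset.sum_filter]
  refine Finset.sum_congr ?_ fun _ _ => rfl
  ext ⟨u, v⟩
  simp only [Finset.mem_filter, Finset.mem_product, Finset.mem_range,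
    Finset.HasAntidiagonal.mem_antidiagonal]
  omega

/-- Polynomials of degree less than `n` over `F` can be multiplied, up to the factor `c`, with `M`
operations in `F`. -/
def PolyMulCost (F : Type*) [Ring F] (n c M : ℕ) : Prop :=
  ∀ a b : F[X], (∀ e, n ≤ e → a.coeff e = 0) → (∀ e, n ≤ e → b.coeff e = 0) →
    Derives (Set.range a.coeff ∪ Set.range b.coeff) M (Set.range (c • (a * b)).coeff)

theorem coeff_mul_eq_zero {a b : F[X]} {m n : ℕ} (ha : ∀ e, m ≤ e → a.coeff e = 0)
    (hb : ∀ e, n ≤ e → b.coeff e = 0) {e : ℕ} (he : m + n ≤ e) : (a * b).coeff e = 0 := by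
  rw [coeff_mul]
  refine Finset.sum_eq_zero ?_
  rintro ⟨u, v⟩ h
  rw [Finset.HasAntidiagonal.mem_antidiagonal] at h
  simp only at h ⊢
  rcases le_or_gt m u with h1 | h1
  · rw [ha u h1, zero_mul]
  · rw [hb v (by omega), mul_zero]

/-- The school method. -/
theorem polyMulCost_school (n : ℕ) : PolyMulCost F n 1 (3 * n ^ 2) := by
  intro a b ha hb
  set S := Set.range a.coeff ∪ Set.range b.coeff
  have h0 : (0 : F) ∈ S := Or.inl (zero_mem_range_coeff a)
  have h1 : Derives S (n * (n * 1)) (⋃ i ∈ Finset.range n, ⋃ j ∈ Finset.range n,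
      {a.coeff i * b.coeff j}) := by
    have := Derives.biUnion (S := S) (s := Finset.range n)
      (T := fun i => ⋃ j ∈ Finset.range n, {a.coeff i * b.coeff j}) (n := n * 1) (fun i _ => by
        have := Derives.biUnion (S := S) (s := Finset.range n)
          (T := fun j => {a.coeff i * b.coeff j}) (n := 1)
          (fun j _ => Derives.mul (Or.inl ⟨i, rfl⟩) (Or.inr ⟨j, rfl⟩))
        simpa using this)
    simpa using this
  set S' := S ∪ ⋃ i ∈ Finset.range n, ⋃ j ∈ Finset.range n, {a.coeff i * b.coeff j} with hS'
  have h2 : Derives S' (2 * n * n) (⋃ k ∈ Finset.range (2 * n), {(a * b).coeff k}) := by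
    have := Derives.biUnion (S := S') (s := Finset.range (2 * n))
      (T := fun k => {(a * b).coeff k}) (n := n) (fun k _ => by
        have : (a * b).coeff k =
            ∑ i ∈ Finset.range n, if i ≤ k then a.coeff i * b.coeff (k - i) else 0 := by
          rw [coeff_mul, Finset.Nat.sum_antidiagonal_eq_sum_range_succ_mk, ← Finset.sum_filter]
          symm
          apply Finset.sum_subset_zero_on_sdiff
          · intro i; simp only [Finset.mem_filter, Finset.mem_range]; omega
          · intro i; simp only [Finset.mem_filter, Finset.mem_range, Finset.mem_sdiff]
            intro hi
            rw [ha i (by omega), zero_mul]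
          · intro i _; rfl
        rw [this]
        refine Derives.sum (F := F) (Or.inl h0) n fun i hi => ?_
        split_ifs with hik
        · rcases lt_or_ge (k - i) n with h | h
          · right
            simp only [Set.mem_iUnion]
            exact ⟨i, by simpa using hi, k - i, by simpa using h, rfl⟩
          · left; rwa [hb _ h, mul_zero]
        · exact Or.inl h0)
    simpa using this
  refine ((h1.keep.trans h2.keep).subset ?_).mono subset_rfl (by nlinarith)
  rintro _ ⟨k, rfl⟩
  rw [one_smul]
  rcases lt_or_ge k (2 * n) with hk | hk
  · right
    simp only [Set.mem_iUnion]
    exact ⟨k, by simpa using hk, rfl⟩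
  · left; left
    rwa [coeff_mul_eq_zero ha hb (by omega)]

/-- Multiplication modulo `X ^ N - 1`. -/
theorem PolyMulCost.derives_wrap {n c M N : ℕ} (h : PolyMulCost F n c M) (hN : 0 < N) (hNn : N ≤ n)
    (p q : F[X]) :
    Derives (Set.range (wrap N p) ∪ Set.range (wrap N q)) (M + N)
      (Set.range (wrap N (c • (p * q)))) := by
  have hz : ∀ (p : F[X]) e, N ≤ e → (wrapPoly N p).coeff e = 0 := fun p e he => by
    rw [coeff_wrapPoly hN, wrap_eq_zero_of_le hN p he]
  have h1 := h (wrapPoly N p) (wrapPoly N q) (fun e he => hz p e (hNn.trans he))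
    (fun e he => hz q e (hNn.trans he))
  rw [coeff_wrapPoly hN, coeff_wrapPoly hN] at h1
  set y := c • (wrapPoly N p * wrapPoly N q) with hy
  have hy0 : ∀ e, 2 * N ≤ e → y.coeff e = 0 := fun e he => by
    rw [hy, coeff_smul, coeff_mul_eq_zero (hz p) (hz q) (by omega), smul_zero]
  have hw : wrap N (c • (p * q)) = wrap N y := by
    rw [hy, map_nsmul, map_nsmul,
      wrap_mul_congr hN (wrap_wrapPoly hN p).symm (wrap_wrapPoly hN q).symm]
  have h2 : Derives (Set.range y.coeff) N (⋃ i ∈ Finset.range N, {wrap N y i}) := by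
    have := Derives.biUnion (S := Set.range y.coeff) (s := Finset.range N)
      (T := fun i => {wrap N y i}) (n := 1) (fun i hi => by
        rw [wrap_eq_coeff_add_coeff hy0 (Finset.mem_range.1 hi)]
        exact Derives.add ⟨i, rfl⟩ ⟨i + N, rfl⟩)
    simpa using this
  refine (h1.trans h2).keep.subset ?_
  rw [hw]
  rintro _ ⟨i, rfl⟩
  rcases lt_or_ge i N with hi | hi
  · right
    simp only [Set.mem_iUnion]
    exact ⟨i, by simpa using hi, rfl⟩
  · left; left
    rw [wrap_eq_zero_of_le hN _ hi]
    exact zero_mem_range_wrap hN p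

/-- The inverse Fourier transform of the pointwise product of two Fourier transforms. -/
theorem wrap_dft_mul {N r b g c : ℕ} (hr : r.Prime) (hN : g * r ^ (b + 1) = N) (α β : ℕ → F[X])
    {m : ℕ} (hm : 2 * m ≤ r ^ (b + 1)) (hα : ∀ u, m ≤ u → α u = 0) (hβ : ∀ v, m ≤ v → β v = 0)
    {i : ℕ} (hi : i < r ^ (b + 1)) :
    wrap N ((1 - X ^ (g * r ^ b)) * dft r (b + 1) g
      (fun j => c • (dft r (b + 1) g α j * dft r (b + 1) g β j)) (r ^ (b + 1) - i)) =
    (c * r ^ (b + 1)) • wrap N ((1 - X ^ (g * r ^ b)) *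
      ∑ x ∈ Finset.HasAntidiagonal.antidiagonal i, α x.1 * β x.2) := by
  set s := r ^ (b + 1) with hs
  set κ : F[X] := 1 - X ^ (g * r ^ b) with hκ
  have e1 : dft r (b + 1) g (fun j => c • (dft r (b + 1) g α j * dft r (b + 1) g β j)) (s - i) =
      c • ∑ u ∈ Finset.range s, ∑ v ∈ Finset.range s, ∑ j ∈ Finset.range s,
        X ^ (g * ((u + v + (s - i)) * j)) * (α u * β v) := by
    unfold dft
    rw [← hs, Finset.smul_sum]
    have : ∀ j, X ^ (g * (j * (s - i))) * c • ((∑ u ∈ Finset.range s, X ^ (g * (u * j)) * α u) *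
        ∑ v ∈ Finset.range s, X ^ (g * (v * j)) * β v) = ∑ u ∈ Finset.range s,
          ∑ v ∈ Finset.range s, c • (X ^ (g * ((u + v + (s - i)) * j)) * (α u * β v)) := by
      intro j
      rw [Finset.sum_mul_sum, mul_smul_comm, Finset.mul_sum, Finset.smul_sum]
      refine Finset.sum_congr rfl fun u _ => ?_
      rw [Finset.mul_sum, Finset.smul_sum]
      refine Finset.sum_congr rfl fun v _ => ?_
      congr 1
      have : α u * X ^ (g * (v * j)) = X ^ (g * (v * j)) * α u := (X_pow_mul).symm
      rw [mul_assoc (X ^ (g * (u * j))), ← mul_assoc (α u), this, mul_assoc (X ^ (g * (v * j))),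
        ← mul_assoc (X ^ (g * (u * j))), ← pow_add, ← mul_assoc, ← pow_add]
      congr 2
      ring
    rw [Finset.sum_congr rfl fun j _ => this j, Finset.sum_comm]
    refine Finset.sum_congr rfl fun u _ => ?_
    rw [Finset.sum_comm, Finset.smul_sum]
    refine Finset.sum_congr rfl fun v _ => ?_
    rw [Finset.smul_sum]
  rw [e1, mul_smul_comm, map_nsmul, Finset.mul_sum, map_sum, mul_smul]
  congr 1
  rw [← sum_range_ite_add_eq hi (fun u v => α u * β v), Finset.mul_sum, map_sum, Finset.smul_sum]
  refine Finset.sum_congr rfl fun u _ => ?_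
  rw [Finset.mul_sum, Finset.mul_sum, map_sum, map_sum, Finset.smul_sum]
  refine Finset.sum_congr rfl fun v _ => ?_
  by_cases huv : m ≤ u ∨ m ≤ v
  · have : α u * β v = 0 := by
      rcases huv with h | h
      · rw [hα u h, zero_mul]
      · rw [hβ v h, mul_zero]
    simp [this]
  · push Not at huv
    split_ifs with h
    · have hd : s ∣ u + v + (s - i) := by rw [h, Nat.add_sub_cancel' hi.le]
      have hcomm : κ * ∑ j ∈ Finset.range s, X ^ (g * ((u + v + (s - i)) * j)) * (α u * β v) =
          ∑ j ∈ Finset.range s, X ^ (g * ((u + v + (s - i)) * j)) * (κ * (α u * β v)) := by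
        rw [Finset.mul_sum]
        refine Finset.sum_congr rfl fun j _ => ?_
        rw [← mul_assoc κ, ← mul_assoc _ κ, X_pow_mul]
      rw [hcomm, wrap_sum_eq_nsmul hN hd]
    · rw [wrap_sum_eq_zero hr hN, mul_zero, map_zero, smul_zero]
      rintro ⟨e, he⟩
      rw [← hs] at he
      have h1 : u + v < s := by omega
      rcases Nat.lt_or_ge e 2 with h2 | h2
      · interval_cases e
        · omega
        · omega
      · have : s * 2 ≤ s * e := Nat.mul_le_mul_left s h2
        omega

end PolyMul

section PolyMulFast

variable {F : Type*} [Ring F]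

/-- One level of the recursion of Schönhage and Strassen: the product of two polynomials of degree
less than `r ^ k` is reduced to about `r ^ (k / 2)` products of degree about `r ^ (k / 2)`. The
factors are cut into blocks of `t = r ^ (k / 2)` coefficients, and the polynomials in `Y = X ^ t`
with these coefficients are multiplied by Fourier transforms of length `s` modulo `X ^ N - 1`, where
`N = r ^ (k / 2 + 2)` and `X ^ (N / s)` is the root of unity. -/
theorem PolyMulCost.step {r k c M : ℕ} (hr : r.Prime)
    (h : PolyMulCost F (r ^ (k / 2 + 2)) c M) :
    PolyMulCost F (r ^ k) (c * r ^ (k - k / 2 + 1))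
      (3 * ((k - k / 2 + 1) * r ^ (k - k / 2 + 1) * r * r ^ (k / 2 + 2)) +
        r ^ (k - k / 2 + 1) * (M + r ^ (k / 2 + 2)) +
        r ^ (k - k / 2 + 1) * r ^ (k / 2 + 2) + 2 * r ^ k) := by
  intro a b ha hb
  obtain ⟨e, hh⟩ : ∃ e, e = k / 2 := ⟨_, rfl⟩
  obtain ⟨w, hw⟩ : ∃ w, w = k - k / 2 := ⟨_, rfl⟩
  rw [← hw, ← hh]
  rw [← hh] at h
  have hew : e + w = k := by omega
  have hle : w ≤ e + 1 := by omega
  set t := r ^ e with ht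
  set m := r ^ w with hm
  set s := r ^ (w + 1) with hs
  set N := r ^ (e + 2) with hN
  set g := r ^ (e + 1 - w) with hg
  have hr2 := hr.two_le
  have ht0 : 0 < t := pow_pos hr.pos _
  have hN0 : 0 < N := pow_pos hr.pos _
  have hgs : g * s = N := by rw [hg, hs, hN, ← pow_add]; congr 1; omega
  have hms : 2 * m ≤ s := by
    rw [hs, hm, pow_succ, mul_comm]; exact Nat.mul_le_mul_left _ hr2
  have hκ : g * r ^ w = r * t := by
    rw [hg, ht, ← pow_add, ← pow_succ']; congr 1; omega
  have htN : 2 * (r * t) ≤ N := by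
    rw [hN, ht, ← pow_succ', pow_succ r (e + 1), mul_comm]; exact Nat.mul_le_mul_left _ hr2
  have h2t : 2 * t ≤ r * t := Nat.mul_le_mul_right _ hr2
  have htm : t * m = r ^ k := by rw [ht, hm, ← pow_add, hew]
  have hα0 : ∀ u, m ≤ u → block t a u = 0 := fun u hu => block_eq_zero (by rwa [htm]) hu
  have hβ0 : ∀ u, m ≤ u → block t b u = 0 := fun u hu => block_eq_zero (by rwa [htm]) hu
  set S₀ := Set.range a.coeff ∪ Set.range b.coeff with hS₀
  have h0 : (0 : F) ∈ S₀ := Or.inl (zero_mem_range_coeff a)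
  have hwr : ∀ (a : F[X]) i, wrap N (block t a i) = (block t a i).coeff := fun a i =>
    wrap_eq_coeff fun k hk => by rw [coeff_block, if_neg (by omega)]
  -- the transforms of the two factors
  have h1 := derives_dft (S := S₀) hN0 h0 (w + 1) g (block t a) hgs (by
    rintro i _ _ ⟨k, rfl⟩
    rw [hwr, coeff_block]
    split_ifs
    · exact Or.inl ⟨_, rfl⟩
    · exact h0)
  have h2 := derives_dft (S := S₀) hN0 h0 (w + 1) g (block t b) hgs (by
    rintro i _ _ ⟨k, rfl⟩
    rw [hwr, coeff_block]
    split_ifs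
    · exact Or.inr ⟨_, rfl⟩
    · exact h0)
  have h3 := (h1.union h2).keep
  set S₁ := S₀ ∪ ((⋃ j, Set.range (wrap N (dft r (w + 1) g (block t a) j))) ∪
    ⋃ j, Set.range (wrap N (dft r (w + 1) g (block t b) j))) with hS₁
  -- the pointwise products
  set Γ : ℕ → F[X] := fun j =>
    c • (dft r (w + 1) g (block t a) j * dft r (w + 1) g (block t b) j) with hΓ
  have h4 : Derives S₁ (s * (M + N)) (⋃ j ∈ Finset.range s, Set.range (wrap N (Γ j))) := by
    have := Derives.biUnion (S := S₁) (s := Finset.range s)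
      (T := fun j => Set.range (wrap N (Γ j))) (n := M + N) (fun j _ =>
        (h.derives_wrap hN0 le_rfl _ _).mono (Set.union_subset
          ((Set.subset_iUnion (fun j => Set.range (wrap N (dft r (w + 1) g (block t a) j))) j).trans
            (Set.subset_union_left.trans Set.subset_union_right))
          ((Set.subset_iUnion (fun j => Set.range (wrap N (dft r (w + 1) g (block t b) j))) j).trans
            (Set.subset_union_right.trans Set.subset_union_right))) le_rfl)
    simpa using this
  have h5 := h4.keep
  set S₂ := S₁ ∪ ⋃ j ∈ Finset.range s, Set.range (wrap N (Γ j)) with hS₂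
  have h02 : (0 : F) ∈ S₂ := Or.inl (Or.inl h0)
  -- the inverse transform
  have h6 := (derives_dft (S := S₂) hN0 h02 (w + 1) g Γ hgs (by
    intro i hi
    exact (Set.subset_biUnion_of_mem (u := fun j => Set.range (wrap N (Γ j)))
      (Finset.mem_coe.2 (Finset.mem_range.2 hi))).trans Set.subset_union_right)).keep
  set S₃ := S₂ ∪ ⋃ j, Set.range (wrap N (dft r (w + 1) g Γ j)) with hS₃
  set κ : F[X] := 1 - X ^ (g * r ^ w) with hκd
  have h7 : Derives S₃ (s * N) (⋃ i ∈ Finset.range s, ⋃ l ∈ Finset.range N,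
      {wrap N (κ * dft r (w + 1) g Γ (s - i)) l}) := by
    have := Derives.biUnion (S := S₃) (s := Finset.range s)
      (T := fun i => ⋃ l ∈ Finset.range N, {wrap N (κ * dft r (w + 1) g Γ (s - i)) l}) (n := N)
      (fun i _ => by
        have := Derives.biUnion (S := S₃) (s := Finset.range N)
          (T := fun l => {wrap N (κ * dft r (w + 1) g Γ (s - i)) l}) (n := 1) (fun l _ => by
            have e1 : Set.range (wrap N (dft r (w + 1) g Γ (s - i))) ⊆ S₃ :=
              (Set.subset_iUnion (fun j => Set.range (wrap N (dft r (w + 1) g Γ j))) (s - i)).trans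
                Set.subset_union_right
            rw [hκd, sub_mul, one_mul, map_sub, Pi.sub_apply]
            exact Derives.sub (e1 ⟨l, rfl⟩)
              (e1 (range_wrap_X_pow_mul_subset hN0 _ _ ⟨l, rfl⟩)))
        simpa using this)
    simpa using this
  have h8 := h7.keep
  set S₄ := S₃ ∪ ⋃ i ∈ Finset.range s, ⋃ l ∈ Finset.range N,
      {wrap N (κ * dft r (w + 1) g Γ (s - i)) l} with hS₄
  have h04 : (0 : F) ∈ S₄ := Or.inl (Or.inl h02)
  have hdeg : ∀ i l, 2 * t ≤ l → (blockMul t a b i).coeff l = 0 := by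
    intro i l hl
    rw [blockMul, finsetSum_coeff]
    refine Finset.sum_eq_zero fun x _ => ?_
    refine coeff_mul_eq_zero (m := t) (n := t) ?_ ?_ (by omega) <;>
    · intro e he
      rw [coeff_block, if_neg (by omega)]
  -- `N` is so large that `1 - X ^ (r * t)` times a block product does not wrap around; as block
  -- products have degree less than `2 * t ≤ r * t`, the low coefficients are those of the latter
  have h9 : ∀ i < s, ∀ l < 2 * t, (c * s) • (blockMul t a b i).coeff l ∈ S₄ := by
    intro i hi l hl
    right
    simp only [Set.mem_iUnion, Finset.mem_range, Set.mem_singleton_iff]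
    refine ⟨i, hi, l, by omega, ?_⟩
    rw [hκd, hΓ, wrap_dft_mul hr hgs _ _ hms hα0 hβ0 hi, Pi.smul_apply]
    congr 1
    have e1 : ∀ e, N ≤ e → ((1 - X ^ (g * r ^ w)) * blockMul t a b i).coeff e = 0 := by
      intro e he
      rw [sub_mul, one_mul, coeff_sub, hdeg i e (by omega), X_pow_mul, coeff_mul_X_pow',
        if_pos (by rw [hκ]; omega), hdeg i _ (by rw [hκ]; omega), sub_zero]
    change _ = wrap N ((1 - X ^ (g * r ^ w)) * blockMul t a b i) l
    rw [wrap_eq_coeff e1, sub_mul, one_mul, coeff_sub, X_pow_mul, coeff_mul_X_pow',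
      if_neg (by rw [hκ]; omega), sub_zero]
  -- overlapping the blocks of the product
  have h10 : Derives S₄ (2 * r ^ k) (⋃ l ∈ Finset.range (2 * r ^ k),
      {((c * s) • (a * b)).coeff l}) := by
    have := Derives.biUnion (S := S₄) (s := Finset.range (2 * r ^ k))
      (T := fun l => {((c * s) • (a * b)).coeff l}) (n := 1) (fun l hl => by
        have hl' : l / t < s := by
          refine (Nat.div_lt_iff_lt_mul ht0).2 ?_
          have := Finset.mem_range.1 hl
          calc l < 2 * r ^ k := this
            _ = (2 * m) * t := by rw [← htm]; ring
            _ ≤ s * t := Nat.mul_le_mul_right _ hms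
        have hlt := Nat.mod_lt l ht0
        rw [coeff_smul, coeff_mul_eq_blockMul ht0, smul_add]
        refine Derives.add (h9 _ hl' _ (by omega)) ?_
        split_ifs
        · exact h9 _ (by omega) _ (by omega)
        · rwa [smul_zero])
    simpa using this
  refine (((((h3.trans h5).trans h6).trans h8).trans h10.keep).subset ?_).mono subset_rfl
    (le_of_eq ?_)
  · rintro _ ⟨l, rfl⟩
    rcases lt_or_ge l (2 * r ^ k) with hl | hl
    · right
      simp only [Set.mem_iUnion]
      exact ⟨l, by simpa using hl, rfl⟩
    · left
      rwa [coeff_smul, coeff_mul_eq_zero ha hb (by omega), smul_zero]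
  · rw [← hs]; ring

/-- Multiplication up to a power of `r` with quasi-linearly many operations. The recursion
`k ↦ k / 2 + 2` has the fixed point `4` and at least halves `k - 4`. A level multiplies the cost per
coefficient by `r ^ 3 ≤ 27`, which is less than `2 ^ 6`: hence the exponent `6`. -/
theorem exists_polyMulCost {r : ℕ} (hr : r.Prime) (hr3 : r ≤ 3) (k : ℕ) :
    ∃ e ≤ 12 * k, PolyMulCost F (r ^ k) (r ^ e) (10000 * (100 * (k - 4) ^ 6 + 1) * r ^ k) := by
  induction k using Nat.strong_induction_on with
  | _ k ih =>
    rcases le_or_gt k 4 with hk | hk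
    · refine ⟨0, by omega, fun a b ha hb => ?_⟩
      rw [pow_zero]
      refine (polyMulCost_school _ a b ha hb).mono subset_rfl ?_
      have : r ^ k ≤ 3 ^ 4 :=
        (Nat.pow_le_pow_left hr3 k).trans (Nat.pow_le_pow_right (by norm_num) hk)
      calc 3 * (r ^ k) ^ 2 = 3 * r ^ k * r ^ k := by ring
        _ ≤ 10000 * (100 * (k - 4) ^ 6 + 1) * r ^ k := Nat.mul_le_mul_right _ (by omega)
    · obtain ⟨e, he, h⟩ := ih (k / 2 + 2) (by omega)
      refine ⟨e + (k - k / 2 + 1), by omega, fun a b ha hb => ?_⟩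
      have := h.step (k := k) hr
      rw [← pow_add] at this
      refine (this a b ha hb).mono subset_rfl ?_
      obtain ⟨κ, hκ⟩ : ∃ κ, κ = k - 4 := ⟨_, rfl⟩
      obtain ⟨κ', hκ'⟩ : ∃ κ', κ' = k / 2 + 2 - 4 := ⟨_, rfl⟩
      rw [← hκ, ← hκ']
      have e1 : r ^ (k - k / 2 + 1) * r ^ (k / 2 + 2) = r ^ 3 * r ^ k := by
        rw [← pow_add, ← pow_add]; congr 1; omega
      have e2 : 3 * ((k - k / 2 + 1) * r ^ (k - k / 2 + 1) * r * r ^ (k / 2 + 2)) =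
          3 * (k - k / 2 + 1) * r * (r ^ 3 * r ^ k) := by rw [← e1]; ring
      have e3 : r ^ (k - k / 2 + 1) * (10000 * (100 * κ' ^ 6 + 1) * r ^ (k / 2 + 2) +
          r ^ (k / 2 + 2)) = (10000 * (100 * κ' ^ 6 + 1) + 1) * (r ^ 3 * r ^ k) := by
        rw [← e1]; ring
      rw [e1, e2, e3]
      have hr27 : r ^ 3 ≤ 27 := (Nat.pow_le_pow_left hr3 3)
      have hκ1 : 1 ≤ κ := by omega
      have hκκ : 2 * κ' ≤ κ := by omega
      have hp6 : 64 * κ' ^ 6 ≤ κ ^ 6 := by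
        calc 64 * κ' ^ 6 = (2 * κ') ^ 6 := by ring
          _ ≤ κ ^ 6 := Nat.pow_le_pow_left hκκ 6
      have hle : κ ≤ κ ^ 6 := Nat.le_self_pow (by norm_num) κ
      have hA : 3 * (k - k / 2 + 1) * r ≤ 9 * (κ + 5) := by
        calc 3 * (k - k / 2 + 1) * r ≤ 3 * (κ + 5) * 3 :=
              Nat.mul_le_mul (by omega) hr3
          _ = 9 * (κ + 5) := by ring
      calc 3 * (k - k / 2 + 1) * r * (r ^ 3 * r ^ k) +
            (10000 * (100 * κ' ^ 6 + 1) + 1) * (r ^ 3 * r ^ k) + r ^ 3 * r ^ k + 2 * r ^ k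
          = ((3 * (k - k / 2 + 1) * r + (10000 * (100 * κ' ^ 6 + 1) + 1) + 1) * r ^ 3 + 2) *
              r ^ k := by ring
        _ ≤ ((9 * (κ + 5) + (10000 * (100 * κ' ^ 6 + 1) + 1) + 1) * 27 + 2) * r ^ k := by
              gcongr
        _ ≤ 10000 * (100 * κ ^ 6 + 1) * r ^ k := by
              refine Nat.mul_le_mul_right _ ?_
              nlinarith

end PolyMulFast

/-! ### Programs for cyclic convolutions -/

/-- A program that loads a list of inputs. -/
theorem exists_slp_inputs {K ι A : Type*} [Ring A] (κ : K → A) (x : ι → A) (l : List ι) :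
    ∃ P : SLP K ι l.length, ∀ i ∈ l, x i ∈ Set.range (P.eval κ x) := by
  induction l with
  | nil => exact ⟨.nil, by simp⟩
  | cons i l ih =>
    obtain ⟨P, hP⟩ := ih
    refine ⟨P.snoc (.input i), ?_⟩
    intro j hj
    rcases List.mem_cons.1 hj with rfl | hj
    · exact ⟨Fin.last _, by simp [SLP.eval, SLP.lineEval]⟩
    · obtain ⟨k, hk⟩ := hP j hj
      exact ⟨k.castSucc, by simp [SLP.eval, hk]⟩

/-- Bézout coefficients of moderate size. -/
theorem exists_bezout_le {m n : ℕ} (hn : 0 < n) (h : Nat.Coprime m n) :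
    ∃ u v : ℤ, u * m + v * n = 1 ∧ u.natAbs ≤ n ∧ v.natAbs ≤ m + 1 := by
  have hn' : (0 : ℤ) < n := by exact_mod_cast hn
  have hb := Nat.gcd_eq_gcd_ab m n
  rw [Nat.Coprime] at h
  rw [h] at hb
  set u := m.gcdA n % n with hu
  have hu0 : 0 ≤ u := Int.emod_nonneg _ hn'.ne'
  have hun : u < n := Int.emod_lt_of_pos _ hn'
  set v := m.gcdB n + m * (m.gcdA n / n) with hv
  have huv : u * m + v * n = 1 := by
    have := Int.emod_add_mul_ediv (m.gcdA n) n
    rw [← hu] at this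
    have h2 : u = m.gcdA n - n * (m.gcdA n / n) := by linarith
    rw [h2, hv]
    push_cast at hb
    linarith
  refine ⟨u, v, huv, by omega, ?_⟩
  have hm0 : (0 : ℤ) ≤ m := Int.natCast_nonneg m
  have h1 : v ≤ 1 := by
    by_contra hc
    have : 2 * (n : ℤ) ≤ v * n := Int.mul_le_mul_of_nonneg_right (by omega) hn'.le
    nlinarith
  have h2 : -(m : ℤ) ≤ v := by
    by_contra hc
    have : v * n ≤ (-(m : ℤ) - 1) * n := Int.mul_le_mul_of_nonneg_right (by omega) hn'.le
    nlinarith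
  omega

theorem exists_pow_between {r p : ℕ} (hr : 2 ≤ r) (hp : 1 ≤ p) :
    ∃ k, p ≤ r ^ k ∧ r ^ k ≤ r * p ∧ k ≤ p.size := by
  refine ⟨Nat.clog r p, Nat.le_pow_clog hr p, ?_⟩
  rcases Nat.lt_or_ge p 2 with h | h
  · have : p = 1 := by omega
    subst this
    simp
    omega
  · have h1 := Nat.pow_pred_clog_lt_self hr h
    have h2 := Nat.clog_pos hr h
    obtain ⟨j, hj⟩ : ∃ j, Nat.clog r p = j + 1 := ⟨Nat.clog r p - 1, by omega⟩
    rw [hj] at h1 ⊢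
    simp only [Nat.pred_succ] at h1
    refine ⟨by rw [pow_succ, mul_comm]; exact Nat.mul_le_mul_left _ h1.le, ?_⟩
    have h3 : 2 ^ j < 2 ^ p.size :=
      ((Nat.pow_le_pow_left hr j).trans_lt h1).trans (Nat.lt_size_self p)
    have := (Nat.pow_lt_pow_iff_right (by norm_num : 1 < 2)).1 h3
    omega

section

variable {F : Type*} [Ring F]

/-- The polynomial with a given vector of coefficients. -/
noncomputable def polyOfVec {p : ℕ} (v : Fin p → F) : F[X] := ∑ i : Fin p, monomial (i : ℕ) (v i)

theorem coeff_polyOfVec {p : ℕ} (v : Fin p → F) (j : ℕ) :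
    (polyOfVec v).coeff j = if h : j < p then v ⟨j, h⟩ else 0 := by
  rw [polyOfVec, finsetSum_coeff]
  simp only [coeff_monomial]
  split_ifs with h
  · rw [Finset.sum_eq_single ⟨j, h⟩]
    · simp
    · intro i _ hi
      rw [if_neg]
      rintro rfl
      exact hi rfl
    · simp
  · refine Finset.sum_eq_zero fun i _ => if_neg ?_
    have := i.2
    omega

theorem wrap_polyOfVec {p : ℕ} (v : Fin p → F) : wrap p (polyOfVec v) = (polyOfVec v).coeff :=
  wrap_eq_coeff fun e he => by rw [coeff_polyOfVec, dif_neg (by omega)]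

theorem wrap_polyOfVec_mul {p : ℕ} (hp : 0 < p) (a b : Fin p → F) (k : ℕ) :
    wrap p (polyOfVec a * polyOfVec b) k =
      ∑ i : Fin p, ∑ j : Fin p, if ((i : ℕ) + (j : ℕ)) % p = k then a i * b j else 0 := by
  rw [wrap_mul hp, wrap_polyOfVec, wrap_polyOfVec, Finset.sum_range]
  refine Finset.sum_congr rfl fun i _ => ?_
  rw [Finset.sum_range]
  refine Finset.sum_congr rfl fun j _ => ?_
  simp [coeff_polyOfVec]

end

/-- Cyclic convolutions in quasi-linear time: a power of `2` times the product and a power of `3`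
times the product are computed, and combined by Bézout coefficients. -/
theorem derives_cyclic {F : Type*} [Ring F] {p : ℕ} (hp : 1 ≤ p) (a b : Fin p → F) :
    Derives (Set.range (Sum.elim a b)) (10 ^ 8 * p * p.size ^ 6)
      (Set.range (wrap p (polyOfVec a * polyOfVec b))) := by
  obtain ⟨k₂, hk₂, hk₂', hs₂⟩ := exists_pow_between (le_refl 2) hp
  obtain ⟨k₃, hk₃, hk₃', hs₃⟩ := exists_pow_between (by norm_num : 2 ≤ 3) hp
  obtain ⟨e₂, he₂, h₂⟩ := exists_polyMulCost (F := F) Nat.prime_two (by norm_num) k₂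
  obtain ⟨e₃, he₃, h₃⟩ := exists_polyMulCost (F := F) Nat.prime_three (by norm_num) k₃
  set ab := polyOfVec a * polyOfVec b with hab
  set S := Set.range (Sum.elim a b) with hS
  have ha : ∀ i, a i ∈ S := fun i => ⟨.inl i, rfl⟩
  have hb : ∀ i, b i ∈ S := fun i => ⟨.inr i, rfl⟩
  have h0 : Derives S 1 {(0 : F)} := by
    have := Derives.sub (ha ⟨0, hp⟩) (ha ⟨0, hp⟩)
    rwa [sub_self] at this
  set S₀ := S ∪ {0} with hS₀
  have hsub : Set.range (wrap p (polyOfVec a)) ∪ Set.range (wrap p (polyOfVec b)) ⊆ S₀ := by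
    rw [wrap_polyOfVec, wrap_polyOfVec]
    rintro _ (⟨i, rfl⟩ | ⟨i, rfl⟩) <;> rw [coeff_polyOfVec] <;> split_ifs
    · exact Or.inl (ha _)
    · exact Or.inr rfl
    · exact Or.inl (hb _)
    · exact Or.inr rfl
  have d₂ := (h₂.derives_wrap hp hk₂ (polyOfVec a) (polyOfVec b)).mono hsub le_rfl
  have d₃ := (h₃.derives_wrap hp hk₃ (polyOfVec a) (polyOfVec b)).mono hsub le_rfl
  have d₄ := (d₂.union d₃).keep
  rw [← hab] at d₄
  set S₁ := S₀ ∪ (Set.range (wrap p (2 ^ e₂ • ab)) ∪ Set.range (wrap p (3 ^ e₃ • ab))) with hS₁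
  obtain ⟨u, v, huv, hu, hv⟩ := exists_bezout_le (m := 2 ^ e₂) (n := 3 ^ e₃) (by positivity)
    (Nat.Coprime.pow _ _ (by norm_num))
  have h0₁ : (0 : F) ∈ S₁ := Or.inl (Or.inr rfl)
  have hus : u.natAbs.size ≤ 2 * e₃ + 1 := by
    rw [Nat.size_le]
    calc u.natAbs ≤ 3 ^ e₃ := hu
      _ ≤ 4 ^ e₃ := Nat.pow_le_pow_left (by norm_num) _
      _ = 2 ^ (2 * e₃) := by rw [pow_mul]; norm_num
      _ < 2 ^ (2 * e₃ + 1) := Nat.pow_lt_pow_right (by norm_num) (by omega)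
  have hvs : v.natAbs.size ≤ e₂ + 2 := by
    rw [Nat.size_le, pow_add]
    have : 1 ≤ 2 ^ e₂ := Nat.one_le_two_pow
    omega
  have d₅ : Derives S₁ (p * (4 * e₃ + 2 * e₂ + 9)) (⋃ k ∈ Finset.range p, {wrap p ab k}) := by
    have := Derives.biUnion (S := S₁) (s := Finset.range p) (T := fun k => {wrap p ab k})
      (n := 4 * e₃ + 2 * e₂ + 9) (fun k _ => by
        have e1 : wrap p ab k = u • (wrap p (2 ^ e₂ • ab) k) + v • (wrap p (3 ^ e₃ • ab) k) := by
          rw [map_nsmul, map_nsmul, Pi.smul_apply, Pi.smul_apply, ← natCast_zsmul,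
            ← natCast_zsmul, smul_smul, smul_smul, ← add_smul, huv, one_smul]
        have d1 := Derives.zsmul (S := S₁) h0₁ (Or.inr (Or.inl ⟨k, rfl⟩) :
          wrap p (2 ^ e₂ • ab) k ∈ S₁) u
        have d2 := Derives.zsmul (S := S₁) h0₁ (Or.inr (Or.inr ⟨k, rfl⟩) :
          wrap p (3 ^ e₃ • ab) k ∈ S₁) v
        rw [e1]
        refine ((d1.union d2).trans (Derives.add ?_ ?_)).mono subset_rfl (by omega)
        · simp
        · simp)
    simpa using this
  refine (((h0.keep.trans d₄).trans d₅.keep).subset ?_).mono subset_rfl ?_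
  · rintro _ ⟨k, rfl⟩
    rcases lt_or_ge k p with hk | hk
    · right
      simp only [Set.mem_iUnion]
      exact ⟨k, by simpa using hk, rfl⟩
    · left
      rwa [wrap_eq_zero_of_le hp _ hk]
  · set s := p.size with hs
    have hs1 : 1 ≤ s := Nat.size_pos.2 hp
    have h1 : s ≤ s ^ 6 := Nat.le_self_pow (by norm_num) s
    have h12 : (k₂ - 4) ^ 6 ≤ s ^ 6 := Nat.pow_le_pow_left (by omega) 6
    have h13 : (k₃ - 4) ^ 6 ≤ s ^ 6 := Nat.pow_le_pow_left (by omega) 6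
    have hm2 : 10000 * (100 * (k₂ - 4) ^ 6 + 1) * 2 ^ k₂ ≤ 10000 * (101 * s ^ 6) * (2 * p) :=
      Nat.mul_le_mul (by omega) hk₂'
    have hm3 : 10000 * (100 * (k₃ - 4) ^ 6 + 1) * 3 ^ k₃ ≤ 10000 * (101 * s ^ 6) * (3 * p) :=
      Nat.mul_le_mul (by omega) hk₃'
    have hm5 : p * (4 * e₃ + 2 * e₂ + 9) ≤ p * (81 * s ^ 6) := Nat.mul_le_mul_left _ (by omega)
    have hp6 : p * 1 ≤ p * s ^ 6 := Nat.mul_le_mul_left _ (by omega)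
    have : 10 ^ 8 * p * s ^ 6 = 10 ^ 8 * (p * s ^ 6) := by ring
    have e2 : 10000 * (101 * s ^ 6) * (2 * p) = 2020000 * (p * s ^ 6) := by ring
    have e3 : 10000 * (101 * s ^ 6) * (3 * p) = 3030000 * (p * s ^ 6) := by ring
    have e5 : p * (81 * s ^ 6) = 81 * (p * s ^ 6) := by ring
    omega

/-- Cyclic convolutions have programs of quasi-linear size that are correct over every ring. The
program is constructed for generic vectors, in the free ring on their entries; homomorphisms from
this ring transport it to arbitrary vectors over arbitrary rings. -/
theorem exists_cyclicMul (p : ℕ) :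
    ∃ M : CyclicMul.{u} p, M.size ≤ 10 ^ 9 * p * p.size ^ 6 := by
  rcases Nat.eq_zero_or_pos p with rfl | hp
  · exact ⟨⟨0, .nil, Fin.elim0, fun _ _ _ _ k => k.elim0⟩, by simp⟩
  · let F := FreeAlgebra ℤ (Fin p ⊕ Fin p)
    let x : Fin p ⊕ Fin p → F := FreeAlgebra.ι ℤ
    let κ : Empty → F := Empty.elim
    obtain ⟨P, hP⟩ := exists_slp_inputs κ x (Finset.univ : Finset (Fin p ⊕ Fin p)).toList
    have hd := derives_cyclic hp (fun i => x (.inl i)) (fun i => x (.inr i))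
    obtain ⟨m, Q, hm, hQ⟩ := hd.exists_slp P (by
      rintro _ ⟨i, rfl⟩
      have := hP i (by simp)
      rcases i with i | i <;> exact this)
    have hQ' : ∀ k : Fin p, ∃ i, Q.eval κ x i =
        wrap p (polyOfVec (fun i => x (.inl i)) * polyOfVec (fun i => x (.inr i))) k :=
      fun k => hQ ⟨k, rfl⟩
    choose out hout using hQ'
    refine ⟨⟨m, Q, out, ?_⟩, ?_⟩
    · intro A _ a b k
      let φ : F →+* A := (FreeAlgebra.lift ℤ (Sum.elim a b)).toRingHom
      have hφ : ∀ j, φ (x j) = Sum.elim a b j := fun j => FreeAlgebra.lift_ι_apply _ _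
      have h1 := SLP.eval_map φ κ x Q (out k)
      have h2 : (fun c => φ (κ c)) = (Empty.elim : Empty → A) := funext fun c => c.elim
      have h3 : (fun j => φ (x j)) = Sum.elim a b := funext hφ
      rw [h2, h3] at h1
      rw [← h1, hout, wrap_polyOfVec_mul hp, map_sum]
      refine Finset.sum_congr rfl fun i _ => ?_
      rw [map_sum]
      refine Finset.sum_congr rfl fun j _ => ?_
      split_ifs
      · rw [map_mul, hφ, hφ]; rfl
      · exact map_zero φ
    · have hl : (Finset.univ : Finset (Fin p ⊕ Fin p)).toList.length = p + p := by simp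
      rw [hl] at hm
      have : 1 ≤ p.size ^ 6 := Nat.one_le_pow _ _ (Nat.size_pos.2 hp)
      have h1 : p * 1 ≤ p * p.size ^ 6 := Nat.mul_le_mul_left _ this
      simp only [mul_assoc] at hm ⊢
      omega

/-! ### Values and costs of the primitives -/

namespace Counted

variable {α β : Type*}

@[simp] theorem val_pure (a : α) : (Counted.pure a).val = a := rfl
@[simp] theorem ringOps_pure (a : α) : (Counted.pure a).ringOps = 0 := rfl
@[simp] theorem bitOps_pure (a : α) : (Counted.pure a).bitOps = 0 := rfl
@[simp] theorem val_bind (x : Counted α) (g : α → Counted β) : (x ⊳ g).val = (g x.val).val := by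
  cases x; rfl
@[simp] theorem ringOps_bind (x : Counted α) (g : α → Counted β) :
    (x ⊳ g).ringOps = x.ringOps + (g x.val).ringOps := by
  cases x; rfl
@[simp] theorem bitOps_bind (x : Counted α) (g : α → Counted β) :
    (x ⊳ g).bitOps = x.bitOps + (g x.val).bitOps := by
  cases x; rfl

end Counted

namespace UIPoly

open Counted

@[simp] theorem val_natAdd (a b : ℕ) : (natAdd a b).val = a + b := rfl
@[simp] theorem val_natSub (a b : ℕ) : (natSub a b).val = a - b := rfl
@[simp] theorem val_natMax (a b : ℕ) : (natMax a b).val = max a b := rfl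
@[simp] theorem val_natLt (a b : ℕ) : (natLt a b).val = decide (a < b) := rfl
@[simp] theorem val_natEq (a b : ℕ) : (natEq a b).val = decide (a = b) := rfl
@[simp] theorem val_natMul (a b : ℕ) : (natMul a b).val = a * b := rfl
@[simp] theorem val_natMod (a b : ℕ) : (natMod a b).val = a % b := rfl
@[simp] theorem val_natClog (a : ℕ) : (natClog a).val = Nat.clog 2 a := rfl
@[simp] theorem ringOps_natAdd (a b : ℕ) : (natAdd a b).ringOps = 0 := rfl
@[simp] theorem ringOps_natSub (a b : ℕ) : (natSub a b).ringOps = 0 := rfl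
@[simp] theorem ringOps_natMax (a b : ℕ) : (natMax a b).ringOps = 0 := rfl
@[simp] theorem ringOps_natLt (a b : ℕ) : (natLt a b).ringOps = 0 := rfl
@[simp] theorem ringOps_natEq (a b : ℕ) : (natEq a b).ringOps = 0 := rfl
@[simp] theorem ringOps_natMul (a b : ℕ) : (natMul a b).ringOps = 0 := rfl
@[simp] theorem ringOps_natMod (a b : ℕ) : (natMod a b).ringOps = 0 := rfl
@[simp] theorem ringOps_natClog (a : ℕ) : (natClog a).ringOps = 0 := rfl
@[simp] theorem bitOps_natAdd (a b : ℕ) : (natAdd a b).bitOps = linCost a b := rfl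
@[simp] theorem bitOps_natSub (a b : ℕ) : (natSub a b).bitOps = linCost a b := rfl
@[simp] theorem bitOps_natMax (a b : ℕ) : (natMax a b).bitOps = linCost a b := rfl
@[simp] theorem bitOps_natLt (a b : ℕ) : (natLt a b).bitOps = linCost a b := rfl
@[simp] theorem bitOps_natEq (a b : ℕ) : (natEq a b).bitOps = linCost a b := rfl
@[simp] theorem bitOps_natMul (a b : ℕ) : (natMul a b).bitOps = mulCost a b := rfl
@[simp] theorem bitOps_natMod (a b : ℕ) : (natMod a b).bitOps = mulCost a b := rfl
@[simp] theorem bitOps_natClog (a : ℕ) : (natClog a).bitOps = linCost a 1 := rfl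

section

variable {R : Type*}

@[simp] theorem val_ringSub [Ring R] (a b : R) : (ringSub a b).val = a - b := rfl
@[simp] theorem val_ringEq [DecidableEq R] (a b : R) : (ringEq a b).val = decide (a = b) := rfl
@[simp] theorem val_isZero [Ring R] [DecidableEq R] (a : R) :
    (isZero a).val = decide (a = 0) := rfl
@[simp] theorem val_read (a : ℕ → R) (i : ℕ) : (read a i).val = a i := rfl
@[simp] theorem val_write (a : ℕ → R) (i : ℕ) (c : R) :
    (write a i c).val = Function.update a i c := rfl
@[simp] theorem ringOps_ringSub [Ring R] (a b : R) : (ringSub a b).ringOps = 1 := rfl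
@[simp] theorem ringOps_ringEq [DecidableEq R] (a b : R) : (ringEq a b).ringOps = 1 := rfl
@[simp] theorem ringOps_isZero [Ring R] [DecidableEq R] (a : R) : (isZero a).ringOps = 1 := rfl
@[simp] theorem ringOps_read (a : ℕ → R) (i : ℕ) : (read a i).ringOps = 0 := rfl
@[simp] theorem ringOps_write (a : ℕ → R) (i : ℕ) (c : R) : (write a i c).ringOps = 0 := rfl
@[simp] theorem bitOps_ringSub [Ring R] (a b : R) : (ringSub a b).bitOps = 0 := rfl
@[simp] theorem bitOps_ringEq [DecidableEq R] (a b : R) : (ringEq a b).bitOps = 0 := rfl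
@[simp] theorem bitOps_isZero [Ring R] [DecidableEq R] (a : R) : (isZero a).bitOps = 0 := rfl
@[simp] theorem bitOps_read (a : ℕ → R) (i : ℕ) : (read a i).bitOps = Nat.size i + 1 := rfl
@[simp] theorem bitOps_write (a : ℕ → R) (i : ℕ) (c : R) :
    (write a i c).bitOps = Nat.size i + 1 := rfl

end

@[simp] theorem val_splitHalf (l : List ℕ) :
    (splitHalf l).val = (l.take (l.length / 2), l.drop (l.length / 2)) := rfl
@[simp] theorem ringOps_splitHalf (l : List ℕ) : (splitHalf l).ringOps = 0 := rfl
@[simp] theorem bitOps_splitHalf (l : List ℕ) : (splitHalf l).bitOps = l.length + 1 := rfl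
@[simp] theorem val_numTerms {R : Type*} (s : List (ℕ × R)) : (numTerms s).val = s.length := rfl
@[simp] theorem ringOps_numTerms {R : Type*} (s : List (ℕ × R)) : (numTerms s).ringOps = 0 := rfl
@[simp] theorem bitOps_numTerms {R : Type*} (s : List (ℕ × R)) :
    (numTerms s).bitOps = s.length + 1 := rfl

@[simp] theorem val_natPow (a n : ℕ) : (natPow a n).val = a ^ n := by
  induction n with
  | zero => rfl
  | succ n ih => simp [natPow, ih, pow_succ, mul_comm]

@[simp] theorem ringOps_natPow (a n : ℕ) : (natPow a n).ringOps = 0 := by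
  induction n with
  | zero => rfl
  | succ n ih => simp [natPow, ih]

theorem linCost_le {a b u v : ℕ} (ha : a.size ≤ u) (hb : b.size ≤ v) :
    linCost a b ≤ u + v + 1 := by
  unfold linCost; omega

theorem mulCost_le {a b u v : ℕ} (ha : a.size ≤ u) (hb : b.size ≤ v) :
    mulCost a b ≤ (u + v + 1) * (u + v + 1).size ^ 2 := by
  have h := linCost_le ha hb
  unfold mulCost
  exact Nat.mul_le_mul h (Nat.pow_le_pow_left (Nat.size_le_size h) 2)

theorem size_le_self (n : ℕ) : n.size ≤ n :=
  Nat.size_le.2 Nat.lt_two_pow_self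

theorem mulCost_le_cube {a b u v : ℕ} (ha : a.size ≤ u) (hb : b.size ≤ v) :
    mulCost a b ≤ (u + v + 1) ^ 3 := by
  refine (mulCost_le ha hb).trans ?_
  rw [pow_succ' _ 2]
  exact Nat.mul_le_mul_left _ (Nat.pow_le_pow_left (size_le_self _) 2)

theorem size_mul_le (a b : ℕ) : (a * b).size ≤ a.size + b.size := by
  rw [Nat.size_le, pow_add]
  exact Nat.mul_lt_mul'' (Nat.lt_size_self a) (Nat.lt_size_self b)

theorem size_add_le (a b : ℕ) : (a + b).size ≤ max a.size b.size + 1 := by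
  rw [Nat.size_le, pow_succ]
  have h1 := (Nat.lt_size_self a).trans_le
    (Nat.pow_le_pow_right (n := 2) (by norm_num) (le_max_left a.size b.size))
  have h2 := (Nat.lt_size_self b).trans_le
    (Nat.pow_le_pow_right (n := 2) (by norm_num) (le_max_right a.size b.size))
  omega

/-! ### Prime numbers -/

/-- Trial division by `d, d + 1, …` decides whether `m` has a divisor `q ≥ d` with `q * q ≤ m`, if
the fuel lasts up to the square root of `m`. -/
theorem val_trial {m fuel d : ℕ} (h : m < (fuel + d) ^ 2) :
    (trial m fuel d).val = true ↔ ∀ q, d ≤ q → q * q ≤ m → ¬ q ∣ m := by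
  induction fuel generalizing d with
  | zero =>
    simp only [trial, val_pure, true_iff]
    intro q hq hqm
    nlinarith
  | succ fuel ih =>
    simp only [trial, val_bind, val_natMul, val_natLt, decide_eq_true_eq]
    split_ifs with h1
    · simp only [val_pure, true_iff]
      intro q hq hqm
      nlinarith
    · simp only [val_bind, val_natMod, val_natEq, decide_eq_true_eq]
      split_ifs with h2
      · simp only [val_pure, Bool.false_eq_true, false_iff]
        intro h3
        exact h3 d le_rfl (by omega) (Nat.dvd_of_mod_eq_zero h2)
      · simp only [val_bind, val_natAdd]
        rw [ih (by rw [show fuel + (d + 1) = fuel + 1 + d by omega]; exact h)]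
        refine ⟨fun h3 q hq hqm => ?_, fun h3 q hq => h3 q (by omega)⟩
        rcases Nat.eq_or_lt_of_le hq with rfl | hq
        · exact fun h4 => h2 (Nat.mod_eq_zero_of_dvd h4)
        · exact h3 q hq hqm

theorem val_trial_eq_prime {m : ℕ} (hm : 2 ≤ m) : (trial m m 2).val = decide m.Prime := by
  rw [Bool.eq_iff_iff, decide_eq_true_iff, val_trial (by nlinarith), Nat.prime_def_le_sqrt]
  simp only [Nat.le_sqrt]
  exact ⟨fun h => ⟨hm, h⟩, fun h => h.2⟩

@[simp] theorem ringOps_trial (m fuel d : ℕ) : (trial m fuel d).ringOps = 0 := by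
  induction fuel generalizing d with
  | zero => rfl
  | succ fuel ih =>
    simp only [trial, ringOps_bind, ringOps_natMul, ringOps_natLt]
    split_ifs
    · rfl
    · simp only [ringOps_bind, ringOps_natMod, ringOps_natEq]
      split_ifs <;> simp [ih]

theorem bitOps_trial_le {m σ : ℕ} (hm : m.size ≤ σ) (hσ : 1 ≤ σ) (fuel d : ℕ)
    (hd : d ≤ m.sqrt + 1) :
    (trial m fuel d).bitOps ≤ (m.sqrt + 2 - d) * (210 * σ ^ 3) := by
  induction fuel generalizing d with
  | zero => simp [trial]
  | succ fuel ih =>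
    have hdm : d.size ≤ σ + 1 := by
      have h1 : m.sqrt ≤ m := Nat.sqrt_le_self m
      have h2 := Nat.lt_size_self m
      have h3 : 2 ^ m.size ≤ 2 ^ σ := Nat.pow_le_pow_right (by norm_num) hm
      have := Nat.one_le_two_pow (n := σ)
      rw [Nat.size_le, pow_succ]
      omega
    have c1 : mulCost d d ≤ (σ + 1 + (σ + 1) + 1) ^ 3 := mulCost_le_cube hdm hdm
    have c2 : linCost m (d * d) ≤ σ + (σ + 1 + (σ + 1)) + 1 :=
      linCost_le hm ((size_mul_le d d).trans (by omega))
    have c3 : mulCost m d ≤ (σ + (σ + 1) + 1) ^ 3 := mulCost_le_cube hm hdm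
    have c4 : linCost (m % d) 0 ≤ σ + 0 + 1 :=
      linCost_le ((Nat.size_le_size (Nat.mod_le m d)).trans hm) Nat.size_zero.le
    have c5 : linCost d 1 ≤ σ + 1 + 1 + 1 := linCost_le (u := σ + 1) (v := 1) hdm Nat.size_one.le
    have hs1 : σ ≤ σ ^ 3 := Nat.le_self_pow (by norm_num) σ
    have e1 : (σ + 1 + (σ + 1) + 1) ^ 3 ≤ (5 * σ) ^ 3 := Nat.pow_le_pow_left (by omega) 3
    have e2 : (σ + (σ + 1) + 1) ^ 3 ≤ (4 * σ) ^ 3 := Nat.pow_le_pow_left (by omega) 3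
    rw [mul_pow] at e1 e2
    have hstep : 210 * σ ^ 3 ≤ (m.sqrt + 2 - d) * (210 * σ ^ 3) :=
      Nat.le_mul_of_pos_left _ (by omega)
    simp only [trial, bitOps_bind, val_natMul, val_natLt, bitOps_natMul, bitOps_natLt,
      decide_eq_true_eq]
    split_ifs with h1
    · simp only [bitOps_pure]; omega
    · simp only [bitOps_bind, val_natMod, val_natEq, bitOps_natMod, bitOps_natEq,
        decide_eq_true_eq]
      have hd' : d ≤ m.sqrt := Nat.le_sqrt.2 (by omega)
      split_ifs with h2
      · simp only [bitOps_pure]; omega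
      · simp only [bitOps_bind, val_natAdd, bitOps_natAdd]
        have := ih (d + 1) (by omega)
        have e : m.sqrt + 2 - d = (m.sqrt + 2 - (d + 1)) + 1 := by omega
        rw [e, add_mul, one_mul]
        omega

theorem val_primesFrom {fuel m k : ℕ} (hm : 2 ≤ m)
    (h : k = 0 ∨ Nat.nth Nat.Prime (Nat.count Nat.Prime m + (k - 1)) < m + fuel) :
    (primesFrom fuel m k).val =
      (List.range k).map fun i => Nat.nth Nat.Prime (Nat.count Nat.Prime m + i) := by
  induction fuel generalizing m k with
  | zero =>
    rcases h with rfl | h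
    · simp [primesFrom]
    · exfalso
      have h2 : m ≤ Nat.nth Nat.Prime (Nat.count Nat.Prime m + (k - 1)) :=
        (Nat.count_le_iff_le_nth Nat.infinite_setOfPred_prime).1 (Nat.le_add_right _ _)
      omega
  | succ fuel ih =>
    simp only [primesFrom, val_bind, val_natEq, decide_eq_true_eq]
    split_ifs with hk
    · simp [hk]
    · simp only [val_bind, val_trial_eq_prime hm, val_natAdd, decide_eq_true_eq]
      have h' : Nat.nth Nat.Prime (Nat.count Nat.Prime m + (k - 1)) < m + (fuel + 1) := by
        rcases h with h | h
        · exact absurd h hk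
        · exact h
      split_ifs with hp
      · simp only [val_bind, val_natSub, val_pure]
        have hc : Nat.count Nat.Prime (m + 1) = Nat.count Nat.Prime m + 1 := by
          rw [Nat.count_succ, if_pos hp]
        rw [ih (by omega) (by
          rcases Nat.lt_or_ge 1 k with h1 | h1
          · right
            rw [hc, show Nat.count Nat.Prime m + 1 + (k - 1 - 1) =
              Nat.count Nat.Prime m + (k - 1) by omega]
            omega
          · left; omega), hc]
        obtain ⟨k, rfl⟩ : ∃ j, k = j + 1 := ⟨k - 1, by omega⟩
        rw [List.range_succ_eq_map]
        simp only [Nat.add_sub_cancel, List.map_cons, List.map_map, add_zero, Nat.nth_count hp]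
        congr 1
        refine List.map_congr_left fun i _ => ?_
        simp only [Function.comp]
        congr 1
        omega
      · have hc : Nat.count Nat.Prime (m + 1) = Nat.count Nat.Prime m := by
          rw [Nat.count_succ, if_neg hp, add_zero]
        rw [ih (by omega) (Or.inr (by rw [hc]; omega)), hc]

@[simp] theorem ringOps_primesFrom (fuel m k : ℕ) : (primesFrom fuel m k).ringOps = 0 := by
  induction fuel generalizing m k with
  | zero => rfl
  | succ fuel ih =>
    simp only [primesFrom, ringOps_bind, ringOps_natEq]
    split_ifs
    · rfl
    · simp only [ringOps_bind, ringOps_trial, ringOps_natAdd]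
      split_ifs <;> simp [ih]

/-- The cost of the search for primes up to `B`: about `B ^ (3 / 2)`. -/
theorem bitOps_primesFrom_le {B σ fuel m k : ℕ} (hB : B.size ≤ σ) (hσ : 1 ≤ σ) (hk : k.size ≤ σ)
    (hm : 2 ≤ m) (hmB : m ≤ B + 1)
    (h : k = 0 ∨ Nat.nth Nat.Prime (Nat.count Nat.Prime m + (k - 1)) ≤ B) :
    (primesFrom fuel m k).bitOps ≤ (B + 2 - m) * ((B.sqrt + 1) * (220 * σ ^ 3)) := by
  induction fuel generalizing m k with
  | zero => simp [primesFrom]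
  | succ fuel ih =>
    have hs1 : σ ≤ σ ^ 3 := Nat.le_self_pow (by norm_num) σ
    have e0 : 220 * σ ^ 3 ≤ (B.sqrt + 1) * (220 * σ ^ 3) := Nat.le_mul_of_pos_left _ (by omega)
    have e1 : (B.sqrt + 1) * (220 * σ ^ 3) ≤ (B + 2 - m) * ((B.sqrt + 1) * (220 * σ ^ 3)) :=
      Nat.le_mul_of_pos_left _ (by omega)
    have c1 : linCost k 0 ≤ σ + 0 + 1 := linCost_le hk Nat.size_zero.le
    simp only [primesFrom, bitOps_bind, val_natEq, bitOps_natEq, decide_eq_true_eq]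
    split_ifs with hk0
    · simp only [bitOps_pure]; omega
    · have h' : Nat.nth Nat.Prime (Nat.count Nat.Prime m + (k - 1)) ≤ B := by
        rcases h with h | h
        · exact absurd h hk0
        · exact h
      have hmB' : m ≤ B := by
        refine le_trans ?_ h'
        exact (Nat.count_le_iff_le_nth Nat.infinite_setOfPred_prime).1 (Nat.le_add_right _ _)
      have hms : m.size ≤ σ := (Nat.size_le_size hmB').trans hB
      have c2 : (trial m m 2).bitOps ≤ (B.sqrt + 1) * (210 * σ ^ 3) := by
        refine (bitOps_trial_le hms hσ m 2 ?_).trans (Nat.mul_le_mul_right _ ?_)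
        · have : 1 ≤ m.sqrt := Nat.le_sqrt.2 (by omega)
          omega
        · have := Nat.sqrt_le_sqrt hmB'
          omega
      have c3 : linCost m 1 ≤ σ + 1 + 1 := linCost_le hms Nat.size_one.le
      have c4 : linCost k 1 ≤ σ + 1 + 1 := linCost_le hk Nat.size_one.le
      have e2 : (B.sqrt + 1) * (220 * σ ^ 3) =
        (B.sqrt + 1) * (210 * σ ^ 3) + (B.sqrt + 1) * (10 * σ ^ 3) := by ring
      have e3 : 10 * σ ^ 3 ≤ (B.sqrt + 1) * (10 * σ ^ 3) := Nat.le_mul_of_pos_left _ (by omega)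
      have e4 : (B + 2 - m) * ((B.sqrt + 1) * (220 * σ ^ 3)) =
          (B + 2 - (m + 1)) * ((B.sqrt + 1) * (220 * σ ^ 3)) +
            (B.sqrt + 1) * (220 * σ ^ 3) := by
        rw [show B + 2 - m = (B + 2 - (m + 1)) + 1 by omega, add_mul, one_mul]
      simp only [bitOps_bind, val_trial_eq_prime (show 2 ≤ m by omega), val_natAdd, bitOps_natAdd,
        decide_eq_true_eq]
      split_ifs with hp
      · simp only [bitOps_bind, val_natSub, bitOps_natSub, bitOps_pure]
        have hc : Nat.count Nat.Prime (m + 1) = Nat.count Nat.Prime m + 1 := by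
          rw [Nat.count_succ, if_pos hp]
        have := ih (m := m + 1) (k := k - 1) ((Nat.size_le_size (by omega)).trans hk) (by omega)
          (by omega) (by
            rcases Nat.lt_or_ge 1 k with h1 | h1
            · right
              rw [hc, show Nat.count Nat.Prime m + 1 + (k - 1 - 1) =
                Nat.count Nat.Prime m + (k - 1) by omega]
              omega
            · left; omega)
        omega
      · have hc : Nat.count Nat.Prime (m + 1) = Nat.count Nat.Prime m := by
          rw [Nat.count_succ, if_neg hp, add_zero]
        have := ih (m := m + 1) (k := k) hk (by omega) (by omega) (Or.inr (by rw [hc]; omega))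
        omega

/-- Bertrand's postulate shows that the search for primes has enough fuel. -/
theorem nth_prime_le_two_pow (i : ℕ) : Nat.nth Nat.Prime i ≤ 2 ^ (i + 1) := by
  induction i with
  | zero => rw [Nat.nth_prime_zero_eq_two]; norm_num
  | succ i ih =>
    have hp : (Nat.nth Nat.Prime i).Prime := Nat.prime_nth_prime i
    obtain ⟨q, hq, h1, h2⟩ := Nat.exists_prime_lt_and_le_two_mul _ hp.ne_zero
    have : Nat.nth Nat.Prime (i + 1) ≤ q := by
      have h5 : i < Nat.count Nat.Prime q := by
        calc i = Nat.count Nat.Prime (Nat.nth Nat.Prime i) :=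
              (Nat.count_nth (fun h => absurd h Nat.infinite_setOfPred_prime)).symm
          _ < Nat.count Nat.Prime q := Nat.count_strict_mono hp h1
      calc Nat.nth Nat.Prime (i + 1) ≤ Nat.nth Nat.Prime (Nat.count Nat.Prime q) :=
            Nat.nth_monotone Nat.infinite_setOfPred_prime h5
        _ = q := Nat.nth_count hq
    rw [pow_succ]
    omega

theorem val_firstPrimes (N : ℕ) :
    (firstPrimes N).val = (List.range N).map (Nat.nth Nat.Prime) := by
  have hc : Nat.count Nat.Prime 2 = 0 := by decide
  rw [firstPrimes, val_primesFrom le_rfl, hc]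
  · simp
  · rcases Nat.eq_zero_or_pos N with h | h
    · exact Or.inl h
    · right
      rw [hc, zero_add]
      have := nth_prime_le_two_pow (N - 1)
      have h2 : 2 ^ (N - 1 + 1) ≤ 2 ^ (N + 1) := Nat.pow_le_pow_right (by norm_num) (by omega)
      omega

theorem bitOps_firstPrimes_le {N B σ : ℕ} (hB : B.size ≤ σ) (hN : N.size ≤ σ) (hB2 : 2 ≤ B)
    (h : ∀ i < N, Nat.nth Nat.Prime i ≤ B) :
    (firstPrimes N).bitOps ≤ B * ((B.sqrt + 1) * (220 * σ ^ 3)) := by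
  have hc : Nat.count Nat.Prime 2 = 0 := by decide
  have hσ : 1 ≤ σ := le_trans (Nat.size_pos.2 (by omega)) hB
  refine bitOps_primesFrom_le hB hσ hN le_rfl (by omega) ?_
  rcases Nat.eq_zero_or_pos N with h1 | h1
  · exact Or.inl h1
  · right
    rw [hc, zero_add]
    exact h _ (by omega)

@[simp] theorem ringOps_firstPrimes (N : ℕ) : (firstPrimes N).ringOps = 0 :=
  ringOps_primesFrom _ _ _

/-- Chebyshev's bound, from the least common multiple of `1, …, n`. -/
theorem le_size_mul_primeCounting {n : ℕ} :
    n ≤ n.size * (Nat.primeCounting n + 1) := by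
  rcases Nat.eq_zero_or_pos n with rfl | hn
  · simp
  have h1 := Chebyshev.two_pow_le_mul_lcmUpto n
  have h2 : Nat.lcmUpto n ≤ n ^ Nat.primeCounting n := by
    rw [Nat.lcmUpto_eq_prod_pow_log, ← Nat.primesLE_card_eq_primeCounting]
    exact Finset.prod_le_pow_card _ _ _ fun p _ => Nat.pow_log_le_self p hn.ne'
  have h3 : n + 1 ≤ 2 ^ n.size := Nat.lt_size_self n
  have h4 : n ^ Nat.primeCounting n ≤ 2 ^ (n.size * Nat.primeCounting n) := by
    rw [pow_mul]
    exact Nat.pow_le_pow_left (by omega) _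
  have h5 : 2 ^ n ≤ 2 ^ (n.size * (Nat.primeCounting n + 1)) := by
    rw [mul_add, mul_one, pow_add, mul_comm]
    exact h1.trans (Nat.mul_le_mul h3 (h2.trans h4))
  exact (Nat.pow_le_pow_iff_right (by norm_num)).1 h5

/-- The bound for the primes in terms of their bit length, from Chebyshev's bound. -/
theorem nth_prime_le (i : ℕ) :
    Nat.nth Nat.Prime i ≤ (i + 2) * (Nat.nth Nat.Prime i).size := by
  have h := @le_size_mul_primeCounting (Nat.nth Nat.Prime i)
  have : Nat.primeCounting (Nat.nth Nat.Prime i) = i + 1 := by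
    rw [Nat.primeCounting, Nat.primeCounting', Nat.count_succ,
      Nat.count_nth (fun h => absurd h Nat.infinite_setOfPred_prime),
      if_pos (Nat.prime_nth_prime i)]
  rw [this] at h
  rwa [mul_comm]

/-- A crude bound, used only for the bit length of the primes. -/
theorem nth_prime_le_sq (i : ℕ) : Nat.nth Nat.Prime i ≤ 4 * (i + 2) ^ 2 := by
  have h := nth_prime_le i
  set p := Nat.nth Nat.Prime i
  have hp : p.Prime := Nat.prime_nth_prime i
  have key : ∀ s : ℕ, s ^ 2 ≤ 2 ^ (s + 1) := by
    intro s
    rcases Nat.lt_or_ge s 4 with h | h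
    · interval_cases s <;> norm_num
    · induction s, h using Nat.le_induction with
      | base => norm_num
      | succ s hs ih => rw [pow_succ 2 (s + 1)]; nlinarith
  have hs : 2 ^ (p.size + 1) ≤ 4 * p := by
    obtain ⟨j, hj⟩ : ∃ j, p.size = j + 1 :=
      ⟨p.size - 1, by have := Nat.size_pos.2 hp.pos; omega⟩
    have : 2 ^ j ≤ p := Nat.lt_size.1 (by omega)
    rw [hj, pow_succ, pow_succ]
    omega
  have h2 := (key p.size).trans hs
  have h3 : p * p ≤ p * (4 * (i + 2) ^ 2) := by
    calc p * p ≤ ((i + 2) * p.size) * ((i + 2) * p.size) := Nat.mul_le_mul h h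
      _ = (i + 2) ^ 2 * p.size ^ 2 := by ring
      _ ≤ (i + 2) ^ 2 * (4 * p) := Nat.mul_le_mul_left _ h2
      _ = p * (4 * (i + 2) ^ 2) := by ring
  exact Nat.le_of_mul_le_mul_left h3 hp.pos

theorem size_nth_prime_le (i : ℕ) : (Nat.nth Nat.Prime i).size ≤ 3 + 2 * (i + 2).size := by
  refine (Nat.size_le_size (nth_prime_le_sq i)).trans ((size_mul_le _ _).trans ?_)
  have h1 : Nat.size 4 = 3 := by decide
  have h2 := size_mul_le (i + 2) (i + 2)
  rw [h1, pow_two]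
  omega

/-! ### Correctness of the subroutines -/

section Probe

variable {R : Type u} [Ring R] [DecidableEq R]

theorem val_countTerms (a : ℕ → R) (n : ℕ) :
    (countTerms a n).val = ((Finset.range n).filter fun i => a i ≠ 0).card := by
  induction n with
  | zero => rfl
  | succ n ih =>
    rw [Finset.range_add_one, Finset.filter_insert]
    simp only [countTerms, val_bind, ih, val_isZero, decide_eq_true_eq]
    by_cases h : a n = 0
    · simp [h]
    · simp [h]

omit [DecidableEq R] in
theorem val_lineMod (M : ∀ p : ℕ, CyclicMul.{u} p) {p : ℕ} (hp : 0 < p) {n : ℕ}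
    {v : Fin n → Fin p → R} {w : Fin n → R[X]} (h : ∀ i k, v i k = wrap p (w i) k)
    (l : SLPLine R Unit n) (k : Fin p) :
    (lineMod M p v l).val k =
      wrap p (SLP.lineEval (fun c => (C c : R[X])) (fun _ => X) w l) k := by
  cases l with
  | const c =>
    simp only [lineMod, val_pure, SLP.lineEval]
    rw [← monomial_zero_left, wrap_monomial, Nat.zero_mod]
    exact if_congr eq_comm rfl rfl
  | input i =>
    simp only [lineMod, val_pure, SLP.lineEval]
    rw [← monomial_one_one_eq_X, wrap_monomial]
    exact if_congr eq_comm rfl rfl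
  | add a b => simp [lineMod, SLP.lineEval, h]
  | sub a b => simp [lineMod, SLP.lineEval, h]
  | mul a b =>
    simp only [lineMod, SLP.lineEval]
    rw [(M p).correct, wrap_mul hp, Finset.sum_range]
    refine Finset.sum_congr rfl fun i _ => ?_
    rw [Finset.sum_range]
    refine Finset.sum_congr rfl fun j _ => ?_
    rw [h, h]

omit [DecidableEq R] in
theorem val_evalMod (M : ∀ p : ℕ, CyclicMul.{u} p) {p : ℕ} (hp : 0 < p) {n : ℕ}
    (P : SLP R Unit n) (i : Fin n) (k : Fin p) :
    (evalMod M p P).val i k = wrap p (P.eval (fun c => (C c : R[X])) (fun _ => X) i) k := by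
  induction P generalizing k with
  | nil => exact i.elim0
  | snoc P l ih =>
    simp only [evalMod, val_bind, val_pure, SLP.eval]
    refine Fin.lastCases ?_ (fun j => ?_) i
    · rw [Fin.snoc_last, Fin.snoc_last]
      exact val_lineMod M hp ih l k
    · rw [Fin.snoc_castSucc, Fin.snoc_castSucc]
      exact ih j k

omit [DecidableEq R] in
theorem val_probe (M : ∀ p : ℕ, CyclicMul.{u} p) {L : ℕ} (P : SLP R Unit L) {p : ℕ} (hp : 0 < p) :
    (probe M P p).val = wrap p P.toPoly := by
  ext i
  simp only [probe, val_bind, val_pure]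
  split_ifs with hi
  · unfold SLP.toPoly SLP.output
    split_ifs with hL
    · exact val_evalMod M hp P _ ⟨i, hi⟩
    · simp
  · rw [wrap_eq_zero_of_le hp _ (by omega)]

/-- The image of `g` modulo `X ^ p - 1`. -/
noncomputable def imageOf (g : R[X]) (p : ℕ) : Image R :=
  ⟨p, wrap p g, ((Finset.range p).filter fun i => wrap p g i ≠ 0).card⟩

theorem val_images (M : ∀ p : ℕ, CyclicMul.{u} p) {L : ℕ} (P : SLP R Unit L) (ps : List ℕ)
    (hps : ∀ p ∈ ps, 0 < p) : (images M P ps).val = ps.map (imageOf P.toPoly) := by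
  induction ps with
  | nil => rfl
  | cons p ps ih =>
    simp only [images, val_bind, val_pure, List.map_cons]
    rw [ih fun p hp => hps p (by simp [hp]), val_probe M P (hps p (by simp)), val_countTerms]
    rfl

omit [Ring R] [DecidableEq R] in
theorem val_best (b : Image R) (l : List (Image R)) :
    (best b l).val ∈ b :: l ∧ ∀ x ∈ b :: l, x.terms ≤ (best b l).val.terms := by
  induction l generalizing b with
  | nil => simp [best]
  | cons f fs ih =>
    simp only [best, val_bind, val_natLt, decide_eq_true_eq]
    obtain ⟨h1, h2⟩ := ih (if b.terms < f.terms then f else b)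
    set y := (best (if b.terms < f.terms then f else b) fs).val
    refine ⟨?_, ?_⟩
    · rcases List.mem_cons.1 h1 with h | h
      · rw [h]; split_ifs <;> simp
      · simp [h]
    · have h3 := h2 _ List.mem_cons_self
      intro x hx
      simp only [List.mem_cons] at hx
      rcases hx with rfl | rfl | hx
      · split_ifs at h3 <;> omega
      · split_ifs at h3 <;> omega
      · exact h2 x (List.mem_cons_of_mem _ hx)

omit [DecidableEq R] in
theorem wrap_sub_monomial {p : ℕ} (g : R[X]) (e : ℕ) (c : R) :
    wrap p (g - monomial e c) =
      Function.update (wrap p g) (e % p) (wrap p g (e % p) - c) := by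
  ext i
  rw [map_sub, Pi.sub_apply, wrap_monomial]
  rcases eq_or_ne i (e % p) with rfl | h
  · simp
  · rw [Function.update_of_ne h, if_neg h.symm, sub_zero]

theorem terms_sub_monomial {p : ℕ} (hp : 0 < p) (g : R[X]) (e : ℕ) (c : R) :
    (imageOf (g - monomial e c) p).terms =
      if wrap p g (e % p) = 0 ∧ wrap p g (e % p) - c ≠ 0 then (imageOf g p).terms + 1
      else if wrap p g (e % p) ≠ 0 ∧ wrap p g (e % p) - c = 0 then (imageOf g p).terms - 1
      else (imageOf g p).terms := by
  have hr : e % p ∈ Finset.range p := Finset.mem_range.2 (Nat.mod_lt e hp)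
  simp only [imageOf]
  rw [wrap_sub_monomial]
  set a := wrap p g
  set r := e % p
  set A := (Finset.range p).filter fun i => a i ≠ 0 with hA
  set B := (Finset.range p).filter fun i => Function.update a r (a r - c) i ≠ 0 with hB
  have hAB : A.erase r = B.erase r := by
    ext i
    simp only [hA, hB, Finset.mem_erase, Finset.mem_filter]
    refine and_congr_right fun hi => ?_
    rw [Function.update_of_ne hi]
  have hrA : r ∈ A ↔ a r ≠ 0 := by simp [hA, hr]
  have hrB : r ∈ B ↔ a r - c ≠ 0 := by simp only [hB, Finset.mem_filter, Function.update_self, hr,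
    true_and]
  have hcard : (A.erase r).card = (B.erase r).card := by rw [hAB]
  by_cases h1 : a r = 0 <;> by_cases h2 : a r - c = 0
  · have hA' : r ∉ A := by rw [hrA]; simpa using h1
    have hB' : r ∉ B := by rw [hrB]; simpa using h2
    rw [Finset.erase_eq_of_notMem hA', Finset.erase_eq_of_notMem hB'] at hcard
    rw [if_neg (by tauto), if_neg (by tauto), hcard]
  · have hA' : r ∉ A := by rw [hrA]; simpa using h1
    have hB' : r ∈ B := by rw [hrB]; exact h2
    rw [Finset.erase_eq_of_notMem hA', Finset.card_erase_of_mem hB'] at hcard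
    have := Finset.card_pos.2 ⟨r, hB'⟩
    rw [if_pos ⟨h1, h2⟩]
    omega
  · have hA' : r ∈ A := by rw [hrA]; exact h1
    have hB' : r ∉ B := by rw [hrB]; simpa using h2
    rw [Finset.erase_eq_of_notMem hB', Finset.card_erase_of_mem hA'] at hcard
    rw [if_neg (by tauto), if_pos ⟨h1, h2⟩, hcard]
  · have hA' : r ∈ A := by rw [hrA]; exact h1
    have hB' : r ∈ B := by rw [hrB]; exact h2
    rw [Finset.card_erase_of_mem hB', Finset.card_erase_of_mem hA'] at hcard
    have h3 := Finset.card_pos.2 ⟨r, hA'⟩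
    have h4 := Finset.card_pos.2 ⟨r, hB'⟩
    rw [if_neg (by tauto), if_neg (by tauto)]
    omega

theorem val_subTerm {p : ℕ} (hp : 0 < p) (g : R[X]) (e : ℕ) (c : R) :
    (subTerm (imageOf g p) (e % p) c).val =
      (wrap p (g - monomial e c) (e % p), (imageOf (g - monomial e c) p).terms) := by
  rw [terms_sub_monomial hp, wrap_sub_monomial, Function.update_self]
  simp only [subTerm, val_bind, val_read, val_ringSub, val_isZero]
  have : (imageOf g p).coeff = wrap p g := rfl
  rw [this]
  by_cases h1 : wrap p g (e % p) = 0 <;> by_cases h2 : wrap p g (e % p) - c = 0 <;>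
    simp [h1, h2]
  · rw [h1] at h2; simp at h2; simp [h2]
  · rw [h1] at h2; simp at h2; simp [h2]

/-- Subtracting a term from an image reduces the number of terms exactly if it cancels a nonzero
coefficient. -/
theorem terms_sub_lt_iff {p : ℕ} (hp : 0 < p) (g : R[X]) (e : ℕ) (c : R) :
    (imageOf (g - monomial e c) p).terms < (imageOf g p).terms ↔
      wrap p g (e % p) ≠ 0 ∧ wrap p g (e % p) = c := by
  rw [terms_sub_monomial hp, ← sub_eq_zero (b := c)]
  have hr : e % p ∈ Finset.range p := Finset.mem_range.2 (Nat.mod_lt e hp)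
  split_ifs with h1 h2
  · simp only [Nat.not_succ_lt_self, false_iff, not_and]; tauto
  · simp only [h2, ne_eq, not_false_eq_true, and_self, iff_true]
    have : 0 < (imageOf g p).terms :=
      Finset.card_pos.2 ⟨e % p, Finset.mem_filter.2 ⟨hr, h2.1⟩⟩
    omega
  · simpa using h2

/-- The polynomial with a given list of terms. -/
noncomputable def listPoly (h : List (ℕ × R)) : R[X] := (h.map fun w => monomial w.1 w.2).sum

omit [DecidableEq R] in
@[simp] theorem listPoly_nil : listPoly ([] : List (ℕ × R)) = 0 := rfl

omit [DecidableEq R] in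
@[simp] theorem listPoly_cons (w : ℕ × R) (h : List (ℕ × R)) :
    listPoly (w :: h) = monomial w.1 w.2 + listPoly h := rfl

omit [DecidableEq R] in
theorem listPoly_append (h s : List (ℕ × R)) : listPoly (h ++ s) = listPoly h + listPoly s := by
  simp [listPoly]

omit [DecidableEq R] in
theorem val_subSparse (m : ℕ) (h : List (ℕ × R)) (g : R[X]) :
    (subSparse m h (wrap m g)).val = wrap m (g - listPoly h) := by
  induction h generalizing g with
  | nil => simp [subSparse]
  | cons w h ih =>
    obtain ⟨e, c⟩ := w
    simp only [subSparse, val_bind, val_natMod, val_read, val_ringSub, val_write, listPoly_cons]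
    rw [← wrap_sub_monomial, ih, sub_sub]

omit [DecidableEq R] in
theorem val_cofactorImages (M : ∀ p : ℕ, CyclicMul.{u} p) {L : ℕ} (P : SLP R Unit L)
    (h : List (ℕ × R)) {p : ℕ} (hp : 0 < p) (qs : List ℕ) (hqs : ∀ q ∈ qs, 0 < q) :
    (cofactorImages M P h p qs).val =
      qs.map fun q => (q, wrap (p * q) (P.toPoly - listPoly h)) := by
  induction qs with
  | nil => rfl
  | cons q qs ih =>
    have hq : 0 < p * q := Nat.mul_pos hp (hqs q (by simp))
    simp only [cofactorImages, val_bind, val_pure, List.map_cons, val_natMul]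
    rw [ih fun q hq => hqs q (by simp [hq]), val_probe M P hq, val_subSparse]

theorem mem_blockTerms {g : ℕ → R} {p n b : ℕ} {w : ℕ × R} :
    w ∈ (blockTerms g p n b).val ↔ ∃ i < n, w = (b + i * p, g (b + i * p)) ∧ w.2 ≠ 0 := by
  induction n generalizing b with
  | zero => simp [blockTerms]
  | succ n ih =>
    simp only [blockTerms, val_bind, val_read, val_isZero, val_natAdd, val_pure,
      decide_eq_true_eq]
    have key : w ∈ (blockTerms g p n (b + p)).val ↔
        ∃ i, i + 1 < n + 1 ∧ w = (b + (i + 1) * p, g (b + (i + 1) * p)) ∧ w.2 ≠ 0 := by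
      rw [ih]
      refine exists_congr fun i => ?_
      rw [show b + p + i * p = b + (i + 1) * p by ring, Nat.add_lt_add_iff_right]
    split_ifs with h
    · rw [key]
      constructor
      · rintro ⟨i, h1, h2⟩; exact ⟨i + 1, h1, h2⟩
      · rintro ⟨i, h1, h2, h3⟩
        rcases i with _ | i
        · exfalso; apply h3; rw [h2]; simpa using h
        · exact ⟨i, h1, h2, h3⟩
    · rw [List.mem_cons, key]
      constructor
      · rintro (rfl | ⟨i, h1, h2⟩)
        · exact ⟨0, by omega, by simp, h⟩
        · exact ⟨i + 1, h1, h2⟩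
      · rintro ⟨i, h1, h2, h3⟩
        rcases i with _ | i
        · left; simpa using h2
        · right; exact ⟨i, h1, h2, h3⟩

theorem nodup_blockTerms {g : ℕ → R} {p : ℕ} (hp : 0 < p) (n b : ℕ) :
    (blockTerms g p n b).val.Nodup := by
  induction n generalizing b with
  | zero => simp [blockTerms]
  | succ n ih =>
    simp only [blockTerms, val_bind, val_read, val_isZero, val_natAdd, val_pure,
      decide_eq_true_eq]
    split_ifs with h
    · exact ih _
    · refine List.nodup_cons.2 ⟨?_, ih _⟩
      rw [mem_blockTerms]
      rintro ⟨i, _, h2, _⟩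
      have := congrArg Prod.fst h2
      simp only at this
      have h3 : 0 ≤ i * p := Nat.zero_le _
      omega

end Probe

section Crt

theorem val_crtSearch {b m q e n : ℕ} (h : ∃ t < n, (b + m * t) % q = e) :
    (b + m * (crtSearch b m q e n).val) % q = e ∧ (crtSearch b m q e n).val < n := by
  induction n with
  | zero => obtain ⟨t, ht, _⟩ := h; omega
  | succ n ih =>
    simp only [crtSearch, val_bind, val_natMul, val_natAdd, val_natMod, val_natEq,
      decide_eq_true_eq]
    split_ifs with h1
    · exact ⟨h1, by simp⟩
    · obtain ⟨t, ht, h2⟩ := h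
      have : t ≠ n := by rintro rfl; exact h1 h2
      obtain ⟨h3, h4⟩ := ih ⟨t, by omega, h2⟩
      exact ⟨h3, by omega⟩

theorem val_crtStep {β A q ε : ℕ} (hq : 0 < q) (hA : 0 < A) (hc : Nat.Coprime A q)
    (hβ : β = ε % A) : (crtStep β A q (ε % q)).val = ε % (A * q) := by
  simp only [crtStep, val_bind, val_natMod, val_natMul, val_natAdd]
  -- the quotient of `ε` modulo `A * q` by `A` is a solution
  have hex : ∃ t < q, (β % q + A % q * t) % q = ε % q := by
    refine ⟨ε % (A * q) / A, ?_, ?_⟩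
    · rw [Nat.div_lt_iff_lt_mul hA, mul_comm q]; exact Nat.mod_lt _ (Nat.mul_pos hA hq)
    · have h1 : β + A * (ε % (A * q) / A) = ε % (A * q) := by
        have := Nat.mod_add_div (ε % (A * q)) A
        rwa [Nat.mod_mul_right_mod, ← hβ] at this
      have h2 : (β % q + A % q * (ε % (A * q) / A)) ≡ β + A * (ε % (A * q) / A) [MOD q] :=
        (Nat.mod_modEq _ _).add ((Nat.mod_modEq _ _).mul_right _)
      rw [h1] at h2
      exact h2.trans (by rw [Nat.ModEq, Nat.mod_mul_left_mod])
  obtain ⟨h1, h2⟩ := val_crtSearch hex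
  set t := (crtSearch (β % q) (A % q) q (ε % q) q).val
  have h3 : β + A * t ≡ ε [MOD q] :=
    (((Nat.mod_modEq β q).add ((Nat.mod_modEq A q).mul_right t)).symm).trans h1
  have h4 : β + A * t ≡ ε [MOD A] := by
    rw [Nat.ModEq, Nat.add_mul_mod_self_left, hβ, Nat.mod_mod]
  have h5 : β + A * t ≡ ε [MOD A * q] := (Nat.modEq_and_modEq_iff_modEq_mul hc).1 ⟨h4, h3⟩
  have hβA : β < A := by rw [hβ]; exact Nat.mod_lt _ hA
  have h6 : β + A * t < A * q := by
    calc β + A * t < A + A * t := by omega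
      _ = A * (t + 1) := by ring
      _ ≤ A * q := Nat.mul_le_mul_left _ h2
  rw [Nat.ModEq, Nat.mod_eq_of_lt h6] at h5
  exact h5

/-- The primes for Chinese remaindering are an initial segment of the given list, and their product
is at least `D` if that of the whole list is. -/
theorem val_crtPrimes (D : ℕ) (ps : List ℕ) (A : ℕ) :
    ∃ n, (crtPrimes D ps A).val = ps.take n ∧
      (D ≤ A * ps.prod → D ≤ A * (ps.take n).prod) := by
  induction ps generalizing A with
  | nil => exact ⟨0, by simp [crtPrimes]⟩
  | cons q qs ih =>
    simp only [crtPrimes, val_bind, val_natLt, decide_eq_true_eq]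
    split_ifs with h
    · simp only [val_bind, val_natMul, val_pure]
      obtain ⟨n, h1, h2⟩ := ih (A * q)
      refine ⟨n + 1, by simp [h1], ?_⟩
      simpa [mul_assoc] using h2
    · exact ⟨0, by simp, fun _ => by simpa using h⟩

/-- At most `⌈log₂ D⌉` primes are used for Chinese remaindering: all of them but the last have a
product less than `D`. -/
theorem two_pow_length_crtPrimes {D : ℕ} {ps : List ℕ} (hps : ∀ p ∈ ps, 2 ≤ p) {A : ℕ}
    (hA : 1 ≤ A) : (crtPrimes D ps A).val = [] ∨
      A * 2 ^ ((crtPrimes D ps A).val.length - 1) < D := by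
  induction ps generalizing A with
  | nil => left; rfl
  | cons q qs ih =>
    simp only [crtPrimes, val_bind, val_natLt, decide_eq_true_eq]
    split_ifs with h
    · right
      have hq := hps q (by simp)
      simp only [val_bind, val_natMul, val_pure, List.length_cons, Nat.add_sub_cancel]
      rcases ih (A := A * q) (fun p hp => hps p (by simp [hp])) (Nat.mul_pos hA (by omega)) with
        h1 | h1
      · rw [h1]; simpa using h
      · rcases Nat.eq_zero_or_pos (crtPrimes D qs (A * q)).val.length with h0 | h0
        · rw [h0]; simpa using h
        · refine lt_of_le_of_lt ?_ h1
          obtain ⟨j, hj⟩ : ∃ j, (crtPrimes D qs (A * q)).val.length = j + 1 :=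
            ⟨_, (Nat.succ_pred_eq_of_pos h0).symm⟩
          rw [hj, pow_succ, Nat.add_sub_cancel, mul_assoc A q, mul_comm (2 ^ j)]
          exact Nat.mul_le_mul_left _ (Nat.mul_le_mul_right _ hq)
    · left; rfl

end Crt

/-! ### Candidate terms -/

section Candidates

variable {R : Type u} [Ring R] [DecidableEq R]

/-- If `ε` is the only exponent of `g` in the class of `d` modulo `p`, then the coefficients modulo
`X ^ (p * q) - 1` in this class consist of a single term, the image of the term of `g`. -/
theorem val_blockTerms_eq_singleton {p q d : ℕ} (hp : 0 < p) (hq : 0 < q) {g : R[X]} {ε : ℕ}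
    (hε : ∀ e, g.coeff e ≠ 0 → e % p = d → e = ε) (hεd : ε % p = d) (ha : g.coeff ε ≠ 0) :
    (blockTerms (wrap (p * q) g) p q d).val = [(ε % (p * q), g.coeff ε)] := by
  have hw : ∀ i < q, wrap (p * q) g (d + i * p) =
      if ε % (p * q) = d + i * p then g.coeff ε else 0 := by
    intro i _
    rw [wrap_apply, Finset.sum_filter]
    have : ∀ e ∈ g.support, (if e % (p * q) = d + i * p then g.coeff e else 0) =
        if e = ε then (if ε % (p * q) = d + i * p then g.coeff ε else 0) else 0 := by
      intro e he
      by_cases h : e = ε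
      · rw [if_pos h, h]
      · rw [if_neg h, if_neg]
        intro h2
        apply h
        refine hε e (mem_support_iff.1 he) ?_
        have h3 : e % (p * q) % p = e % p := Nat.mod_mul_right_mod e p q
        rw [← h3, h2, Nat.add_mul_mod_self_right, ← hεd, Nat.mod_mod]
    rw [Finset.sum_congr rfl this, Finset.sum_ite_eq' g.support ε, if_pos (mem_support_iff.2 ha)]
  have hmem : ∀ w, w ∈ (blockTerms (wrap (p * q) g) p q d).val ↔
      w ∈ [(ε % (p * q), g.coeff ε)] := by
    intro w
    rw [mem_blockTerms, List.mem_singleton]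
    constructor
    · rintro ⟨i, hi, h1, h2⟩
      rw [h1] at h2 ⊢
      simp only at h2
      rw [hw i hi] at h2 ⊢
      split_ifs at h2 ⊢ with h3
      · rw [h3]
      · exact absurd rfl h2
    · rintro rfl
      have hlt : ε % (p * q) < p * q := Nat.mod_lt _ (Nat.mul_pos hp hq)
      have hi : ε % (p * q) / p < q := by
        rw [Nat.div_lt_iff_lt_mul hp, mul_comm q]; exact hlt
      have heq : d + ε % (p * q) / p * p = ε % (p * q) := by
        have := Nat.mod_add_div (ε % (p * q)) p
        rw [Nat.mod_mul_right_mod, hεd, mul_comm p] at this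
        exact this
      refine ⟨ε % (p * q) / p, hi, ?_, ha⟩
      rw [hw _ hi, if_pos heq.symm, heq]
  have := (List.perm_ext_iff_of_nodup (nodup_blockTerms hp q d)
    (List.nodup_singleton _)).2 hmem
  exact List.perm_singleton.1 this

/-- A term that is alone in its class modulo `p` is recovered: its exponent is lifted from its
residue modulo `A` to its residue modulo `A` times the product of the primes in `qs`. -/
theorem val_liftExponent {p d : ℕ} (hp : 0 < p) {g : R[X]} {ε : ℕ}
    (hε : ∀ e, g.coeff e ≠ 0 → e % p = d → e = ε) (hεd : ε % p = d) (ha : g.coeff ε ≠ 0)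
    (qs : List ℕ) (hqs : ∀ q ∈ qs, q.Prime) (hnd : qs.Nodup) {A : ℕ} (hA : 0 < A)
    (hcop : ∀ q ∈ qs, Nat.Coprime A q) :
    (liftExponent p d (g.coeff ε) (qs.map fun q => (q, wrap (p * q) g)) (ε % A) A).val =
      some (ε % (A * qs.prod)) := by
  induction qs generalizing A with
  | nil => simp [liftExponent]
  | cons q qs ih =>
    have hq : q.Prime := hqs q (by simp)
    have hqs' : ∀ r ∈ qs, r.Prime := fun r hr => hqs r (by simp [hr])
    rw [List.nodup_cons] at hnd
    simp only [liftExponent, List.map_cons, val_bind,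
      val_blockTerms_eq_singleton hp hq.pos hε hεd ha, val_ringEq, decide_true, if_true,
      val_natMod, val_natMul, Nat.mod_mul_left_mod,
      val_crtStep hq.pos hA (hcop q (by simp)) rfl]
    rw [ih hqs' hnd.2 (Nat.mul_pos hA hq.pos), List.prod_cons, mul_assoc]
    intro r hr
    refine Nat.Coprime.mul_left (hcop r (by simp [hr])) ((Nat.coprime_primes hq (hqs' r hr)).2 ?_)
    rintro rfl
    exact hnd.1 hr

omit [Ring R] in
theorem val_insertTerm (w : ℕ × R) (l : List (ℕ × R)) :
    (insertTerm w l).val = if w ∈ l then l else l ++ [w] := by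
  induction l with
  | nil => simp [insertTerm]
  | cons y ys ih =>
    simp only [insertTerm, val_bind, val_natEq, val_ringEq, Bool.and_eq_true, decide_eq_true_eq,
      ← Prod.ext_iff]
    by_cases h : w = y
    · simp [h]
    · simp only [h, if_false, val_bind, val_pure, ih, List.mem_cons, false_or]
      split_ifs <;> simp

theorem mem_uTerms {D : ℕ} {f : Image R} {gs : List (ℕ × (ℕ → R))} {n : ℕ} {w : ℕ × R} :
    w ∈ (uTerms D f gs n).val ↔ ∃ d < n, f.coeff d ≠ 0 ∧ w.2 = f.coeff d ∧ w.1 < D ∧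
      (liftExponent f.p d (f.coeff d) gs 0 1).val = some w.1 := by
  induction n with
  | zero => simp [uTerms]
  | succ n ih =>
    have hsplit : (∃ d < n + 1, f.coeff d ≠ 0 ∧ w.2 = f.coeff d ∧ w.1 < D ∧
        (liftExponent f.p d (f.coeff d) gs 0 1).val = some w.1) ↔
        w ∈ (uTerms D f gs n).val ∨ (f.coeff n ≠ 0 ∧ w.2 = f.coeff n ∧ w.1 < D ∧
          (liftExponent f.p n (f.coeff n) gs 0 1).val = some w.1) := by
      rw [ih]
      constructor
      · rintro ⟨d, hd, h⟩
        rcases Nat.lt_succ_iff_lt_or_eq.1 hd with h1 | rfl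
        · exact Or.inl ⟨d, h1, h⟩
        · exact Or.inr h
      · rintro (⟨d, hd, h⟩ | h)
        · exact ⟨d, by omega, h⟩
        · exact ⟨n, by omega, h⟩
    rw [hsplit]
    simp only [uTerms, val_bind, val_read, val_isZero, decide_eq_true_eq]
    by_cases hz : f.coeff n = 0
    · simp [hz]
    · simp only [hz, if_false, val_bind]
      cases ho : (liftExponent f.p n (f.coeff n) gs 0 1).val with
      | none => simp
      | some β =>
        simp only [val_bind, val_natLt, decide_eq_true_eq, Option.some.injEq]
        obtain ⟨e, c⟩ := w
        split_ifs with hβ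
        · rw [val_insertTerm]
          split_ifs with hm
          · constructor
            · exact Or.inl
            · rintro (h | ⟨_, h1, _, h2⟩)
              · exact h
              · simp only at h1 h2; rw [h1, ← h2]; exact hm
          · rw [List.mem_append, List.mem_singleton]
            refine or_congr_right ?_
            constructor
            · intro h
              rw [Prod.mk.injEq] at h
              exact ⟨hz, h.2, h.1 ▸ hβ, h.1.symm⟩
            · rintro ⟨_, h1, _, h2⟩
              simp only at h1 h2; rw [h1, ← h2]
        · simp only [val_pure]
          constructor
          · exact Or.inl
          · rintro (h | ⟨_, _, h1, h2⟩)
            · exact h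
            · omega

theorem nodup_uTerms (D : ℕ) (f : Image R) (gs : List (ℕ × (ℕ → R))) (n : ℕ) :
    (uTerms D f gs n).val.Nodup := by
  induction n with
  | zero => simp [uTerms]
  | succ n ih =>
    simp only [uTerms, val_bind, val_read, val_isZero, decide_eq_true_eq]
    split_ifs
    · exact ih
    · simp only [val_bind]
      cases (liftExponent f.p n (f.coeff n) gs 0 1).val with
      | none => exact ih
      | some β =>
        simp only [val_bind, val_natLt, decide_eq_true_eq]
        split_ifs
        · rw [val_insertTerm]
          split_ifs with hm
          · exact ih
          · refine List.nodup_append.2 ⟨ih, List.nodup_singleton _, ?_⟩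
            intro a ha b hb
            rw [List.mem_singleton] at hb
            rintro rfl
            exact hm (hb ▸ ha)
        · exact ih

theorem length_uTerms_le (D : ℕ) (f : Image R) (gs : List (ℕ × (ℕ → R))) (n : ℕ) :
    (uTerms D f gs n).val.length ≤ ((Finset.range n).filter fun i => f.coeff i ≠ 0).card := by
  induction n with
  | zero => simp [uTerms]
  | succ n ih =>
    rw [Finset.range_add_one, Finset.filter_insert]
    simp only [uTerms, val_bind, val_read, val_isZero, decide_eq_true_eq]
    by_cases h : f.coeff n = 0
    · simpa [h] using ih
    · rw [if_pos (show f.coeff n ≠ 0 from h), if_neg h, Finset.card_insert_of_notMem (by simp)]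
      simp only [val_bind]
      cases (liftExponent f.p n (f.coeff n) gs 0 1).val with
      | none => exact ih.trans (Nat.le_succ _)
      | some β =>
        simp only [val_bind, val_natLt, decide_eq_true_eq]
        split_ifs
        · rw [val_insertTerm]
          split_ifs with hm
          · exact ih.trans (Nat.le_succ _)
          · simpa using ih
        · exact ih.trans (Nat.le_succ _)

end Candidates

/-! ### Product trees and the test of the candidates -/

section Trees

/-- The leaves of a product tree, from left to right. -/
def ProdTree.leaves : ProdTree → List ℕ
  | .nil => []
  | .leaf p => [p]
  | .node _ l r => l.leaves ++ r.leaves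

/-- The label of every node is the product of the leaves below it. -/
def ProdTree.IsValid : ProdTree → Prop
  | .nil => True
  | .leaf _ => True
  | .node m l r => m = l.leaves.prod * r.leaves.prod ∧ l.IsValid ∧ r.IsValid

theorem ProdTree.IsValid.prod_eq {t : ProdTree} (h : t.IsValid) : t.prod = t.leaves.prod := by
  cases t with
  | nil => rfl
  | leaf p => simp [ProdTree.prod, ProdTree.leaves]
  | node m l r => simp [ProdTree.prod, ProdTree.leaves, h.1]

theorem val_prodTree {fuel : ℕ} {l : List ℕ} (h : l.length ≤ fuel) :
    (prodTree fuel l).val.leaves = l ∧ (prodTree fuel l).val.IsValid := by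
  induction fuel generalizing l with
  | zero =>
    have : l = [] := List.length_eq_zero_iff.1 (by omega)
    subst this
    simp [prodTree, ProdTree.leaves, ProdTree.IsValid]
  | succ fuel ih =>
    match l with
    | [] => simp [prodTree, ProdTree.leaves, ProdTree.IsValid]
    | [p] => simp [prodTree, ProdTree.leaves, ProdTree.IsValid]
    | a :: b :: l =>
      have h1 := ih (l := (a :: b :: l).take ((a :: b :: l).length / 2)) (by
        simp only [List.length_take, List.length_cons] at h ⊢; omega)
      have h2 := ih (l := (a :: b :: l).drop ((a :: b :: l).length / 2)) (by
        simp only [List.length_drop, List.length_cons] at h ⊢; omega)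
      have hx : prodTree (fuel + 1) (a :: b :: l) = splitHalf (a :: b :: l) ⊳ fun s =>
        prodTree fuel s.1 ⊳ fun x => prodTree fuel s.2 ⊳ fun y =>
        natMul x.prod y.prod ⊳ fun m => pure (.node m x y) := rfl
      rw [hx]
      simp only [val_bind, val_splitHalf, val_natMul, val_pure, ProdTree.leaves, ProdTree.IsValid]
      exact ⟨by rw [h1.1, h2.1, List.take_append_drop],
        by rw [h1.2.prod_eq, h2.2.prod_eq], h1.2, h2.2⟩

theorem dvd_prod_leaves {t : ProdTree} {p : ℕ} (hp : p ∈ t.leaves) : p ∣ t.leaves.prod :=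
  List.dvd_prod hp

theorem val_residues (e : ℕ) {t : ProdTree} (ht : t.IsValid) (acc : List ℕ) :
    (residues e t acc).val = t.leaves.map (fun p => e % p) ++ acc := by
  induction t generalizing e acc with
  | nil => simp [residues, ProdTree.leaves]
  | leaf p => simp [residues, ProdTree.leaves]
  | node m l r ihl ihr =>
    obtain ⟨_, hl, hr⟩ := ht
    simp only [residues, val_bind, val_natMod, ihl _ hl, ihr _ hr, ProdTree.leaves,
      List.map_append, List.append_assoc]
    rw [hl.prod_eq, hr.prod_eq]
    congr 1
    · exact List.map_congr_left fun p hp => Nat.mod_mod_of_dvd e (dvd_prod_leaves hp)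
    · congr 1
      exact List.map_congr_left fun p hp => Nat.mod_mod_of_dvd e (dvd_prod_leaves hp)

end Trees

section Testing

variable {R : Type u} [Ring R] [DecidableEq R]

theorem val_imageTree (g : R[X]) (ps : List ℕ) :
    (imageTree (ps.map (imageOf g))).val.leaves = ps ∧
      (imageTree (ps.map (imageOf g))).val.IsValid := by
  have : (ps.map (imageOf g)).map Image.p = ps := by
    rw [List.map_map]; exact List.map_id ps
  rw [imageTree, this]
  exact val_prodTree (by simp)

/-- The number of primes `p` in a list for which subtracting the term `w` from the image of `g`
modulo `X ^ p - 1` removes a term. -/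
noncomputable def drops (g : R[X]) (ps : List ℕ) (w : ℕ × R) : ℕ :=
  ps.countP fun p => decide (wrap p g (w.1 % p) ≠ 0 ∧ wrap p g (w.1 % p) = w.2)

theorem val_countDrops (g : R[X]) (w : ℕ × R) (ps : List ℕ) (hps : ∀ p ∈ ps, 0 < p) :
    (countDrops w.2 (ps.map (imageOf g)) (ps.map fun p => w.1 % p)).val = drops g ps w := by
  unfold drops
  induction ps with
  | nil => simp [countDrops]
  | cons p ps ih =>
    have hp : 0 < p := hps p (by simp)
    simp only [List.map_cons, countDrops, val_bind, val_natLt, val_subTerm hp,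
      ih fun p hp => hps p (by simp [hp]), decide_eq_true_eq, terms_sub_lt_iff hp,
      List.countP_cons]
    split_ifs <;> simp

theorem val_select (g : R[X]) {ps : List ℕ} (hps : ∀ p ∈ ps, 0 < p) {t : ProdTree}
    (ht : t.IsValid) (hl : t.leaves = ps) (N₂ : ℕ) (U : List (ℕ × R)) :
    (select (ps.map (imageOf g)) t N₂ U).val = U.filter fun w => decide (N₂ ≤ drops g ps w) := by
  induction U with
  | nil => rfl
  | cons w U ih =>
    simp only [select, val_bind, val_residues _ ht, hl, List.append_nil, val_countDrops g w ps hps,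
      val_natLt, val_pure, ih, List.filter_cons, decide_eq_true_eq]
    by_cases h : N₂ ≤ drops g ps w
    · rw [if_neg (by omega), if_pos h]
    · rw [if_pos (by omega), if_neg h]

theorem val_subAll (g : R[X]) (e : ℕ) (c : R) (ps : List ℕ) (hps : ∀ p ∈ ps, 0 < p) :
    (subAll c (ps.map (imageOf g)) (ps.map fun p => e % p)).val =
      ps.map (imageOf (g - monomial e c)) := by
  induction ps with
  | nil => simp [subAll]
  | cons p ps ih =>
    have hp : 0 < p := hps p (by simp)
    simp only [List.map_cons, subAll, val_bind, val_subTerm hp, val_write, val_pure,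
      ih fun p hp => hps p (by simp [hp])]
    congr 1
    have : (imageOf g p).coeff = wrap p g := rfl
    rw [this, wrap_sub_monomial, Function.update_self, ← wrap_sub_monomial]
    rfl

theorem val_update {ps : List ℕ} (hps : ∀ p ∈ ps, 0 < p) {t : ProdTree}
    (ht : t.IsValid) (hl : t.leaves = ps) (s : List (ℕ × R)) (g : R[X]) :
    (update t s (ps.map (imageOf g))).val = ps.map (imageOf (g - listPoly s)) := by
  induction s generalizing g with
  | nil => simp [update]
  | cons w s ih =>
    obtain ⟨e, c⟩ := w
    simp only [update, val_bind, val_residues _ ht, hl, List.append_nil, val_subAll g e c ps hps,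
      ih, listPoly_cons, sub_sub]

end Testing

/-- The parameter `N₁` of the algorithm. -/
def paramN₁ (T D : ℕ) : ℕ := max 1 (Nat.clog 2 (D ^ (T - 1)))

/-- The parameter `N₂` of the algorithm. -/
def paramN₂ (T D : ℕ) : ℕ := Nat.clog 2 (D ^ T)

/-- The parameter `N` of the algorithm. -/
def paramN (T D : ℕ) : ℕ := max (4 * paramN₁ T D) (paramN₁ T D + paramN₂ T D - 1)

theorem val_params (T D : ℕ) : (params T D).val = (paramN₁ T D, paramN₂ T D, paramN T D) := by
  simp [params, paramN₁, paramN₂, paramN]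

/-! ### Collisions of exponents -/

/-- The exponent `e` collides modulo `p` with another exponent in `E`. -/
def Collides (E : Finset ℕ) (e p : ℕ) : Prop := ∃ e' ∈ E, e' ≠ e ∧ e' % p = e % p

instance (E : Finset ℕ) (e p : ℕ) : Decidable (Collides E e p) := by
  unfold Collides; infer_instance

/-- The primes modulo which `e` collides divide the product of the differences. -/
theorem two_pow_card_collides_le {Q : Finset ℕ} (hQ : ∀ p ∈ Q, p.Prime) (E : Finset ℕ) (e : ℕ) :
    2 ^ (Q.filter (Collides E e)).card ≤ ∏ e' ∈ E.erase e, ((e : ℤ) - e').natAbs := by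
  set m := ∏ e' ∈ E.erase e, ((e : ℤ) - e').natAbs with hm
  have hm0 : 0 < m := by
    refine Finset.prod_pos fun e' he' => ?_
    have := (Finset.mem_erase.1 he').1
    omega
  have h1 : ∏ p ∈ Q.filter (Collides E e), p ∣ m := by
    refine Finset.prod_primes_dvd m (fun p hp => (hQ p (Finset.mem_filter.1 hp).1).prime) ?_
    intro p hp
    obtain ⟨e', he', hne, hmod⟩ := (Finset.mem_filter.1 hp).2
    refine dvd_trans ?_ (Finset.dvd_prod_of_mem _ (Finset.mem_erase.2 ⟨hne, he'⟩))
    rw [← Int.natCast_dvd]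
    exact (Nat.modEq_iff_dvd (n := p) (a := e') (b := e)).1 hmod
  refine le_trans ?_ (Nat.le_of_dvd hm0 h1)
  exact Finset.pow_card_le_prod _ _ _ fun p hp => (hQ p (Finset.mem_filter.1 hp).1).two_le

/-- The differences of the exponents are less than `D`, so their product is less than `D ^ n`,
unless it is empty; in that case there are no collisions at all. -/
theorem card_collides_lt {Q : Finset ℕ} (hQ : ∀ p ∈ Q, p.Prime) {E : Finset ℕ} {e n D : ℕ}
    (hE : ∀ e' ∈ E, e' < D) (he : e < D) (hn : (E.erase e).card ≤ n) :
    (Q.filter (Collides E e)).card = 0 ∨ (Q.filter (Collides E e)).card < Nat.clog 2 (D ^ n) := by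
  have h := two_pow_card_collides_le hQ E e
  rcases Finset.eq_empty_or_nonempty (E.erase e) with h0 | h0
  · left
    rw [h0, Finset.prod_empty] at h
    by_contra hc
    have := Nat.one_lt_two_pow hc
    omega
  · right
    rw [Nat.lt_clog_iff_pow_lt (by norm_num)]
    have h1 : ∏ e' ∈ E.erase e, ((e : ℤ) - e').natAbs < ∏ _e' ∈ E.erase e, D := by
      refine Finset.prod_lt_prod_of_nonempty (fun e' he' => ?_) (fun e' he' => ?_) h0
      · have := (Finset.mem_erase.1 he').1
        omega
      · have := hE e' (Finset.mem_erase.1 he').2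
        omega
    rw [Finset.prod_const] at h1
    have h2 : D ^ (E.erase e).card ≤ D ^ n := Nat.pow_le_pow_right (by omega) hn
    omega

section Combinatorics

variable {R : Type u} [Ring R] [DecidableEq R]

omit [DecidableEq R] in
theorem wrap_of_not_collides {g : R[X]} {e p : ℕ} (h : ¬ Collides g.support e p) :
    wrap p g (e % p) = g.coeff e := by
  rw [wrap_apply, Finset.sum_filter, Finset.sum_congr rfl
    (g := fun e' => if e' = e then g.coeff e else 0), Finset.sum_ite_eq']
  · split_ifs with h1
    · rfl
    · exact (notMem_support_iff.1 h1).symm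
  · intro e' he'
    by_cases h2 : e' = e
    · simp [h2]
    · rw [if_neg h2, if_neg]
      exact fun h3 => h ⟨e', he', h2, h3⟩

/-- Isolated exponents give distinct terms of the image. -/
theorem card_not_collides_le_terms {p : ℕ} (hp : 0 < p) (g : R[X]) :
    (g.support.filter fun e => ¬ Collides g.support e p).card ≤ (imageOf g p).terms := by
  change _ ≤ ((Finset.range p).filter fun i => wrap p g i ≠ 0).card
  refine Finset.card_le_card_of_injOn (fun e => e % p) ?_ ?_
  · intro e he
    rw [Finset.mem_coe, Finset.mem_filter] at he
    rw [Finset.mem_coe, Finset.mem_filter]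
    refine ⟨Finset.mem_range.2 (Nat.mod_lt _ hp), ?_⟩
    rw [wrap_of_not_collides he.2]
    exact mem_support_iff.1 he.1
  · intro e he e' he' h
    rw [Finset.mem_coe, Finset.mem_filter] at he he'
    by_contra hne
    exact he'.2 ⟨e, he.1, hne, h⟩

theorem terms_le_card_image (p : ℕ) (g : R[X]) :
    (imageOf g p).terms ≤ (g.support.image fun e => e % p).card := by
  change ((Finset.range p).filter fun i => wrap p g i ≠ 0).card ≤ _
  refine Finset.card_le_card fun i hi => ?_
  have h := (Finset.mem_filter.1 hi).2
  rw [wrap_apply] at h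
  obtain ⟨e, he, _⟩ := Finset.exists_ne_zero_of_sum_ne_zero h
  rw [Finset.mem_filter] at he
  exact Finset.mem_image.2 ⟨e, he⟩

/-- A class of exponents modulo `p` without isolated exponent has at least two elements. -/
theorem two_mul_terms_le (p : ℕ) (g : R[X]) :
    2 * (imageOf g p).terms ≤
      g.support.card + (g.support.filter fun e => ¬ Collides g.support e p).card := by
  set E := g.support with hE
  set I := E.image fun e => e % p with hI
  refine (Nat.mul_le_mul_left 2 (terms_le_card_image p g)).trans ?_
  have h1 : E.card = ∑ r ∈ I, (E.filter fun e => e % p = r).card :=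
    Finset.card_eq_sum_card_image _ _
  have h2 : (E.filter fun e => ¬ Collides E e p).card =
      ∑ r ∈ I, ((E.filter fun e => ¬ Collides E e p).filter fun e => e % p = r).card :=
    Finset.card_eq_sum_card_fiberwise fun e he =>
      Finset.mem_image_of_mem _ (Finset.mem_filter.1 he).1
  rw [h1, h2, ← Finset.sum_add_distrib]
  have h3 : 2 * I.card = ∑ r ∈ I, 2 := by rw [Finset.sum_const, smul_eq_mul, mul_comm]
  change 2 * I.card ≤ _
  rw [h3]
  refine Finset.sum_le_sum fun r hr => ?_
  obtain ⟨e, he, her⟩ := Finset.mem_image.1 hr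
  have hmem : e ∈ E.filter fun e => e % p = r := Finset.mem_filter.2 ⟨he, her⟩
  by_cases hc : Collides E e p
  · obtain ⟨e', he', hne, hmod⟩ := hc
    have hmem' : e' ∈ E.filter fun e => e % p = r :=
      Finset.mem_filter.2 ⟨he', by rw [hmod]; exact her⟩
    have : 1 < (E.filter fun e => e % p = r).card :=
      Finset.one_lt_card.2 ⟨e', hmem', e, hmem, hne⟩
    omega
  · have h4 : 0 < (E.filter fun e => e % p = r).card := Finset.card_pos.2 ⟨e, hmem⟩
    have h5 : 0 < ((E.filter fun e => ¬ Collides E e p).filter fun e => e % p = r).card :=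
      Finset.card_pos.2 ⟨e, Finset.mem_filter.2 ⟨Finset.mem_filter.2 ⟨he, hc⟩, her⟩⟩
    omega

/-- On average over the primes, fewer than a quarter of the exponents collide; hence, modulo a
prime for which the image has the most terms, more than half of the exponents are isolated. -/
theorem half_not_collide {Q : Finset ℕ} (hQ : ∀ p ∈ Q, p.Prime) {N₁ : ℕ} (hN₁ : 1 ≤ N₁)
    (hcard : 4 * N₁ ≤ Q.card) {g : R[X]} (hg : 0 < g.support.card)
    (hcol : ∀ e ∈ g.support, (Q.filter (Collides g.support e)).card < N₁) {p : ℕ}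
    (hmax : ∀ q ∈ Q, (imageOf g q).terms ≤ (imageOf g p).terms) :
    g.support.card < 2 * (g.support.filter fun e => ¬ Collides g.support e p).card := by
  set E := g.support with hE
  obtain ⟨q, hq, hlt⟩ : ∃ q ∈ Q, 4 * (E.filter fun e => Collides E e q).card < E.card := by
    by_contra! hc
    have h1 : ∑ q ∈ Q, (E.filter fun e => Collides E e q).card =
        ∑ e ∈ E, (Q.filter (Collides E e)).card :=
      (Finset.sum_card_bipartiteAbove_eq_sum_card_bipartiteBelow (fun q e => Collides E e q))
    have h2 : ∑ e ∈ E, (Q.filter (Collides E e)).card ≤ E.card * (N₁ - 1) := by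
      rw [← smul_eq_mul]
      exact Finset.sum_le_card_nsmul _ _ _ fun e he => by have := hcol e he; omega
    have h3 : Q.card * E.card ≤ 4 * ∑ q ∈ Q, (E.filter fun e => Collides E e q).card := by
      rw [Finset.mul_sum, ← smul_eq_mul]
      exact Finset.card_nsmul_le_sum _ _ _ hc
    have h4 : 4 * N₁ * E.card ≤ Q.card * E.card := Nat.mul_le_mul_right _ hcard
    have h5 : 4 * (E.card * (N₁ - 1)) + 4 * E.card = 4 * N₁ * E.card := by
      obtain ⟨k, rfl⟩ : ∃ k, N₁ = k + 1 := ⟨N₁ - 1, by omega⟩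
      rw [Nat.add_sub_cancel]; ring
    omega
  have h1 := card_not_collides_le_terms (hQ q hq).pos g
  have h2 := two_mul_terms_le p g
  have h3 := hmax q hq
  have h4 := Finset.card_filter_add_card_filter_not (s := E) (fun e => Collides E e q)
  rw [← hE] at h1 h2
  omega

theorem drops_eq_card {ps : List ℕ} (hnd : ps.Nodup) (g : R[X]) (w : ℕ × R) :
    drops g ps w = (ps.toFinset.filter fun p =>
      wrap p g (w.1 % p) ≠ 0 ∧ wrap p g (w.1 % p) = w.2).card := by
  rw [drops, List.countP_eq_length_filter, ← List.toFinset_card_of_nodup (hnd.filter _)]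
  congr 1
  ext p
  simp

/-- A term of `g` passes the test: it is removed modulo all primes without collision. -/
theorem le_drops {ps : List ℕ} (hnd : ps.Nodup) {N₁ N₂ : ℕ} (hlen : ps.length = N₁ + N₂ - 1)
    {g : R[X]} {e : ℕ} (he : g.coeff e ≠ 0)
    (hcol : (ps.toFinset.filter (Collides g.support e)).card < N₁) :
    N₂ ≤ drops g ps (e, g.coeff e) := by
  rw [drops_eq_card hnd]
  have h1 : (ps.toFinset.filter fun p => ¬ Collides g.support e p).card ≤
      (ps.toFinset.filter fun p => wrap p g (e % p) ≠ 0 ∧ wrap p g (e % p) = g.coeff e).card := by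
    refine Finset.card_le_card fun p hp => ?_
    rw [Finset.mem_filter] at hp ⊢
    rw [wrap_of_not_collides hp.2]
    exact ⟨hp.1, he, rfl⟩
  have h2 := Finset.card_filter_add_card_filter_not (s := ps.toFinset) (Collides g.support e)
  rw [List.toFinset_card_of_nodup hnd] at h2
  simp only
  omega

/-- A candidate that is not a term of `g` can remove a term only modulo primes with a collision at
its exponent, so it fails the test. -/
theorem coeff_eq_of_le_drops {ps : List ℕ} (hnd : ps.Nodup) {g : R[X]} {w : ℕ × R} {N₂ : ℕ}
    (hcol : (ps.toFinset.filter (Collides g.support w.1)).card < N₂) (h : N₂ ≤ drops g ps w) :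
    g.coeff w.1 = w.2 := by
  by_contra hne
  rw [drops_eq_card hnd] at h
  have : (ps.toFinset.filter fun p => wrap p g (w.1 % p) ≠ 0 ∧ wrap p g (w.1 % p) = w.2).card ≤
      (ps.toFinset.filter (Collides g.support w.1)).card := by
    refine Finset.card_le_card fun p hp => ?_
    rw [Finset.mem_filter] at hp ⊢
    refine ⟨hp.1, ?_⟩
    by_contra hc
    rw [wrap_of_not_collides hc] at hp
    exact hne hp.2.2
  omega

end Combinatorics

/-! ### Correctness of the algorithm -/

section Correct

variable {R : Type u} [Ring R] [DecidableEq R]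

/-- The list `h` consists of terms of `f`, each at most once. -/
def IsPart (f : R[X]) (h : List (ℕ × R)) : Prop :=
  (h.map Prod.fst).Nodup ∧ ∀ w ∈ h, w.2 ≠ 0 ∧ f.coeff w.1 = w.2

omit [DecidableEq R] in
theorem IsPart.coeff_listPoly {f : R[X]} {h : List (ℕ × R)} (hh : IsPart f h) (e : ℕ) :
    (listPoly h).coeff e = if e ∈ h.map Prod.fst then f.coeff e else 0 := by
  induction h with
  | nil => simp
  | cons w h ih =>
    obtain ⟨h1, h2⟩ := hh
    rw [List.map_cons, List.nodup_cons] at h1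
    rw [listPoly_cons, coeff_add, ih ⟨h1.2, fun w hw => h2 w (by simp [hw])⟩, coeff_monomial,
      List.map_cons]
    simp only [List.mem_cons]
    have h3 := (h2 w (by simp)).2
    by_cases hw : w.1 = e
    · subst hw
      rw [if_pos rfl, if_neg h1.1, if_pos (Or.inl rfl), add_zero, h3]
    · have : e ≠ w.1 := fun h => hw h.symm
      rw [if_neg hw, zero_add]
      exact if_congr ⟨Or.inr, fun h => h.resolve_left this⟩ rfl rfl

omit [DecidableEq R] in
theorem IsPart.coeff_sub {f : R[X]} {h : List (ℕ × R)} (hh : IsPart f h) (e : ℕ) :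
    (f - listPoly h).coeff e = if e ∈ h.map Prod.fst then 0 else f.coeff e := by
  rw [Polynomial.coeff_sub, hh.coeff_listPoly]
  split_ifs <;> simp

omit [DecidableEq R] in
theorem IsPart.card_support_sub {g : R[X]} {s : List (ℕ × R)} (hs : IsPart g s) :
    (g - listPoly s).support.card + s.length = g.support.card := by
  have h1 : (g - listPoly s).support = g.support \ (s.map Prod.fst).toFinset := by
    ext e
    rw [mem_support_iff, hs.coeff_sub, Finset.mem_sdiff, mem_support_iff, List.mem_toFinset]
    split_ifs with h <;> simp [h]
  have h2 : (s.map Prod.fst).toFinset ⊆ g.support := by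
    intro e he
    rw [List.mem_toFinset, List.mem_map] at he
    obtain ⟨w, hw, rfl⟩ := he
    rw [mem_support_iff, (hs.2 w hw).2]
    exact (hs.2 w hw).1
  have h3 := Finset.card_sdiff_add_card_eq_card h2
  rw [List.toFinset_card_of_nodup hs.1, List.length_map] at h3
  rw [h1, h3]

omit [DecidableEq R] in
theorem IsPart.append {f : R[X]} {h s : List (ℕ × R)} (hh : IsPart f h)
    (hs : IsPart (f - listPoly h) s) : IsPart f (h ++ s) := by
  have key : ∀ w ∈ s, w.1 ∉ h.map Prod.fst ∧ f.coeff w.1 = w.2 := by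
    intro w hw
    obtain ⟨h1, h2⟩ := hs.2 w hw
    rw [hh.coeff_sub] at h2
    split_ifs at h2 with h3
    · exact absurd h2.symm h1
    · exact ⟨h3, h2⟩
  refine ⟨?_, fun w hw => ?_⟩
  · rw [List.map_append, List.nodup_append]
    refine ⟨hh.1, hs.1, fun a ha b hb => ?_⟩
    obtain ⟨w, hw, rfl⟩ := List.mem_map.1 hb
    rintro rfl
    exact (key w hw).1 ha
  · rcases List.mem_append.1 hw with hw | hw
    · exact hh.2 w hw
    · exact ⟨(hs.2 w hw).1, (key w hw).2⟩

/-- The list of the first `n` primes. -/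
noncomputable def primeList (n : ℕ) : List ℕ := (List.range n).map (Nat.nth Nat.Prime)

theorem prime_of_mem_primeList {n p : ℕ} (hp : p ∈ primeList n) : p.Prime := by
  obtain ⟨i, _, rfl⟩ := List.mem_map.1 hp
  exact Nat.prime_nth_prime i

theorem nodup_primeList (n : ℕ) : (primeList n).Nodup :=
  List.nodup_range.map (Nat.nth_injective Nat.infinite_setOfPred_prime)

theorem length_primeList (n : ℕ) : (primeList n).length = n := by simp [primeList]

theorem take_primeList {m n : ℕ} (h : m ≤ n) : (primeList n).take m = primeList m := by
  rw [primeList, ← List.map_take, List.take_range, min_eq_left h, primeList]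

theorem one_le_paramN₁ (T D : ℕ) : 1 ≤ paramN₁ T D := le_max_left _ _

theorem four_le_paramN (T D : ℕ) : 4 ≤ paramN T D := by
  have := one_le_paramN₁ T D
  unfold paramN
  omega

theorem paramN_mono {T T' D : ℕ} (hD : 1 ≤ D) (h : T' ≤ T) : paramN T' D ≤ paramN T D := by
  have h1 : paramN₁ T' D ≤ paramN₁ T D :=
    max_le_max le_rfl (Nat.clog_mono_right 2 (Nat.pow_le_pow_right hD (by omega)))
  have h2 : paramN₂ T' D ≤ paramN₂ T D := Nat.clog_mono_right 2 (Nat.pow_le_pow_right hD h)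
  unfold paramN
  omega

/-- The image with the most terms among the images modulo `X ^ p - 1`. -/
theorem exists_best {g : R[X]} {ps : List ℕ} {f₀ : Image R} {fs : List (Image R)}
    (h : f₀ :: fs = ps.map (imageOf g)) :
    ∃ p ∈ ps, (best f₀ fs).val = imageOf g p ∧
      ∀ q ∈ ps, (imageOf g q).terms ≤ (imageOf g p).terms := by
  obtain ⟨h1, h2⟩ := val_best f₀ fs
  rw [h] at h1 h2
  obtain ⟨p, hp, hpe⟩ := List.mem_map.1 h1
  refine ⟨p, hp, hpe.symm, fun q hq => ?_⟩
  rw [hpe]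
  exact h2 _ (List.mem_map.2 ⟨q, hq, rfl⟩)

/-- The terms found in one round of the algorithm are terms of `g`, and they make up at least half
of the terms of `g`. -/
theorem isPart_round {g : R[X]} {T D : ℕ} (hgD : ∀ e, g.coeff e ≠ 0 → e < D)
    (hgT : g.support.card ≤ T) (hg : 0 < g.support.card) {p : ℕ}
    (hp : p ∈ primeList (paramN T D))
    (hmax : ∀ q ∈ primeList (paramN T D), (imageOf g q).terms ≤ (imageOf g p).terms)
    {qs : List ℕ} (hqs : ∀ q ∈ qs, q.Prime) (hnd : qs.Nodup) (hqD : D ≤ qs.prod)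
    {s : List (ℕ × R)}
    (hs : s = (uTerms D (imageOf g p) (qs.map fun q => (q, wrap (p * q) g)) p).val.filter fun w =>
      decide (paramN₂ T D ≤ drops g (primeList (paramN₁ T D + paramN₂ T D - 1)) w)) :
    IsPart g s ∧ g.support.card ≤ 2 * s.length := by
  have hpp := prime_of_mem_primeList hp
  have hE : ∀ e ∈ g.support, e < D := fun e he => hgD e (mem_support_iff.1 he)
  have hT : 1 ≤ T := by omega
  have hcol₁ : ∀ n, ∀ e ∈ g.support,
      ((primeList n).toFinset.filter (Collides g.support e)).card < paramN₁ T D := by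
    intro n e he
    have := card_collides_lt (Q := (primeList n).toFinset) (n := T - 1)
      (fun p hp => prime_of_mem_primeList (List.mem_toFinset.1 hp)) hE (hE e he)
      (by rw [Finset.card_erase_of_mem he]; omega)
    unfold paramN₁
    omega
  have hmem : ∀ w, w ∈ s ↔ w ∈ (uTerms D (imageOf g p)
      (qs.map fun q => (q, wrap (p * q) g)) p).val ∧
      paramN₂ T D ≤ drops g (primeList (paramN₁ T D + paramN₂ T D - 1)) w := by
    intro w
    rw [hs, List.mem_filter, decide_eq_true_iff]
  have hsound : ∀ w ∈ s, w.2 ≠ 0 ∧ g.coeff w.1 = w.2 := by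
    intro w hw
    obtain ⟨h1, h2⟩ := (hmem w).1 hw
    obtain ⟨d, hd, h3, h4, h5, _⟩ := mem_uTerms.1 h1
    have h3' : wrap p g d ≠ 0 := h3
    have h4' : w.2 = wrap p g d := h4
    refine ⟨by rw [h4']; exact h3', ?_⟩
    rcases Nat.lt_or_ge D 2 with hD | hD
    · -- for `D = 1` the polynomial is constant
      have hw0 : w.1 = 0 := by omega
      have hnc : ¬ Collides g.support d p := by
        rintro ⟨e, he, hne, hmod⟩
        have := hE e he
        rw [wrap_apply] at h3'
        obtain ⟨e', he', _⟩ := Finset.exists_ne_zero_of_sum_ne_zero h3'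
        rw [Finset.mem_filter] at he'
        have := hE e' he'.1
        have h0 : e' = 0 := by omega
        rw [h0, Nat.zero_mod] at he'
        omega
      have h6 := wrap_of_not_collides hnc
      rw [Nat.mod_eq_of_lt hd] at h6
      have : g.coeff d ≠ 0 := by rw [← h6]; exact h3'
      have := hgD d this
      rw [h4', h6, hw0, show d = 0 by omega]
    · refine coeff_eq_of_le_drops (nodup_primeList _) ?_ h2
      rcases card_collides_lt (Q := (primeList (paramN₁ T D + paramN₂ T D - 1)).toFinset) (n := T)
        (fun p hp => prime_of_mem_primeList (List.mem_toFinset.1 hp)) hE h5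
        ((Finset.card_erase_le).trans hgT) with h6 | h6
      · rw [h6]
        refine Nat.clog_pos (by norm_num) ?_
        calc 2 ≤ D := hD
          _ ≤ D ^ T := Nat.le_self_pow (by omega) D
      · exact h6
  refine ⟨⟨?_, hsound⟩, ?_⟩
  · have hnds : s.Nodup := by rw [hs]; exact (nodup_uTerms _ _ _ _).filter _
    refine hnds.map_on ?_
    intro w hw w' hw' h
    refine Prod.ext h ?_
    rw [← (hsound w hw).2, ← (hsound w' hw').2, h]
  · have h1 : g.support.card < 2 * (g.support.filter fun e => ¬ Collides g.support e p).card := by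
      refine half_not_collide (Q := (primeList (paramN T D)).toFinset)
        (fun p hp => prime_of_mem_primeList (List.mem_toFinset.1 hp)) (one_le_paramN₁ T D) ?_ hg
        (hcol₁ _) (fun q hq => hmax q (List.mem_toFinset.1 hq))
      rw [List.toFinset_card_of_nodup (nodup_primeList _), length_primeList]
      exact le_max_left _ _
    have h2 : (g.support.filter fun e => ¬ Collides g.support e p).card ≤
        (s.map Prod.fst).toFinset.card := by
      refine Finset.card_le_card fun e he => ?_
      rw [Finset.mem_filter] at he
      obtain ⟨he, hnc⟩ := he
      have hce : g.coeff e ≠ 0 := mem_support_iff.1 he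
      rw [List.mem_toFinset, List.mem_map]
      refine ⟨(e, g.coeff e), (hmem _).2 ⟨?_, ?_⟩, rfl⟩
      · refine mem_uTerms.2 ⟨e % p, Nat.mod_lt _ hpp.pos, ?_, ?_, hE e he, ?_⟩
        · change wrap p g (e % p) ≠ 0
          rw [wrap_of_not_collides hnc]; exact hce
        · exact (wrap_of_not_collides hnc).symm
        · change (liftExponent p (e % p) (wrap p g (e % p)) _ 0 1).val = some e
          rw [wrap_of_not_collides hnc]
          have := val_liftExponent hpp.pos (g := g) (ε := e) (d := e % p) (fun e' he' hmod => by
            by_contra hne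
            exact hnc ⟨e', mem_support_iff.2 he', hne, hmod⟩) rfl hce qs hqs hnd
            (A := 1) one_pos (fun q _ => Nat.coprime_one_left q)
          rw [Nat.mod_one] at this
          rw [this, one_mul, Nat.mod_eq_of_lt ((hE e he).trans_le hqD)]
      · exact le_drops (nodup_primeList _) (length_primeList _) hce (hcol₁ _ e he)
    have h3 := List.toFinset_card_le (s.map Prod.fst)
    rw [List.length_map] at h3
    omega

end Correct

/-! ### The main loop -/

section Loop

variable {R : Type u} [Ring R] [DecidableEq R]

/-- The data of one round of the main loop: `g = f - h` is the polynomial whose terms are still to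
be found, `p` the prime that is chosen, `U` the set of candidates, and `s` the terms found. -/
structure IsRound (g : R[X]) (T D : ℕ) (qs : List ℕ) (p : ℕ) (U s : List (ℕ × R)) : Prop where
  mem : p ∈ primeList (paramN T D)
  max : ∀ q ∈ primeList (paramN T D), (imageOf g q).terms ≤ (imageOf g p).terms
  candidates : U = (uTerms D (imageOf g p) (qs.map fun q => (q, wrap (p * q) g)) p).val
  found : s = U.filter fun w =>
    decide (paramN₂ T D ≤ drops g (primeList (paramN₁ T D + paramN₂ T D - 1)) w)

theorem IsRound.isPart {g : R[X]} {T D : ℕ} {qs : List ℕ} {p : ℕ} {U s : List (ℕ × R)}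
    (h : IsRound g T D qs p U s) (hgD : ∀ e, g.coeff e ≠ 0 → e < D)
    (hgT : g.support.card ≤ T) (hg : 0 < g.support.card) (hqs : ∀ q ∈ qs, q.Prime)
    (hnd : qs.Nodup) (hqD : D ≤ qs.prod) : IsPart g s ∧ g.support.card ≤ 2 * s.length :=
  isPart_round hgD hgT hg h.mem h.max hqs hnd hqD (by rw [h.found, h.candidates])

theorem IsRound.terms_pos {g : R[X]} {T D : ℕ} {qs : List ℕ} {p : ℕ} {U s : List (ℕ × R)}
    (h : IsRound g T D qs p U s) (h2 : 0 < s.length) :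
    0 < (imageOf g p).terms := by
  obtain ⟨w, hw⟩ := List.exists_mem_of_length_pos h2
  rw [h.found, List.mem_filter, h.candidates, mem_uTerms] at hw
  obtain ⟨⟨d, hd, h3, _⟩, _⟩ := hw
  exact Finset.card_pos.2 ⟨d, Finset.mem_filter.2 ⟨Finset.mem_range.2 hd, h3⟩⟩

omit [DecidableEq R] in
theorem terms_eq_zero {g : R[X]} (hg : g.support.card = 0) [DecidableEq R] (p : ℕ) :
    (imageOf g p).terms = 0 := by
  have := two_mul_terms_le p g
  have h2 := Finset.card_filter_le g.support (fun e => ¬ Collides g.support e p)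
  omega

omit [DecidableEq R] in
/-- The invariants of the main loop: `h` consists of terms of `f`, and `f - h` has at most `T`
terms, of degree less than `D`. -/
structure LoopInv (f : R[X]) (T D : ℕ) (qs : List ℕ) (h : List (ℕ × R)) : Prop where
  isPart : IsPart f h
  card_le : (f - listPoly h).support.card ≤ T
  lt : ∀ e, f.coeff e ≠ 0 → e < D
  prime : ∀ q ∈ qs, q.Prime
  nodup : qs.Nodup
  le_prod : 1 ≤ T → D ≤ qs.prod

omit [DecidableEq R] in
theorem LoopInv.coeff_lt {f : R[X]} {T D : ℕ} {qs : List ℕ} {h : List (ℕ × R)}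
    (H : LoopInv f T D qs h) (e : ℕ) (he : (f - listPoly h).coeff e ≠ 0) : e < D := by
  rw [H.isPart.coeff_sub] at he
  split_ifs at he with h1
  · exact absurd rfl he
  · exact H.lt e he

theorem LoopInv.round {f : R[X]} {T D : ℕ} {qs : List ℕ} {h : List (ℕ × R)}
    (H : LoopInv f T D qs h) (hg : 0 < (f - listPoly h).support.card) {p : ℕ}
    {U s : List (ℕ × R)} (hr : IsRound (f - listPoly h) T D qs p U s) :
    LoopInv f (T - s.length) D qs (h ++ s) ∧
      (f - listPoly (h ++ s)).support.card + s.length = (f - listPoly h).support.card ∧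
      (f - listPoly h).support.card ≤ 2 * s.length := by
  obtain ⟨h1, h2⟩ := hr.isPart H.coeff_lt H.card_le hg H.prime H.nodup
    (H.le_prod (hg.trans_le H.card_le))
  have h3 := h1.card_support_sub
  rw [sub_sub, ← listPoly_append] at h3
  have := H.card_le
  exact ⟨⟨H.isPart.append h1, by omega, H.lt, H.prime, H.nodup,
    fun h => H.le_prod (by omega)⟩, h3, h2⟩

/-- One round of the main loop: the values of the subroutines, and the state that is passed on. -/
theorem exists_round (M : ∀ p : ℕ, CyclicMul.{u} p) {L : ℕ} (P : SLP R Unit L) {T D : ℕ}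
    {qs : List ℕ} {h : List (ℕ × R)} (H : LoopInv P.toPoly T D qs h)
    (hg : 0 < (P.toPoly - listPoly h).support.card) (fuel : ℕ) {f₀ : Image R} {fs : List (Image R)}
    (hfs : f₀ :: fs = (primeList (paramN T D)).map (imageOf (P.toPoly - listPoly h))) :
    ∃ p U s, IsRound (P.toPoly - listPoly h) T D qs p U s ∧
      (best f₀ fs).val = imageOf (P.toPoly - listPoly h) p ∧
      (uTerms D (imageOf (P.toPoly - listPoly h) p)
        (qs.map fun q => (q, wrap (p * q) (P.toPoly - listPoly h))) p).val = U ∧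
      (cofactorImages M P h p qs).val =
        qs.map (fun q => (q, wrap (p * q) (P.toPoly - listPoly h))) ∧
      (select ((f₀ :: fs).take (paramN₁ T D + paramN₂ T D - 1))
        (imageTree ((f₀ :: fs).take (paramN₁ T D + paramN₂ T D - 1))).val
        (paramN₂ T D) U).val = s ∧
      (update (imageTree ((f₀ :: fs).take (paramN (T - s.length) D))).val s
        ((f₀ :: fs).take (paramN (T - s.length) D))).val =
          (primeList (paramN (T - s.length) D)).map (imageOf (P.toPoly - listPoly (h ++ s))) ∧
      (loop M P D qs (fuel + 1) (f₀ :: fs) T (paramN₁ T D) (paramN₂ T D) h).val =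
        (loop M P D qs fuel
          ((primeList (paramN (T - s.length) D)).map (imageOf (P.toPoly - listPoly (h ++ s))))
          (T - s.length) (paramN₁ (T - s.length) D) (paramN₂ (T - s.length) D) (h ++ s)).val := by
  set g := P.toPoly - listPoly h with hgdef
  obtain ⟨p, hp, hbest, hmax⟩ := exists_best hfs
  have hpp := prime_of_mem_primeList hp
  have hpos : ∀ n, ∀ q ∈ primeList n, 0 < q := fun n q hq => (prime_of_mem_primeList hq).pos
  obtain ⟨U, hU⟩ : ∃ U, U = (uTerms D (imageOf g p) (qs.map fun q => (q, wrap (p * q) g)) p).val :=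
    ⟨_, rfl⟩
  obtain ⟨s, hs⟩ : ∃ s, s = U.filter fun w =>
      decide (paramN₂ T D ≤ drops g (primeList (paramN₁ T D + paramN₂ T D - 1)) w) := ⟨_, rfl⟩
  have hr : IsRound g T D qs p U s := ⟨hp, hmax, hU, hs⟩
  obtain ⟨h1, h2⟩ := hr.isPart H.coeff_lt H.card_le hg H.prime H.nodup
    (H.le_prod (hg.trans_le H.card_le))
  have hterms : 0 < (imageOf g p).terms := hr.terms_pos (by omega)
  have hD : 1 ≤ D := by
    obtain ⟨e, he⟩ := Finset.card_pos.1 hg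
    have := H.coeff_lt e (mem_support_iff.1 he)
    omega
  have hcof : (cofactorImages M P h p qs).val = qs.map (fun q => (q, wrap (p * q) g)) :=
    val_cofactorImages M P h hpp.pos qs fun q hq => (H.prime q hq).pos
  have htake₁ : (f₀ :: fs).take (paramN₁ T D + paramN₂ T D - 1) =
      (primeList (paramN₁ T D + paramN₂ T D - 1)).map (imageOf g) := by
    rw [hfs, ← List.map_take, take_primeList (show _ ≤ paramN T D from le_max_right _ _)]
  have htake₂ : (f₀ :: fs).take (paramN (T - s.length) D) =
      (primeList (paramN (T - s.length) D)).map (imageOf g) := by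
    rw [hfs, ← List.map_take, take_primeList (paramN_mono hD (Nat.sub_le _ _))]
  have hsel : (select ((f₀ :: fs).take (paramN₁ T D + paramN₂ T D - 1))
      (imageTree ((f₀ :: fs).take (paramN₁ T D + paramN₂ T D - 1))).val (paramN₂ T D) U).val =
        s := by
    rw [htake₁, val_select g (hpos _) (val_imageTree _ _).2 (val_imageTree _ _).1, hs]
  have hupd : (update (imageTree ((f₀ :: fs).take (paramN (T - s.length) D))).val s
      ((f₀ :: fs).take (paramN (T - s.length) D))).val =
        (primeList (paramN (T - s.length) D)).map (imageOf (P.toPoly - listPoly (h ++ s))) := by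
    rw [htake₂, val_update (hpos _) (val_imageTree _ _).2 (val_imageTree _ _).1, listPoly_append,
      ← sub_sub]
  refine ⟨p, U, s, hr, hbest, hU.symm, hcof, hsel, hupd, ?_⟩
  have hfp : (imageOf g p).p = p := rfl
  simp only [loop, val_bind, hbest, val_natEq, decide_eq_true_eq, hterms.ne', if_false, hfp, hcof,
    ← hU, val_natAdd, val_natSub, val_numTerms, val_params, hsel, hupd]

/-- The main loop finds all terms. One unit of fuel per missing term is enough, since every round
finds at least one. -/
theorem val_loop (M : ∀ p : ℕ, CyclicMul.{u} p) {L : ℕ} (P : SLP R Unit L) {D : ℕ} {qs : List ℕ}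
    (fuel : ℕ) (T : ℕ) (h : List (ℕ × R)) (H : LoopInv P.toPoly T D qs h)
    (hfuel : (P.toPoly - listPoly h).support.card < fuel) :
    IsPart P.toPoly (loop M P D qs fuel
        ((primeList (paramN T D)).map (imageOf (P.toPoly - listPoly h))) T (paramN₁ T D)
        (paramN₂ T D) h).val ∧
      P.toPoly = listPoly (loop M P D qs fuel
        ((primeList (paramN T D)).map (imageOf (P.toPoly - listPoly h))) T (paramN₁ T D)
        (paramN₂ T D) h).val := by
  induction fuel generalizing T h with
  | zero => omega
  | succ fuel ih =>
    obtain ⟨f₀, fs, hfs⟩ : ∃ f₀ fs, f₀ :: fs =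
        (primeList (paramN T D)).map (imageOf (P.toPoly - listPoly h)) := by
      cases hl : (primeList (paramN T D)).map (imageOf (P.toPoly - listPoly h)) with
      | nil =>
        have h1 := congrArg List.length hl
        rw [List.length_map, length_primeList] at h1
        have := four_le_paramN T D
        simp only [List.length_nil] at h1
        omega
      | cons a l => exact ⟨a, l, rfl⟩
    rw [← hfs]
    rcases Nat.eq_zero_or_pos (P.toPoly - listPoly h).support.card with h0 | h0
    · obtain ⟨p, _, hbest, _⟩ := exists_best hfs
      have : (loop M P D qs (fuel + 1) (f₀ :: fs) T (paramN₁ T D) (paramN₂ T D) h).val = h := by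
        simp only [loop, val_bind, hbest, val_natEq, terms_eq_zero h0, decide_true, if_true,
          val_pure]
      rw [this]
      refine ⟨H.isPart, ?_⟩
      rw [Finset.card_eq_zero, support_eq_empty, sub_eq_zero] at h0
      exact h0
    · obtain ⟨p, U, s, hr, _, _, _, _, _, hloop⟩ := exists_round M P H h0 fuel hfs
      obtain ⟨H', h1, h2⟩ := H.round h0 hr
      rw [hloop]
      exact ih _ _ H' (by omega)

omit [DecidableEq R] in
theorem support_card_listPoly_nil (f : R[X]) :
    (f - listPoly []).support.card = f.support.card := by simp

omit [DecidableEq R] in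
/-- The initial state of the main loop. -/
theorem loopInv_init {f : R[X]} {T D : ℕ} (hT : f.support.card ≤ T) (hD : f.degree < D) :
    LoopInv f T D (crtPrimes D (primeList (paramN T D)) 1).val [] := by
  obtain ⟨n, hn, hprod⟩ := val_crtPrimes D (primeList (paramN T D)) 1
  have hlt : ∀ e, f.coeff e ≠ 0 → e < D := by
    intro e he
    have := le_degree_of_ne_zero he
    exact_mod_cast this.trans_lt hD
  refine ⟨⟨by simp, by simp⟩, by simpa using hT, hlt, ?_, ?_, ?_⟩
  · rw [hn]
    exact fun q hq => prime_of_mem_primeList (List.mem_of_mem_take hq)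
  · rw [hn]
    exact (nodup_primeList _).sublist (List.take_sublist _ _)
  · intro hT1
    rw [hn]
    have h1 := hprod (by
      rw [one_mul]
      have h2 : paramN₂ T D ≤ paramN T D := by
        have := one_le_paramN₁ T D
        unfold paramN
        omega
      calc D ≤ D ^ T := Nat.le_self_pow (by omega) D
        _ ≤ 2 ^ paramN₂ T D := Nat.le_pow_clog (by norm_num) _
        _ ≤ 2 ^ paramN T D := Nat.pow_le_pow_right (by norm_num) h2
        _ = 2 ^ (primeList (paramN T D)).length := by rw [length_primeList]
        _ ≤ (primeList (paramN T D)).prod :=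
          List.pow_card_le_prod _ _ fun p hp => (prime_of_mem_primeList hp).two_le)
    rwa [one_mul] at h1

/-- The algorithm returns the terms of `f`. -/
theorem uiPoly_correct (M : ∀ p : ℕ, CyclicMul.{u} p) {L : ℕ} (P : SLP R Unit L) {T D : ℕ}
    (hT : P.toPoly.support.card ≤ T) (hD : P.toPoly.degree < D) :
    ((uiPoly M P T D).val.map Prod.fst).Nodup ∧ ∀ (e : ℕ) (c : R),
      (e, c) ∈ (uiPoly M P T D).val ↔ c ≠ 0 ∧ P.toPoly.coeff e = c := by
  have hval : (uiPoly M P T D).val = (loop M P D (crtPrimes D (primeList (paramN T D)) 1).val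
      (T + 1) ((primeList (paramN T D)).map (imageOf (P.toPoly - listPoly []))) T (paramN₁ T D)
      (paramN₂ T D) []).val := by
    have h1 : (firstPrimes (paramN T D)).val = primeList (paramN T D) := val_firstPrimes _
    have h2 := val_images M P (primeList (paramN T D))
      fun p hp => (prime_of_mem_primeList hp).pos
    simp only [uiPoly, val_bind, val_params, h1, h2, listPoly_nil, sub_zero]
  obtain ⟨h1, h2⟩ := val_loop M P (T + 1) T [] (loopInv_init hT hD)
    (by rw [support_card_listPoly_nil]; omega)
  rw [← hval] at h1 h2
  refine ⟨h1.1, fun e c => ⟨fun h => h1.2 _ h, fun h => ?_⟩⟩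
  have h3 := h1.coeff_listPoly e
  rw [← h2, h.2] at h3
  split_ifs at h3 with h4
  · obtain ⟨w, hw, rfl⟩ := List.mem_map.1 h4
    have h5 := (h1.2 w hw).2
    rw [h.2] at h5
    rw [h5]
    exact hw
  · exact absurd h3 h.1

end Loop

/-! ### Costs of the subroutines -/

theorem linCost_le_sq {Λ a b : ℕ} (hΛ : 1000 ≤ Λ) (ha : a.size ≤ 4 * Λ) (hb : b.size ≤ 4 * Λ) :
    linCost a b ≤ Λ ^ 2 := by
  refine (linCost_le ha hb).trans ?_
  nlinarith

theorem mulCost_le_pow {Λ a b : ℕ} (hΛ : 1000 ≤ Λ) (ha : a.size ≤ 4 * Λ) (hb : b.size ≤ 4 * Λ) :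
    mulCost a b ≤ Λ ^ 4 := by
  refine (mulCost_le_cube ha hb).trans ?_
  calc (4 * Λ + 4 * Λ + 1) ^ 3 ≤ (9 * Λ) ^ 3 := Nat.pow_le_pow_left (by omega) 3
    _ = 729 * Λ ^ 3 := by ring
    _ ≤ Λ * Λ ^ 3 := Nat.mul_le_mul_right _ (by omega)
    _ = Λ ^ 4 := by ring

theorem mulCost_le_mul {Λ W a b : ℕ} (h : a.size + b.size + 1 ≤ W) (hW : W.size ≤ Λ) :
    mulCost a b ≤ W * Λ ^ 2 := by
  unfold mulCost linCost
  exact Nat.mul_le_mul h (Nat.pow_le_pow_left ((Nat.size_le_size h).trans hW) 2)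

theorem size_mod_le (a b : ℕ) : (a % b).size ≤ a.size := Nat.size_le_size (Nat.mod_le a b)

theorem size_mod_le_right (a : ℕ) {b : ℕ} (hb : 0 < b) : (a % b).size ≤ b.size :=
  Nat.size_le_size (Nat.mod_lt a hb).le

section Lift

variable {R : Type u} [Ring R] [DecidableEq R]

theorem bitOps_blockTerms_le {Λ : ℕ} (hΛ : 1000 ≤ Λ) (g : ℕ → R) {p : ℕ} (hp : p.size ≤ 4 * Λ)
    (n b : ℕ) (hb : (b + n * p).size ≤ 4 * Λ) :
    (blockTerms g p n b).bitOps ≤ n * (2 * Λ ^ 2) := by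
  induction n generalizing b with
  | zero => simp [blockTerms]
  | succ n ih =>
    have h1 := ih (b + p) (by rwa [show b + p + n * p = b + (n + 1) * p by ring])
    have hbs : b.size ≤ 4 * Λ := (Nat.size_le_size (Nat.le_add_right _ _)).trans hb
    have h2 := linCost_le_sq hΛ hbs hp
    have h3 : b.size + 1 ≤ Λ ^ 2 := by nlinarith
    simp only [blockTerms, bitOps_bind, val_read, val_isZero, val_natAdd, bitOps_read,
      bitOps_isZero, bitOps_natAdd, bitOps_pure]
    rw [add_mul, one_mul]
    omega

theorem ringOps_blockTerms (g : ℕ → R) (p n b : ℕ) : (blockTerms g p n b).ringOps = n := by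
  induction n generalizing b with
  | zero => rfl
  | succ n ih =>
    simp only [blockTerms, ringOps_bind, val_read, val_isZero, val_natAdd, ringOps_read,
      ringOps_isZero, ringOps_natAdd, ringOps_pure, ih]
    omega

theorem bitOps_crtSearch_le {Λ b m q e : ℕ} (hΛ : 1000 ≤ Λ) (hb : b.size ≤ Λ) (hm : m.size ≤ Λ)
    (hq : q.size ≤ Λ) (he : e.size ≤ Λ) (n : ℕ) (hn : n.size ≤ Λ) :
    (crtSearch b m q e n).bitOps ≤ n * (3 * Λ ^ 4) := by
  induction n with
  | zero => simp [crtSearch]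
  | succ t ih =>
    have ht : t.size ≤ Λ := (Nat.size_le_size (Nat.le_succ t)).trans hn
    have h1 := ih ht
    have hy := size_mul_le m t
    have hy' := size_add_le b (m * t)
    have c1 := mulCost_le_pow hΛ (show m.size ≤ 4 * Λ by omega) (show t.size ≤ 4 * Λ by omega)
    have c2 := linCost_le_sq hΛ (show b.size ≤ 4 * Λ by omega)
      (show (m * t).size ≤ 4 * Λ by omega)
    have c3 := mulCost_le_pow hΛ (show (b + m * t).size ≤ 4 * Λ by omega)
      (show q.size ≤ 4 * Λ by omega)
    have c4 := linCost_le_sq hΛ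
      (show ((b + m * t) % q).size ≤ 4 * Λ by have := size_mod_le (b + m * t) q; omega)
      (show e.size ≤ 4 * Λ by omega)
    have hpow : 2 * Λ ^ 2 ≤ Λ ^ 4 := by
      rw [show Λ ^ 4 = Λ ^ 2 * Λ ^ 2 by ring]
      exact Nat.mul_le_mul_right _ (by nlinarith)
    simp only [crtSearch, bitOps_bind, val_natMul, val_natAdd, val_natMod, val_natEq,
      bitOps_natMul, bitOps_natAdd, bitOps_natMod, bitOps_natEq, decide_eq_true_eq]
    rw [add_mul, one_mul]
    split_ifs
    · simp only [bitOps_pure]; omega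
    · omega

theorem crtSearch_lt (b m q e : ℕ) {n : ℕ} (hn : 0 < n) : (crtSearch b m q e n).val < n := by
  induction n with
  | zero => omega
  | succ t ih =>
    simp only [crtSearch, val_bind, val_natMul, val_natAdd, val_natMod, val_natEq,
      decide_eq_true_eq]
    split_ifs
    · simp
    · rcases Nat.eq_zero_or_pos t with rfl | ht
      · simp [crtSearch]
      · exact (ih ht).trans (Nat.lt_succ_self t)

@[simp] theorem ringOps_crtSearch (b m q e n : ℕ) : (crtSearch b m q e n).ringOps = 0 := by
  induction n with
  | zero => rfl
  | succ t ih =>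
    simp only [crtSearch, ringOps_bind, val_natMul, val_natAdd, val_natMod, val_natEq,
      ringOps_natMul, ringOps_natAdd, ringOps_natMod, ringOps_natEq, decide_eq_true_eq]
    split_ifs
    · simp
    · simp [ih]

@[simp] theorem ringOps_crtStep (β A q e : ℕ) : (crtStep β A q e).ringOps = 0 := by
  simp [crtStep]

theorem crtStep_lt {β A q : ℕ} (e : ℕ) (hβ : β < A) (hq : 0 < q) :
    (crtStep β A q e).val < A * q := by
  simp only [crtStep, val_bind, val_natMod, val_natMul, val_natAdd]
  have h := crtSearch_lt (β % q) (A % q) q e hq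
  set t := (crtSearch (β % q) (A % q) q e q).val
  calc β + A * t < A + A * t := by omega
    _ = A * (t + 1) := by ring
    _ ≤ A * q := Nat.mul_le_mul_left _ h

theorem bitOps_crtStep_le {Λ ℓ β A q e : ℕ} (hΛ : 1000 ≤ Λ) (hℓ : 1 ≤ ℓ)
    (hW : (10 * (ℓ * Λ)).size ≤ Λ) (hβ : β < A) (hA : A.size ≤ 2 * (ℓ * Λ)) (hq0 : 0 < q)
    (hq : q.size ≤ Λ) (hqℓ : q ≤ 2 * (ℓ * Λ)) (he : e.size ≤ Λ) :
    (crtStep β A q e).bitOps ≤ 7 * (ℓ * Λ ^ 5) := by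
  have hΛℓ : Λ ≤ ℓ * Λ := Nat.le_mul_of_pos_left _ hℓ
  have hβs : β.size ≤ 2 * (ℓ * Λ) := (Nat.size_le_size hβ.le).trans hA
  have h1 : mulCost β q ≤ 10 * (ℓ * Λ) * Λ ^ 2 := mulCost_le_mul (by omega) hW
  have h2 : mulCost A q ≤ 10 * (ℓ * Λ) * Λ ^ 2 := mulCost_le_mul (by omega) hW
  have h3 := bitOps_crtSearch_le hΛ (b := β % q) (m := A % q) (q := q) (e := e)
    ((size_mod_le_right β hq0).trans hq) ((size_mod_le_right A hq0).trans hq) hq he q hq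
  have h4 := crtSearch_lt (β % q) (A % q) q e hq0
  set t := (crtSearch (β % q) (A % q) q e q).val with ht
  have hts : t.size ≤ Λ := (Nat.size_le_size h4.le).trans hq
  have h5 : mulCost A t ≤ 10 * (ℓ * Λ) * Λ ^ 2 := mulCost_le_mul (by omega) hW
  have h6 := size_mul_le A t
  have h7 : linCost β (A * t) ≤ 10 * (ℓ * Λ) := by unfold linCost; omega
  have h8 : q * (3 * Λ ^ 4) ≤ 2 * (ℓ * Λ) * (3 * Λ ^ 4) := Nat.mul_le_mul_right _ hqℓ
  have e1 : 10 * (ℓ * Λ) * Λ ^ 2 = 10 * (ℓ * Λ ^ 3) := by ring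
  have e2 : 2 * (ℓ * Λ) * (3 * Λ ^ 4) = 6 * (ℓ * Λ ^ 5) := by ring
  have e3 : 1000 * (ℓ * Λ ^ 3) ≤ ℓ * Λ ^ 5 := by
    calc 1000 * (ℓ * Λ ^ 3) ≤ Λ ^ 2 * (ℓ * Λ ^ 3) := Nat.mul_le_mul_right _ (by nlinarith)
      _ = ℓ * Λ ^ 5 := by ring
  have e4 : ℓ * Λ ≤ ℓ * Λ ^ 3 := Nat.mul_le_mul_left _ (Nat.le_self_pow (by norm_num) Λ)
  simp only [crtStep, bitOps_bind, val_natMod, val_natMul, bitOps_natMod,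
    bitOps_natMul, bitOps_natAdd, ← ht]
  omega

theorem bitOps_liftExponent_le {Λ ℓ p d : ℕ} (hΛ : 1000 ≤ Λ) (hℓ : 1 ≤ ℓ)
    (hW : (10 * (ℓ * Λ)).size ≤ Λ) (hp : p.size ≤ Λ) (hd : d < p) (a : R)
    (gs : List (ℕ × (ℕ → R)))
    (hgs : ∀ w ∈ gs, 0 < w.1 ∧ w.1.size ≤ Λ ∧ w.1 ≤ 2 * (ℓ * Λ)) (β A : ℕ) (hβ : β < A)
    (hA : A.size + gs.length * Λ ≤ 2 * (ℓ * Λ)) :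
    (liftExponent p d a gs β A).bitOps ≤ gs.length * (9 * (ℓ * Λ ^ 5)) ∧
      ∀ γ, (liftExponent p d a gs β A).val = some γ → γ.size ≤ 2 * (ℓ * Λ) := by
  induction gs generalizing β A with
  | nil =>
    refine ⟨by simp [liftExponent], ?_⟩
    intro γ hγ
    simp only [liftExponent, val_pure, Option.some.injEq] at hγ
    rw [← hγ]
    refine (Nat.size_le_size hβ.le).trans ?_
    simpa using hA
  | cons w gs ih =>
    obtain ⟨q, g⟩ := w
    obtain ⟨hq0, hqs, hqℓ⟩ := hgs (q, g) (by simp)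
    simp only at hq0 hqs hqℓ
    have hΛℓ : Λ ≤ ℓ * Λ := Nat.le_mul_of_pos_left _ hℓ
    rw [List.length_cons, add_mul, one_mul] at hA ⊢
    have hend : ∀ i, i ≤ q → (d + i * p).size ≤ 3 * Λ := by
      intro i hi
      have h1 : d + i * p ≤ p * (q + 1) := by
        calc d + i * p ≤ p + q * p := Nat.add_le_add hd.le (Nat.mul_le_mul_right p hi)
          _ = p * (q + 1) := by ring
      have h2 := size_mul_le p (q + 1)
      have h3 := size_add_le q 1
      have h4 : Nat.size 1 = 1 := Nat.size_one
      have h5 := Nat.size_le_size h1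
      have : max q.size (Nat.size 1) ≤ Λ := max_le hqs (by omega)
      omega
    have hblock := bitOps_blockTerms_le hΛ g (p := p) (by omega) q d
      ((hend q le_rfl).trans (by omega))
    have h8 : q * (2 * Λ ^ 2) ≤ 2 * (ℓ * Λ) * (2 * Λ ^ 2) := Nat.mul_le_mul_right _ hqℓ
    have e1 : 2 * (ℓ * Λ) * (2 * Λ ^ 2) = 4 * (ℓ * Λ ^ 3) := by ring
    have e3 : 1000 * (ℓ * Λ ^ 3) ≤ ℓ * Λ ^ 5 := by
      calc 1000 * (ℓ * Λ ^ 3) ≤ Λ ^ 2 * (ℓ * Λ ^ 3) := Nat.mul_le_mul_right _ (by nlinarith)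
        _ = ℓ * Λ ^ 5 := by ring
    have e5 : 1000 * Λ ^ 4 ≤ ℓ * Λ ^ 5 := by
      calc 1000 * Λ ^ 4 ≤ (ℓ * Λ) * Λ ^ 4 := Nat.mul_le_mul_right _ (by omega)
        _ = ℓ * Λ ^ 5 := by ring
    simp only [liftExponent, bitOps_bind, val_bind]
    have hmemb : ∀ w ∈ (blockTerms g p q d).val, w.1.size ≤ 3 * Λ := by
      intro w hw
      obtain ⟨i, hi, h1, _⟩ := mem_blockTerms.1 hw
      rw [h1]
      exact hend i hi.le
    generalize hl : (blockTerms g p q d).val = l at hmemb ⊢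
    match l, hmemb with
    | [], _ =>
      simp only [bitOps_pure, val_pure, reduceCtorEq, false_implies, implies_true, and_true]
      omega
    | [(b, v)], hmemb =>
      have hb := hmemb (b, v) (by simp)
      simp only at hb
      simp only [bitOps_bind, val_bind, val_ringEq, bitOps_ringEq, decide_eq_true_eq]
      split_ifs with hv
      · simp only [bitOps_bind, val_bind, val_natMod, bitOps_natMod, val_natMul, bitOps_natMul]
        have c1 := mulCost_le_pow hΛ (show b.size ≤ 4 * Λ by omega) (show q.size ≤ 4 * Λ by omega)
        have c2 := bitOps_crtStep_le hΛ hℓ hW hβ (show A.size ≤ 2 * (ℓ * Λ) by omega) hq0 hqs hqℓ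
          ((size_mod_le_right b hq0).trans hqs)
        have c3 : mulCost A q ≤ 10 * (ℓ * Λ) * Λ ^ 2 := mulCost_le_mul (by omega) hW
        have e4 : 10 * (ℓ * Λ) * Λ ^ 2 = 10 * (ℓ * Λ ^ 3) := by ring
        have hAq := size_mul_le A q
        obtain ⟨i1, i2⟩ := ih (fun w hw => hgs w (by simp [hw])) _ _ (crtStep_lt (b % q) hβ hq0)
          (show (A * q).size + gs.length * Λ ≤ 2 * (ℓ * Λ) by omega)
        refine ⟨?_, i2⟩
        omega
      · simp only [bitOps_pure, val_pure, reduceCtorEq, false_implies, implies_true, and_true]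
        omega
    | _ :: _ :: _, _ =>
      simp only [bitOps_pure, val_pure, reduceCtorEq, false_implies, implies_true, and_true]
      omega

theorem ringOps_liftExponent_le {Q p d : ℕ} (a : R) (gs : List (ℕ × (ℕ → R)))
    (hgs : ∀ w ∈ gs, w.1 ≤ Q) (β A : ℕ) :
    (liftExponent p d a gs β A).ringOps ≤ gs.length * (Q + 1) := by
  induction gs generalizing β A with
  | nil => simp [liftExponent]
  | cons w gs ih =>
    obtain ⟨q, g⟩ := w
    have hq := hgs (q, g) (by simp)
    simp only at hq
    rw [List.length_cons, add_mul, one_mul]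
    simp only [liftExponent, ringOps_bind, ringOps_blockTerms]
    generalize (blockTerms g p q d).val = l
    match l with
    | [] => simp only [ringOps_pure]; omega
    | [(b, v)] =>
      simp only [ringOps_bind, val_ringEq, ringOps_ringEq, decide_eq_true_eq]
      split_ifs with hv
      · simp only [ringOps_bind, val_natMod, ringOps_natMod, val_natMul, ringOps_natMul,
          ringOps_crtStep]
        have := ih (fun w hw => hgs w (by simp [hw])) (crtStep β A q (b % q)).val (A * q)
        omega
      · simp only [ringOps_pure]; omega
    | _ :: _ :: _ => simp only [ringOps_pure]; omega

omit [Ring R] in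
theorem bitOps_insertTerm_le {ℓ : ℕ} (hℓ : 1 ≤ ℓ) (w : ℕ × R) (hw : w.1.size ≤ ℓ)
    (l : List (ℕ × R)) (hl : ∀ y ∈ l, y.1.size ≤ ℓ) :
    (insertTerm w l).bitOps ≤ l.length * (3 * ℓ) := by
  induction l with
  | nil => simp [insertTerm]
  | cons y ys ih =>
    have h1 := ih fun z hz => hl z (by simp [hz])
    have h2 := linCost_le hw (hl y (by simp))
    rw [List.length_cons, add_mul, one_mul]
    simp only [insertTerm, bitOps_bind, val_natEq, val_ringEq, bitOps_natEq, bitOps_ringEq,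
      Bool.and_eq_true, decide_eq_true_eq]
    split_ifs
    · simp only [bitOps_pure]; omega
    · simp only [bitOps_bind, bitOps_pure]; omega

omit [Ring R] in
theorem ringOps_insertTerm_le (w : ℕ × R) (l : List (ℕ × R)) :
    (insertTerm w l).ringOps ≤ l.length := by
  induction l with
  | nil => simp [insertTerm]
  | cons y ys ih =>
    rw [List.length_cons]
    simp only [insertTerm, ringOps_bind, val_natEq, val_ringEq, ringOps_natEq, ringOps_ringEq,
      Bool.and_eq_true, decide_eq_true_eq]
    split_ifs
    · simp only [ringOps_pure]; omega
    · simp only [ringOps_bind, ringOps_pure]; omega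

/-- The cost of the candidate terms: only the nonzero coefficients of `f` are expensive. -/
theorem bitOps_uTerms_le {Λ ℓ D T : ℕ} (hΛ : 1000 ≤ Λ) (hℓ : 1 ≤ ℓ)
    (hW : (10 * (ℓ * Λ)).size ≤ Λ) (hD : D.size ≤ ℓ) {f : Image R} (hp : f.p.size ≤ Λ)
    (gs : List (ℕ × (ℕ → R)))
    (hgs : ∀ w ∈ gs, 0 < w.1 ∧ w.1.size ≤ Λ ∧ w.1 ≤ 2 * (ℓ * Λ)) (hlen : gs.length ≤ ℓ)
    (n : ℕ) (hn : n ≤ f.p) (hT : ((Finset.range n).filter fun i => f.coeff i ≠ 0).card ≤ T) :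
    (uTerms D f gs n).bitOps ≤ n * Λ ^ 2 +
      ((Finset.range n).filter fun i => f.coeff i ≠ 0).card *
        (10 * (ℓ ^ 2 * Λ ^ 5) + 3 * (T * ℓ)) := by
  induction n with
  | zero => simp [uTerms]
  | succ n ih =>
    rw [Finset.range_add_one, Finset.filter_insert] at hT ⊢
    have hr : n.size + 1 ≤ Λ ^ 2 := by
      have := Nat.size_le_size (show n ≤ f.p by omega)
      nlinarith
    rw [add_mul, one_mul]
    simp only [uTerms, bitOps_bind, val_read, bitOps_read, val_isZero, bitOps_isZero,
      decide_eq_true_eq]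
    by_cases hz : f.coeff n = 0
    · rw [if_neg (not_not_intro hz)] at hT ⊢
      have := ih (by omega) hT
      rw [if_pos hz, bitOps_pure]
      omega
    · rw [if_pos (show f.coeff n ≠ 0 from hz), Finset.card_insert_of_notMem (by simp)] at hT ⊢
      have h1 := ih (by omega) (by omega)
      have hΛℓ : Λ ≤ ℓ * Λ := Nat.le_mul_of_pos_left _ hℓ
      obtain ⟨h2, h3⟩ := bitOps_liftExponent_le hΛ hℓ hW hp (show n < f.p by omega) (f.coeff n) gs
        hgs 0 1 one_pos (by
          have : gs.length * Λ ≤ ℓ * Λ := Nat.mul_le_mul_right _ hlen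
          have h4 : Nat.size 1 = 1 := Nat.size_one
          omega)
      have h4 : gs.length * (9 * (ℓ * Λ ^ 5)) ≤ 9 * (ℓ ^ 2 * Λ ^ 5) := by
        calc gs.length * (9 * (ℓ * Λ ^ 5)) ≤ ℓ * (9 * (ℓ * Λ ^ 5)) := Nat.mul_le_mul_right _ hlen
          _ = 9 * (ℓ ^ 2 * Λ ^ 5) := by ring
      have h5 : 1000 * (ℓ * Λ) ≤ ℓ ^ 2 * Λ ^ 5 := by
        calc 1000 * (ℓ * Λ) ≤ (ℓ * Λ ^ 4) * (ℓ * Λ) := by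
              refine Nat.mul_le_mul_right _ ?_
              calc 1000 ≤ 1 * Λ := by omega
                _ ≤ ℓ * Λ ^ 4 := Nat.mul_le_mul hℓ (Nat.le_self_pow (by norm_num) Λ)
          _ = ℓ ^ 2 * Λ ^ 5 := by ring
      have hℓΛ : ℓ ≤ ℓ * Λ := Nat.le_mul_of_pos_right _ (by omega)
      rw [if_neg hz, bitOps_bind]
      rw [add_mul _ 1, one_mul]
      cases ho : (liftExponent f.p n (f.coeff n) gs 0 1).val with
      | none => simp only [bitOps_pure]; omega
      | some β =>
        have hβ := h3 β ho
        have c1 : linCost β D ≤ 2 * (ℓ * Λ) + ℓ + 1 := linCost_le hβ hD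
        simp only [bitOps_bind, val_natLt, bitOps_natLt, decide_eq_true_eq]
        split_ifs with hβD
        · have hlenU := (length_uTerms_le D f gs n).trans (show _ ≤ T by omega)
          have c2 := bitOps_insertTerm_le hℓ (β, f.coeff n)
            ((Nat.size_le_size hβD.le).trans hD) (uTerms D f gs n).val (fun y hy => by
              obtain ⟨_, _, _, _, h6, _⟩ := mem_uTerms.1 hy
              exact (Nat.size_le_size h6.le).trans hD)
          have c3 : (uTerms D f gs n).val.length * (3 * ℓ) ≤ 3 * (T * ℓ) := by
            calc _ ≤ T * (3 * ℓ) := Nat.mul_le_mul_right _ hlenU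
              _ = 3 * (T * ℓ) := by ring
          omega
        · simp only [bitOps_pure]; omega

theorem ringOps_uTerms_le {K Q D T : ℕ} {f : Image R} (gs : List (ℕ × (ℕ → R)))
    (hgs : ∀ w ∈ gs, w.1 ≤ Q) (hlen : gs.length ≤ K) (n : ℕ)
    (hT : ((Finset.range n).filter fun i => f.coeff i ≠ 0).card ≤ T) :
    (uTerms D f gs n).ringOps ≤ n +
      ((Finset.range n).filter fun i => f.coeff i ≠ 0).card * (K * (Q + 1) + T) := by
  induction n with
  | zero => simp [uTerms]
  | succ n ih =>
    rw [Finset.range_add_one, Finset.filter_insert] at hT ⊢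
    simp only [uTerms, ringOps_bind, val_read, ringOps_read, val_isZero, ringOps_isZero,
      decide_eq_true_eq]
    by_cases hz : f.coeff n = 0
    · rw [if_neg (not_not_intro hz)] at hT ⊢
      have := ih hT
      rw [if_pos hz, ringOps_pure]
      omega
    · rw [if_pos (show f.coeff n ≠ 0 from hz), Finset.card_insert_of_notMem (by simp)] at hT ⊢
      have h1 := ih (by omega)
      have h2 := ringOps_liftExponent_le (p := f.p) (d := n) (f.coeff n) gs hgs 0 1
      have h3 : gs.length * (Q + 1) ≤ K * (Q + 1) := Nat.mul_le_mul_right _ hlen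
      rw [if_neg hz, ringOps_bind]
      rw [add_mul _ 1, one_mul]
      cases ho : (liftExponent f.p n (f.coeff n) gs 0 1).val with
      | none => simp only [ringOps_pure]; omega
      | some β =>
        simp only [ringOps_bind, val_natLt, ringOps_natLt, decide_eq_true_eq]
        split_ifs with hβD
        · have hlenU := (length_uTerms_le D f gs n).trans (show _ ≤ T by omega)
          have c2 := ringOps_insertTerm_le (β, f.coeff n) (uTerms D f gs n).val
          omega
        · simp only [ringOps_pure]; omega

end Lift

section Probes

variable {R : Type u} [Ring R] [DecidableEq R]

omit [DecidableEq R] in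
theorem bitOps_subSparse_le {Λ ℓ m : ℕ} (hΛ : 1000 ≤ Λ) (hℓ : 1 ≤ ℓ)
    (hW : (10 * (ℓ * Λ)).size ≤ Λ) (hm : m.size ≤ 2 * Λ) (h : List (ℕ × R))
    (hh : ∀ w ∈ h, w.1.size ≤ ℓ) (a : ℕ → R) (hm0 : 0 < m) :
    (subSparse m h a).bitOps ≤ h.length * (11 * (ℓ * Λ ^ 3)) := by
  induction h generalizing a with
  | nil => simp [subSparse]
  | cons w h ih =>
    obtain ⟨e, c⟩ := w
    have he := hh (e, c) (by simp)
    simp only at he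
    have hΛℓ : Λ ≤ ℓ * Λ := Nat.le_mul_of_pos_left _ hℓ
    have hℓΛ : ℓ ≤ ℓ * Λ := Nat.le_mul_of_pos_right _ (by omega)
    have c1 : mulCost e m ≤ 10 * (ℓ * Λ) * Λ ^ 2 := mulCost_le_mul (by omega) hW
    have c2 := (size_mod_le_right e hm0).trans hm
    have e1 : 10 * (ℓ * Λ) * Λ ^ 2 = 10 * (ℓ * Λ ^ 3) := by ring
    have e2 : 1000 * (ℓ * Λ) ≤ ℓ * Λ ^ 3 := by
      calc 1000 * (ℓ * Λ) ≤ Λ ^ 2 * (ℓ * Λ) := Nat.mul_le_mul_right _ (by nlinarith)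
        _ = ℓ * Λ ^ 3 := by ring
    rw [List.length_cons, add_mul, one_mul]
    simp only [subSparse, bitOps_bind, val_natMod, val_read, val_ringSub, val_write,
      bitOps_natMod, bitOps_read, bitOps_ringSub, bitOps_write]
    have := ih (fun w hw => hh w (by simp [hw])) (Function.update a (e % m) (a (e % m) - c))
    omega

omit [DecidableEq R] in
theorem ringOps_subSparse (m : ℕ) (h : List (ℕ × R)) (a : ℕ → R) :
    (subSparse m h a).ringOps = h.length := by
  induction h generalizing a with
  | nil => rfl
  | cons w h ih =>
    obtain ⟨e, c⟩ := w
    simp only [subSparse, ringOps_bind, val_natMod, val_read, val_ringSub, val_write,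
      ringOps_natMod, ringOps_read, ringOps_ringSub, ringOps_write, ih, List.length_cons]
    omega

omit [DecidableEq R] in
theorem bitOps_evalMod (M : ∀ p : ℕ, CyclicMul.{u} p) (p : ℕ) {n : ℕ} (P : SLP R Unit n) :
    (evalMod M p P).bitOps = 0 := by
  induction P with
  | nil => rfl
  | snoc P l ih =>
    simp only [evalMod, bitOps_bind, ih, bitOps_pure]
    cases l <;> rfl

omit [DecidableEq R] in
theorem ringOps_evalMod_le {M : ∀ p : ℕ, CyclicMul.{u} p} {p μ : ℕ} (hp : p ≤ μ)
    (hM : (M p).size ≤ μ) {n : ℕ} (P : SLP R Unit n) : (evalMod M p P).ringOps ≤ n * μ := by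
  induction P with
  | nil => simp [evalMod]
  | snoc P l ih =>
    have : ∀ v, (lineMod M p v l).ringOps ≤ μ := by
      intro v
      cases l <;> simp [lineMod, hp, hM]
    have := this (evalMod M p P).val
    simp only [evalMod, ringOps_bind, ringOps_pure]
    rw [add_mul, one_mul]
    omega

omit [DecidableEq R] in
@[simp] theorem bitOps_probe (M : ∀ p : ℕ, CyclicMul.{u} p) (p : ℕ) {L : ℕ} (P : SLP R Unit L) :
    (probe M P p).bitOps = 0 := by
  simp only [probe, bitOps_bind, bitOps_pure, bitOps_evalMod]

omit [DecidableEq R] in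
theorem ringOps_probe_le {M : ∀ p : ℕ, CyclicMul.{u} p} {p μ : ℕ} (hp : p ≤ μ)
    (hM : (M p).size ≤ μ) {L : ℕ} (P : SLP R Unit L) : (probe M P p).ringOps ≤ L * μ := by
  simp only [probe, ringOps_bind, ringOps_pure, add_zero]
  exact ringOps_evalMod_le hp hM P

omit [DecidableEq R] in
theorem bitOps_cofactorImages_le {Λ ℓ : ℕ} (hΛ : 1000 ≤ Λ) (hℓ : 1 ≤ ℓ)
    (hW : (10 * (ℓ * Λ)).size ≤ Λ) (M : ∀ p : ℕ, CyclicMul.{u} p) {L : ℕ} (P : SLP R Unit L)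
    (h : List (ℕ × R)) (hh : ∀ w ∈ h, w.1.size ≤ ℓ) {p : ℕ} (hp0 : 0 < p) (hp : p.size ≤ Λ)
    (qs : List ℕ) (hqs : ∀ q ∈ qs, 0 < q ∧ q.size ≤ Λ) :
    (cofactorImages M P h p qs).bitOps ≤ qs.length * (Λ ^ 4 + h.length * (11 * (ℓ * Λ ^ 3))) := by
  induction qs with
  | nil => simp [cofactorImages]
  | cons q qs ih =>
    obtain ⟨hq0, hq⟩ := hqs q (by simp)
    have h1 := mulCost_le_pow hΛ (show p.size ≤ 4 * Λ by omega) (show q.size ≤ 4 * Λ by omega)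
    have h2 := size_mul_le p q
    have h3 := bitOps_subSparse_le hΛ hℓ hW (show (p * q).size ≤ 2 * Λ by omega) h hh
      (probe M P (p * q)).val (Nat.mul_pos hp0 hq0)
    have h4 := ih fun r hr => hqs r (by simp [hr])
    rw [List.length_cons, add_mul, one_mul]
    simp only [cofactorImages, bitOps_bind, val_natMul, bitOps_natMul, bitOps_probe, bitOps_pure]
    omega

omit [DecidableEq R] in
theorem ringOps_cofactorImages_le {M : ∀ p : ℕ, CyclicMul.{u} p} {L : ℕ} (P : SLP R Unit L)
    (h : List (ℕ × R)) {p μ : ℕ} (qs : List ℕ)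
    (hqs : ∀ q ∈ qs, p * q ≤ μ ∧ (M (p * q)).size ≤ μ) :
    (cofactorImages M P h p qs).ringOps ≤ qs.length * (L * μ + h.length) := by
  induction qs with
  | nil => simp [cofactorImages]
  | cons q qs ih =>
    obtain ⟨hq, hqM⟩ := hqs q (by simp)
    have h1 := ringOps_probe_le hq hqM P
    have h4 := ih fun r hr => hqs r (by simp [hr])
    rw [List.length_cons, add_mul, one_mul]
    simp only [cofactorImages, ringOps_bind, val_natMul, ringOps_natMul, ringOps_pure,
      ringOps_subSparse]
    omega

theorem bitOps_countTerms_le {Λ : ℕ} (hΛ : 1000 ≤ Λ) (a : ℕ → R) (n : ℕ) (hn : n.size ≤ Λ) :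
    (countTerms a n).bitOps ≤ ((Finset.range n).filter fun i => a i ≠ 0).card * Λ ^ 2 := by
  induction n with
  | zero => simp [countTerms]
  | succ n ih =>
    have hn' : n.size ≤ Λ := (Nat.size_le_size (Nat.le_succ n)).trans hn
    have h1 := ih hn'
    rw [Finset.range_add_one, Finset.filter_insert]
    simp only [countTerms, bitOps_bind, val_isZero, bitOps_isZero, decide_eq_true_eq,
      val_countTerms]
    by_cases h : a n = 0
    · simpa [h] using h1
    · have h2 : ((Finset.range n).filter fun i => a i ≠ 0).card ≤ n := by
        simpa using Finset.card_filter_le (Finset.range n) fun i => a i ≠ 0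
      have h3 := linCost_le_sq hΛ (a := ((Finset.range n).filter fun i => a i ≠ 0).card) (b := 1)
        ((Nat.size_le_size h2).trans (by omega)) (by rw [Nat.size_one]; omega)
      rw [if_neg h, if_pos (show a n ≠ 0 from h), Finset.card_insert_of_notMem (by simp), add_mul,
        one_mul, bitOps_natAdd]
      omega

theorem ringOps_countTerms (a : ℕ → R) (n : ℕ) : (countTerms a n).ringOps = n := by
  induction n with
  | zero => rfl
  | succ n ih =>
    simp only [countTerms, ringOps_bind, val_isZero, ringOps_isZero, ih,
      decide_eq_true_eq]
    split_ifs <;> simp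

theorem terms_le_card_support (g : R[X]) (p : ℕ) : (imageOf g p).terms ≤ g.support.card :=
  (terms_le_card_image p g).trans Finset.card_image_le

theorem bitOps_images_le {Λ T : ℕ} (hΛ : 1000 ≤ Λ) (M : ∀ p : ℕ, CyclicMul.{u} p) {L : ℕ}
    (P : SLP R Unit L) (hT : P.toPoly.support.card ≤ T) (ps : List ℕ)
    (hps : ∀ p ∈ ps, 0 < p ∧ p.size ≤ Λ) :
    (images M P ps).bitOps ≤ ps.length * (T * Λ ^ 2) := by
  induction ps with
  | nil => simp [images]
  | cons p ps ih =>
    obtain ⟨hp0, hp⟩ := hps p (by simp)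
    have h1 := ih fun q hq => hps q (by simp [hq])
    have h2 := bitOps_countTerms_le hΛ (probe M P p).val p hp
    rw [val_probe M P hp0] at h2
    have h3 : ((Finset.range p).filter fun i => wrap p P.toPoly i ≠ 0).card * Λ ^ 2 ≤ T * Λ ^ 2 :=
      Nat.mul_le_mul_right _ ((terms_le_card_support P.toPoly p).trans hT)
    rw [List.length_cons, add_mul, one_mul]
    simp only [images, bitOps_bind, bitOps_probe, bitOps_pure, val_probe M P hp0]
    omega

theorem ringOps_images_le {M : ∀ p : ℕ, CyclicMul.{u} p} {L μ : ℕ} (P : SLP R Unit L)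
    (ps : List ℕ) (hps : ∀ p ∈ ps, p ≤ μ ∧ (M p).size ≤ μ) :
    (images M P ps).ringOps ≤ ps.length * (L * μ + μ) := by
  induction ps with
  | nil => simp [images]
  | cons p ps ih =>
    obtain ⟨hp, hM⟩ := hps p (by simp)
    have h1 := ih fun q hq => hps q (by simp [hq])
    have h2 := ringOps_probe_le hp hM P
    rw [List.length_cons, add_mul, one_mul]
    simp only [images, ringOps_bind, ringOps_pure, ringOps_countTerms]
    omega

omit [Ring R] [DecidableEq R] in
theorem bitOps_best_le {Λ : ℕ} (hΛ : 1000 ≤ Λ) (b : Image R) (l : List (Image R))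
    (h : ∀ f ∈ b :: l, f.terms.size ≤ Λ) : (best b l).bitOps ≤ l.length * Λ ^ 2 := by
  induction l generalizing b with
  | nil => simp [best]
  | cons f fs ih =>
    have h1 := h b (by simp)
    have h2 := h f (by simp)
    have h3 := linCost_le_sq hΛ (show b.terms.size ≤ 4 * Λ by omega)
      (show f.terms.size ≤ 4 * Λ by omega)
    have h4 := ih (if b.terms < f.terms then f else b) (by
      intro y hy
      rcases List.mem_cons.1 hy with rfl | hy
      · split_ifs <;> assumption
      · exact h y (by simp [hy]))
    rw [List.length_cons, add_mul, one_mul]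
    simp only [best, bitOps_bind, val_natLt, bitOps_natLt, decide_eq_true_eq]
    omega

omit [Ring R] [DecidableEq R] in
@[simp] theorem ringOps_best (b : Image R) (l : List (Image R)) : (best b l).ringOps = 0 := by
  induction l generalizing b with
  | nil => rfl
  | cons f fs ih => simp only [best, ringOps_bind, ringOps_natLt, ih]

end Probes

/-! ### Costs of product trees, of the term test and of the updates -/

theorem size_prod_le {Λ : ℕ} (l : List ℕ) (hl : ∀ p ∈ l, p.size ≤ Λ) :
    l.prod.size ≤ l.length * Λ + 1 := by
  induction l with
  | nil => simp
  | cons p l ih =>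
    have h1 := ih fun q hq => hl q (by simp [hq])
    have h2 := hl p (by simp)
    have h3 := size_mul_le p l.prod
    rw [List.prod_cons, List.length_cons, add_mul, one_mul]
    omega

theorem prodTree_succ (fuel a b : ℕ) (l : List ℕ) :
    prodTree (fuel + 1) (a :: b :: l) = splitHalf (a :: b :: l) ⊳ fun s =>
      prodTree fuel s.1 ⊳ fun x => prodTree fuel s.2 ⊳ fun y =>
      natMul x.prod y.prod ⊳ fun m => Counted.pure (.node m x y) := rfl

@[simp] theorem ringOps_prodTree (fuel : ℕ) (l : List ℕ) : (prodTree fuel l).ringOps = 0 := by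
  induction fuel generalizing l with
  | zero =>
    match l with
    | [] => rfl
    | [_] => rfl
    | _ :: _ :: _ => rfl
  | succ fuel ih =>
    match l with
    | [] => rfl
    | [_] => rfl
    | a :: b :: l => simp only [prodTree_succ, ringOps_bind, ringOps_splitHalf, ih,
        ringOps_natMul, ringOps_pure]

@[simp] theorem ringOps_residues (e : ℕ) (t : ProdTree) (acc : List ℕ) :
    (residues e t acc).ringOps = 0 := by
  induction t generalizing e acc with
  | nil => rfl
  | leaf p => rfl
  | node m l r ihl ihr =>
    simp only [residues, ringOps_bind, ringOps_natMod, ihl, ihr]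

theorem size_prod_prodTree_le {Λ fuel : ℕ} {l : List ℕ} (h : l.length ≤ fuel)
    (hl : ∀ p ∈ l, p.size ≤ Λ) : (prodTree fuel l).val.prod.size ≤ l.length * Λ + 1 := by
  obtain ⟨h1, h2⟩ := val_prodTree h
  rw [h2.prod_eq, h1]
  exact size_prod_le l hl

/-- The cost of a product tree of height at most `k`: a level costs `O(Λ ^ 3)` per leaf. -/
theorem bitOps_prodTree_le {Λ V k fuel : ℕ} (hΛ : 1000 ≤ Λ) (hV : (2 * V + 1).size ≤ Λ)
    {l : List ℕ} (h : l.length ≤ fuel) (hl : ∀ p ∈ l, p.size ≤ Λ) (hlV : l.length * Λ + 1 ≤ V)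
    (hk : l.length ≤ 2 ^ k) : (prodTree fuel l).bitOps ≤ l.length * (k * (3 * Λ ^ 3)) := by
  induction k generalizing fuel l with
  | zero =>
    match fuel, l with
    | 0, [] => simp [prodTree]
    | _ + 1, [] => simp [prodTree]
    | 0, [_] => simp [prodTree]
    | _ + 1, [_] => simp [prodTree]
    | _, _ :: _ :: _ => simp at hk
  | succ k ih =>
    match fuel, l with
    | 0, [] => simp [prodTree]
    | _ + 1, [] => simp [prodTree]
    | 0, [_] => simp [prodTree]
    | _ + 1, [_] => simp [prodTree]
    | 0, _ :: _ :: _ => simp at h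
    | fuel + 1, a :: b :: l =>
      rw [prodTree_succ]
      have hn : 2 ≤ (a :: b :: l).length := by simp
      generalize (a :: b :: l) = l at *
      have e1 : (l.take (l.length / 2)).length = l.length / 2 := by
        rw [List.length_take]; omega
      have e2 : (l.drop (l.length / 2)).length = l.length - l.length / 2 := by
        rw [List.length_drop]
      have es : l.length = l.length / 2 + (l.length - l.length / 2) := by omega
      rw [pow_succ] at hk
      have m1 : l.length / 2 * Λ ≤ l.length * Λ := Nat.mul_le_mul_right _ (by omega)
      have m2 : (l.length - l.length / 2) * Λ ≤ l.length * Λ := Nat.mul_le_mul_right _ (by omega)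
      have m3 : l.length * Λ = l.length / 2 * Λ + (l.length - l.length / 2) * Λ := by
        rw [← add_mul, ← es]
      have i1 := ih (fuel := fuel) (l := l.take (l.length / 2)) (by omega)
        (fun p hp => hl p (List.mem_of_mem_take hp)) (by rw [e1]; omega) (by rw [e1]; omega)
      have i2 := ih (fuel := fuel) (l := l.drop (l.length / 2)) (by omega)
        (fun p hp => hl p (List.mem_of_mem_drop hp)) (by rw [e2]; omega) (by rw [e2]; omega)
      have s1 := size_prod_prodTree_le (fuel := fuel) (l := l.take (l.length / 2)) (by omega)
        (fun p hp => hl p (List.mem_of_mem_take hp))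
      have s2 := size_prod_prodTree_le (fuel := fuel) (l := l.drop (l.length / 2)) (by omega)
        (fun p hp => hl p (List.mem_of_mem_drop hp))
      simp only [bitOps_bind, bitOps_splitHalf, val_splitHalf, bitOps_natMul, bitOps_pure]
      rw [e1] at i1 s1
      rw [e2] at i2 s2
      have c1 := mulCost_le_mul (Λ := Λ) (W := l.length * Λ + 3)
        (a := (prodTree fuel (l.take (l.length / 2))).val.prod)
        (b := (prodTree fuel (l.drop (l.length / 2))).val.prod) (by omega)
        ((Nat.size_le_size (by omega)).trans hV)
      have c2 : (l.length * Λ + 3) * Λ ^ 2 ≤ 2 * (l.length * Λ ^ 3) := by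
        have : l.length * Λ + 3 ≤ 2 * (l.length * Λ) := by nlinarith
        calc (l.length * Λ + 3) * Λ ^ 2 ≤ 2 * (l.length * Λ) * Λ ^ 2 :=
              Nat.mul_le_mul_right _ this
          _ = 2 * (l.length * Λ ^ 3) := by ring
      have c3 : l.length + 1 ≤ l.length * Λ ^ 3 := by
        calc l.length + 1 ≤ l.length * 2 := by omega
          _ ≤ l.length * Λ ^ 3 := Nat.mul_le_mul_left _
            ((by omega : 2 ≤ Λ).trans (Nat.le_self_pow (by norm_num) Λ))
      have c4 : l.length * (k * (3 * Λ ^ 3)) = l.length / 2 * (k * (3 * Λ ^ 3)) +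
          (l.length - l.length / 2) * (k * (3 * Λ ^ 3)) := by
        rw [← add_mul, ← es]
      have c5 : l.length * ((k + 1) * (3 * Λ ^ 3)) =
          l.length * (k * (3 * Λ ^ 3)) + 3 * (l.length * Λ ^ 3) := by ring
      omega

/-- The cost of the reduction of `e` modulo the leaves of a product tree of height at most `k`:
the reductions at the root cost as much as the length of `e`, every level below costs `O(Λ ^ 3)`
per leaf. -/
theorem bitOps_residues_le {Λ V k fuel u e : ℕ} (hΛ : 1000 ≤ Λ) (hV : (2 * V + 1).size ≤ Λ)
    {l : List ℕ} (h : l.length ≤ fuel) (hl0 : ∀ p ∈ l, 0 < p) (hl : ∀ p ∈ l, p.size ≤ Λ)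
    (hlV : l.length * Λ + 1 ≤ V) (hk : l.length ≤ 2 ^ k) (he : e.size ≤ u) (hu : u ≤ V)
    (acc : List ℕ) : (residues e (prodTree fuel l).val acc).bitOps ≤
      (2 * u + l.length * ((k + 1) * (5 * Λ))) * Λ ^ 2 := by
  induction k generalizing fuel l u e acc with
  | zero =>
    match fuel, l with
    | 0, [] => simp [prodTree, residues]
    | _ + 1, [] => simp [prodTree, residues]
    | 0, [_] => simp at h
    | _ + 1, [p] =>
      have h1 := hl p (by simp)
      have := mulCost_le_mul (Λ := Λ) (W := u + Λ + 1) (a := e) (b := p) (by omega)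
        ((Nat.size_le_size (by simp at hlV; omega)).trans hV)
      simp only [prodTree, val_pure, residues, bitOps_bind, bitOps_natMod, bitOps_pure, add_zero,
        List.length_singleton]
      exact this.trans (Nat.mul_le_mul_right _ (by omega))
    | _, _ :: _ :: _ => simp at hk
  | succ k ih =>
    match fuel, l with
    | 0, [] => simp [prodTree, residues]
    | _ + 1, [] => simp [prodTree, residues]
    | 0, [_] => simp at h
    | _ + 1, [p] =>
      have h1 := hl p (by simp)
      have := mulCost_le_mul (Λ := Λ) (W := u + Λ + 1) (a := e) (b := p) (by omega)
        ((Nat.size_le_size (by simp at hlV; omega)).trans hV)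
      simp only [prodTree, val_pure, residues, bitOps_bind, bitOps_natMod, bitOps_pure, add_zero,
        List.length_singleton]
      exact this.trans (Nat.mul_le_mul_right _ (by nlinarith))
    | 0, _ :: _ :: _ => simp at h
    | fuel + 1, a :: b :: l =>
      rw [prodTree_succ]
      have hn : 2 ≤ (a :: b :: l).length := by simp
      generalize (a :: b :: l) = l at *
      have e1 : (l.take (l.length / 2)).length = l.length / 2 := by
        rw [List.length_take]; omega
      have e2 : (l.drop (l.length / 2)).length = l.length - l.length / 2 := by
        rw [List.length_drop]
      have es : l.length = l.length / 2 + (l.length - l.length / 2) := by omega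
      rw [pow_succ] at hk
      have m1 : l.length / 2 * Λ ≤ l.length * Λ := Nat.mul_le_mul_right _ (by omega)
      have m2 : (l.length - l.length / 2) * Λ ≤ l.length * Λ := Nat.mul_le_mul_right _ (by omega)
      have m3 : l.length * Λ = l.length / 2 * Λ + (l.length - l.length / 2) * Λ := by
        rw [← add_mul, ← es]
      have l1 : (l.take (l.length / 2)).length ≤ fuel := by omega
      have l2 : (l.drop (l.length / 2)).length ≤ fuel := by omega
      have pos1 : ∀ p ∈ l.take (l.length / 2), 0 < p := fun p hp => hl0 p (List.mem_of_mem_take hp)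
      have pos2 : ∀ p ∈ l.drop (l.length / 2), 0 < p := fun p hp => hl0 p (List.mem_of_mem_drop hp)
      have hl1 : ∀ p ∈ l.take (l.length / 2), p.size ≤ Λ :=
        fun p hp => hl p (List.mem_of_mem_take hp)
      have hl2 : ∀ p ∈ l.drop (l.length / 2), p.size ≤ Λ :=
        fun p hp => hl p (List.mem_of_mem_drop hp)
      have s1 := size_prod_prodTree_le l1 hl1
      have s2 := size_prod_prodTree_le l2 hl2
      have p1 : 0 < (prodTree fuel (l.take (l.length / 2))).val.prod := by
        obtain ⟨q1, q2⟩ := val_prodTree l1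
        rw [q2.prod_eq, q1]
        exact List.prod_pos pos1
      have p2 : 0 < (prodTree fuel (l.drop (l.length / 2))).val.prod := by
        obtain ⟨q1, q2⟩ := val_prodTree l2
        rw [q2.prod_eq, q1]
        exact List.prod_pos pos2
      simp only [val_bind, val_splitHalf, val_natMul, val_pure, residues, bitOps_bind, val_natMod,
        bitOps_natMod]
      generalize hx : (prodTree fuel (l.take (l.length / 2))).val = x at *
      generalize hy : (prodTree fuel (l.drop (l.length / 2))).val = y at *
      have i1 := fun acc => ih (fuel := fuel) (l := l.take (l.length / 2)) l1 pos1 hl1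
        (by rw [e1]; omega) (by rw [e1]; omega) ((size_mod_le_right e p1).trans s1)
        (by rw [e1]; omega) acc
      have i2 := fun acc => ih (fuel := fuel) (l := l.drop (l.length / 2)) l2 pos2 hl2
        (by rw [e2]; omega) (by rw [e2]; omega) ((size_mod_le_right e p2).trans s2)
        (by rw [e2]; omega) acc
      rw [hx] at i1
      rw [hy] at i2
      have i2' := i2 acc
      have i1' := i1 (residues (e % y.prod) y acc).val
      rw [e1] at s1 i1'
      rw [e2] at s2 i2'
      have c1 := mulCost_le_mul (Λ := Λ) (W := u + l.length / 2 * Λ + 2) (a := e) (b := x.prod)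
        (by omega) ((Nat.size_le_size (by omega)).trans hV)
      have c2 := mulCost_le_mul (Λ := Λ) (W := u + (l.length - l.length / 2) * Λ + 2) (a := e)
        (b := y.prod) (by omega) ((Nat.size_le_size (by omega)).trans hV)
      have key : (u + (l.length - l.length / 2) * Λ + 2) + ((u + l.length / 2 * Λ + 2) +
          ((2 * ((l.length - l.length / 2) * Λ + 1) +
            (l.length - l.length / 2) * ((k + 1) * (5 * Λ))) +
          (2 * (l.length / 2 * Λ + 1) + l.length / 2 * ((k + 1) * (5 * Λ))))) ≤
          2 * u + l.length * ((k + 1 + 1) * (5 * Λ)) := by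
        have c4 : l.length * ((k + 1) * (5 * Λ)) = l.length / 2 * ((k + 1) * (5 * Λ)) +
            (l.length - l.length / 2) * ((k + 1) * (5 * Λ)) := by
          rw [← add_mul, ← es]
        have c5 : l.length * ((k + 1 + 1) * (5 * Λ)) =
          l.length * ((k + 1) * (5 * Λ)) + 5 * (l.length * Λ) := by ring
        have c6 : 1000 ≤ l.length * Λ := hΛ.trans (Nat.le_mul_of_pos_left _ (by omega))
        omega
      refine le_trans ?_ (Nat.mul_le_mul_right (Λ ^ 2) key)
      simp only [add_mul _ _ (Λ ^ 2)] at c1 c2 i1' i2' ⊢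
      omega

section Testing

variable {R : Type u} [Ring R] [DecidableEq R]

theorem bitOps_subTerm_le {Λ : ℕ} (hΛ : 1000 ≤ Λ) {f : Image R} (hf : f.terms.size ≤ Λ) {r : ℕ}
    (hr : r.size ≤ Λ) (c : R) : (subTerm f r c).bitOps ≤ Λ ^ 2 := by
  have h1 : linCost f.terms 1 ≤ Λ + 1 + 1 := linCost_le hf (by rw [Nat.size_one])
  have h2 : 2 * Λ + 3 ≤ Λ ^ 2 := by nlinarith
  simp only [subTerm, bitOps_bind, val_read, val_ringSub, bitOps_read, bitOps_ringSub, val_isZero,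
    bitOps_isZero, Bool.and_eq_true, Bool.not_eq_true', decide_eq_true_eq,
    decide_eq_false_iff_not]
  split_ifs <;> simp <;> omega

theorem ringOps_subTerm (f : Image R) (r : ℕ) (c : R) : (subTerm f r c).ringOps = 3 := by
  simp only [subTerm, ringOps_bind, val_read, val_ringSub, ringOps_read, ringOps_ringSub,
    val_isZero, ringOps_isZero, Bool.and_eq_true, Bool.not_eq_true', decide_eq_true_eq,
    decide_eq_false_iff_not]
  split_ifs <;> simp

theorem val_subTerm_le (f : Image R) (r : ℕ) (c : R) : (subTerm f r c).val.2 ≤ f.terms + 1 := by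
  simp only [subTerm, val_bind, val_read, val_ringSub, val_isZero, Bool.and_eq_true,
    Bool.not_eq_true', decide_eq_true_eq,
    decide_eq_false_iff_not]
  split_ifs
  · simp
  · simp; omega
  · simp

theorem val_countDrops_le (c : R) (fs : List (Image R)) (rs : List ℕ) :
    (countDrops c fs rs).val ≤ fs.length := by
  induction fs generalizing rs with
  | nil => simp [countDrops]
  | cons f fs ih =>
    match rs with
    | [] => simp [countDrops]
    | r :: rs =>
      have := ih rs
      simp only [countDrops, val_bind, val_natLt, List.length_cons, decide_eq_true_eq]
      split_ifs
      · simpa using this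
      · simp only [val_pure]; omega

theorem bitOps_countDrops_le {Λ : ℕ} (hΛ : 1000 ≤ Λ) (c : R) (fs : List (Image R))
    (hfs : ∀ f ∈ fs, f.terms.size ≤ Λ) (hlen : fs.length.size ≤ Λ) (rs : List ℕ)
    (hrs : ∀ r ∈ rs, r.size ≤ Λ) :
    (countDrops c fs rs).bitOps ≤ fs.length * (3 * Λ ^ 2) := by
  induction fs generalizing rs with
  | nil => simp [countDrops]
  | cons f fs ih =>
    match rs with
    | [] => simp [countDrops]
    | r :: rs =>
      have hlen' : fs.length.size ≤ Λ := (Nat.size_le_size (by simp)).trans hlen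
      have hf := hfs f (by simp)
      have h1 := ih (fun g hg => hfs g (by simp [hg])) hlen' rs (fun q hq => hrs q (by simp [hq]))
      have h2 := bitOps_subTerm_le hΛ hf (hrs r (by simp)) c
      have h3 := Nat.size_le_size (val_subTerm_le f r c)
      have h4 := size_add_le f.terms 1
      have h5 : Nat.size 1 = 1 := Nat.size_one
      have h6 : max f.terms.size (Nat.size 1) ≤ Λ := max_le hf (by omega)
      have h7 := linCost_le_sq hΛ (a := (subTerm f r c).val.2) (b := f.terms) (by omega) (by omega)
      have h8 := (Nat.size_le_size (val_countDrops_le c fs rs)).trans hlen'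
      have h9 := linCost_le_sq hΛ (a := (countDrops c fs rs).val) (b := 1) (by omega) (by omega)
      rw [List.length_cons, add_mul, one_mul]
      simp only [countDrops, bitOps_bind, val_natLt, bitOps_natLt, decide_eq_true_eq]
      split_ifs
      · simp only [bitOps_natAdd]; omega
      · simp only [bitOps_pure]; omega

theorem ringOps_countDrops_le (c : R) (fs : List (Image R)) (rs : List ℕ) :
    (countDrops c fs rs).ringOps ≤ fs.length * 3 := by
  induction fs generalizing rs with
  | nil => simp [countDrops]
  | cons f fs ih =>
    match rs with
    | [] => simp [countDrops]
    | r :: rs =>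
      have := ih rs
      rw [List.length_cons]
      simp only [countDrops, ringOps_bind, val_natLt, ringOps_natLt, ringOps_subTerm,
        decide_eq_true_eq]
      split_ifs
      · simp only [ringOps_natAdd]; omega
      · simp only [ringOps_pure]; omega

/-- The cost of the selection of the terms; `ρ` bounds the cost of reducing the exponent of a
candidate modulo the leaves of `t`. -/
theorem bitOps_select_le {Λ N N₂ ρ : ℕ} (hΛ : 1000 ≤ Λ) (fs : List (Image R))
    (hfs : ∀ f ∈ fs, f.terms.size ≤ Λ) (hlen : fs.length ≤ N) (hN : N.size ≤ Λ)
    (hN₂ : N₂.size ≤ Λ) {t : ProdTree} (ht : t.IsValid)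
    (htl : ∀ p ∈ t.leaves, 0 < p ∧ p.size ≤ Λ) (U : List (ℕ × R))
    (hU : ∀ w ∈ U, (residues w.1 t []).bitOps ≤ ρ) :
    (select fs t N₂ U).bitOps ≤ U.length * (ρ + N * (3 * Λ ^ 2) + Λ ^ 2) := by
  induction U with
  | nil => simp [select]
  | cons w U ih =>
    have h1 := ih fun v hv => hU v (by simp [hv])
    have h2 := hU w (by simp)
    have hlen' : fs.length.size ≤ Λ := (Nat.size_le_size hlen).trans hN
    have h3 := bitOps_countDrops_le hΛ w.2 fs hfs hlen' (residues w.1 t []).val (by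
      rw [val_residues _ ht, List.append_nil]
      intro r hr
      obtain ⟨p, hp, rfl⟩ := List.mem_map.1 hr
      exact (size_mod_le_right _ (htl p hp).1).trans (htl p hp).2)
    have h4 := Nat.mul_le_mul_right (3 * Λ ^ 2) hlen
    have h5 := (Nat.size_le_size (val_countDrops_le w.2 fs (residues w.1 t []).val)).trans hlen'
    have h6 := linCost_le_sq hΛ (a := (countDrops w.2 fs (residues w.1 t []).val).val) (b := N₂)
      (by omega) (by omega)
    rw [List.length_cons, add_mul U.length, one_mul]
    simp only [select, bitOps_bind, bitOps_natLt, bitOps_pure]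
    omega

theorem ringOps_select_le {N N₂ : ℕ} (fs : List (Image R)) (hlen : fs.length ≤ N) (t : ProdTree)
    (U : List (ℕ × R)) : (select fs t N₂ U).ringOps ≤ U.length * (N * 3) := by
  induction U with
  | nil => simp [select]
  | cons w U ih =>
    have h1 := ringOps_countDrops_le w.2 fs (residues w.1 t []).val
    have h2 := Nat.mul_le_mul_right 3 hlen
    rw [List.length_cons, add_mul, one_mul]
    simp only [select, ringOps_bind, ringOps_natLt, ringOps_pure, ringOps_residues]
    omega

theorem bitOps_subAll_le {Λ : ℕ} (hΛ : 1000 ≤ Λ) (c : R) (fs : List (Image R))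
    (hfs : ∀ f ∈ fs, f.terms.size ≤ Λ) (rs : List ℕ) (hrs : ∀ r ∈ rs, r.size ≤ Λ) :
    (subAll c fs rs).bitOps ≤ fs.length * (2 * Λ ^ 2) := by
  induction fs generalizing rs with
  | nil => simp [subAll]
  | cons f fs ih =>
    match rs with
    | [] => simp [subAll]
    | r :: rs =>
      have h1 := ih (fun g hg => hfs g (by simp [hg])) rs (fun q hq => hrs q (by simp [hq]))
      have hr := hrs r (by simp)
      have h2 := bitOps_subTerm_le hΛ (hfs f (by simp)) hr c
      have h3 : r.size + 1 ≤ Λ ^ 2 := by nlinarith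
      rw [List.length_cons, add_mul, one_mul]
      simp only [subAll, bitOps_bind, bitOps_write, bitOps_pure]
      omega

theorem ringOps_subAll_le (c : R) (fs : List (Image R)) (rs : List ℕ) :
    (subAll c fs rs).ringOps ≤ fs.length * 3 := by
  induction fs generalizing rs with
  | nil => simp [subAll]
  | cons f fs ih =>
    match rs with
    | [] => simp [subAll]
    | r :: rs =>
      have := ih rs
      rw [List.length_cons]
      simp only [subAll, ringOps_bind, ringOps_write, ringOps_pure, ringOps_subTerm]
      omega

theorem terms_imageOf_le (g : R[X]) (p : ℕ) : (imageOf g p).terms ≤ p := by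
  exact (Finset.card_filter_le (Finset.range p) fun i => wrap p g i ≠ 0).trans_eq
    (Finset.card_range p)

theorem bitOps_update_le {Λ N ρ : ℕ} (hΛ : 1000 ≤ Λ) {ps : List ℕ}
    (hps : ∀ p ∈ ps, 0 < p ∧ p.size ≤ Λ) (hlen : ps.length ≤ N) {t : ProdTree} (ht : t.IsValid)
    (hl : t.leaves = ps) (s : List (ℕ × R)) (hs : ∀ w ∈ s, (residues w.1 t []).bitOps ≤ ρ)
    (g : R[X]) :
    (update t s (ps.map (imageOf g))).bitOps ≤ s.length * (ρ + N * (2 * Λ ^ 2)) := by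
  induction s generalizing g with
  | nil => simp [update]
  | cons w s ih =>
    obtain ⟨e, c⟩ := w
    have h1 := ih (fun v hv => hs v (by simp [hv])) (g - monomial e c)
    have h2 := hs (e, c) (by simp)
    have h3 := bitOps_subAll_le hΛ c (ps.map (imageOf g)) (by
      intro f hf
      obtain ⟨p, hp, rfl⟩ := List.mem_map.1 hf
      exact (Nat.size_le_size (terms_imageOf_le g p)).trans (hps p hp).2)
      (ps.map fun p => e % p) (by
        intro r hr
        obtain ⟨p, hp, rfl⟩ := List.mem_map.1 hr
        exact (size_mod_le_right _ (hps p hp).1).trans (hps p hp).2)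
    rw [List.length_map] at h3
    have h4 := Nat.mul_le_mul_right (2 * Λ ^ 2) hlen
    rw [List.length_cons, add_mul s.length, one_mul]
    simp only [update, bitOps_bind, val_residues _ ht, hl, List.append_nil,
      val_subAll g e c ps fun p hp => (hps p hp).1]
    simp only at h2
    omega

theorem ringOps_update_le {N : ℕ} {ps : List ℕ} (hps : ∀ p ∈ ps, 0 < p) (hlen : ps.length ≤ N)
    {t : ProdTree} (ht : t.IsValid) (hl : t.leaves = ps) (s : List (ℕ × R)) (g : R[X]) :
    (update t s (ps.map (imageOf g))).ringOps ≤ s.length * (N * 3) := by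
  induction s generalizing g with
  | nil => simp [update]
  | cons w s ih =>
    obtain ⟨e, c⟩ := w
    have h1 := ih (g - monomial e c)
    have h2 := ringOps_subAll_le c (ps.map (imageOf g)) (ps.map fun p => e % p)
    rw [List.length_map] at h2
    have h3 := Nat.mul_le_mul_right 3 hlen
    rw [List.length_cons, add_mul s.length, one_mul]
    simp only [update, ringOps_bind, val_residues _ ht, hl, List.append_nil,
      val_subAll g e c ps hps, ringOps_residues]
    omega

end Testing

section Parameters

theorem size_pow_le {a ℓ : ℕ} (ha : a.size ≤ ℓ) (n : ℕ) : (a ^ n).size ≤ n * ℓ + 1 := by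
  induction n with
  | zero => simp
  | succ n ih =>
    have := size_mul_le (a ^ n) a
    rw [pow_succ, add_mul, one_mul]
    omega

theorem bitOps_natPow_le {Λ X a ℓ : ℕ} (ha : a.size ≤ ℓ) (hX : (2 * X + 2).size ≤ Λ) (n : ℕ)
    (hn : (n + 1) * ℓ ≤ X + ℓ) :
    (natPow a n).bitOps ≤ n * ((2 * X + 2) * Λ ^ 2) := by
  induction n with
  | zero => simp [natPow]
  | succ n ih =>
    rw [add_mul, one_mul] at hn
    have h1 := ih (by omega)
    have h2 := size_pow_le ha n
    rw [add_mul, one_mul] at hn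
    have h3 := mulCost_le_mul (Λ := Λ) (W := 2 * X + 2) (a := a ^ n) (b := a) (by omega) hX
    simp only [natPow, bitOps_bind, val_natPow, bitOps_natMul]
    rw [add_mul n, one_mul]
    omega

theorem clog_pow_le {D ℓ : ℕ} (hD : D.size ≤ ℓ) (n : ℕ) : Nat.clog 2 (D ^ n) ≤ n * ℓ := by
  refine Nat.clog_le_of_le_pow ?_
  calc D ^ n ≤ (2 ^ ℓ) ^ n := Nat.pow_le_pow_left (Nat.size_le.1 hD).le n
    _ = 2 ^ (n * ℓ) := by rw [← pow_mul, mul_comm]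

theorem paramN₁_le {T D ℓ : ℕ} (hD : D.size ≤ ℓ) (hT : 1 ≤ T * ℓ) : paramN₁ T D ≤ T * ℓ :=
  max_le hT ((clog_pow_le hD _).trans (Nat.mul_le_mul_right _ (Nat.sub_le _ _)))

theorem paramN₂_le {T D ℓ : ℕ} (hD : D.size ≤ ℓ) : paramN₂ T D ≤ T * ℓ := clog_pow_le hD T

theorem paramN_le {T D ℓ : ℕ} (hD : D.size ≤ ℓ) (hT : 1 ≤ T * ℓ) : paramN T D ≤ 4 * (T * ℓ) := by
  have h1 := paramN₁_le hD hT
  have h2 := paramN₂_le (T := T) hD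
  unfold paramN
  omega

@[simp] theorem ringOps_params (T D : ℕ) : (params T D).ringOps = 0 := by
  simp [params]

theorem bitOps_params_le {Λ T T' D ℓ : ℕ} (hΛ : 1000 ≤ Λ) (hD : D.size ≤ ℓ) (hℓ : 1 ≤ ℓ)
    (hT : 1 ≤ T) (hT' : T' ≤ T) (hX : (10 * (T * ℓ)).size ≤ Λ) :
    (params T' D).bitOps ≤ 30 * (T * (T * ℓ) * Λ ^ 2) := by
  obtain ⟨X, hXdef⟩ : ∃ X, X = T * ℓ := ⟨_, rfl⟩
  have hℓX : ℓ ≤ X := by rw [hXdef]; exact Nat.le_mul_of_pos_left _ hT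
  have hTX : T ≤ X := by rw [hXdef]; exact Nat.le_mul_of_pos_right _ hℓ
  have hTℓ : T' * ℓ ≤ X := by rw [hXdef]; exact Nat.mul_le_mul_right _ hT'
  have hTℓ' : (T' - 1) * ℓ ≤ X := (Nat.mul_le_mul_right _ (Nat.sub_le _ _)).trans hTℓ
  rw [← hXdef] at hX ⊢
  have hsize : ∀ n, n ≤ 10 * X → n.size ≤ Λ := fun n hn => (Nat.size_le_size hn).trans hX
  have h1 := bitOps_natPow_le (Λ := Λ) (X := X) hD (hsize _ (by omega)) (T' - 1)
    (by rw [add_mul]; omega)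
  have h2 := bitOps_natPow_le (Λ := Λ) (X := X) hD (hsize _ (by omega)) T'
    (by rw [add_mul]; omega)
  have h3 : (T' - 1) * ((2 * X + 2) * Λ ^ 2) ≤ T * (4 * (X * Λ ^ 2)) := by
    refine Nat.mul_le_mul (by omega) ?_
    rw [← mul_assoc]
    exact Nat.mul_le_mul_right _ (by omega)
  have h4 : T' * ((2 * X + 2) * Λ ^ 2) ≤ T * (4 * (X * Λ ^ 2)) := by
    refine Nat.mul_le_mul (by omega) ?_
    rw [← mul_assoc]
    exact Nat.mul_le_mul_right _ (by omega)
  have s1 := size_pow_le hD (T' - 1)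
  have s2 := size_pow_le hD T'
  have c1 := clog_pow_le hD (T' - 1)
  have c2 := clog_pow_le hD T'
  have o1 : Nat.size 1 = 1 := Nat.size_one
  have hsΛ : ∀ a b, a ≤ 10 * X → b ≤ 10 * X → linCost a b ≤ Λ ^ 2 := fun a b ha hb =>
    linCost_le_sq hΛ ((hsize a ha).trans (by omega)) ((hsize b hb).trans (by omega))
  have l1 := hsΛ T' 1 (by omega) (by omega)
  have l2 : linCost (D ^ (T' - 1)) 1 ≤ X + 3 := by unfold linCost; omega
  have l3 : linCost (D ^ T') 1 ≤ X + 3 := by unfold linCost; omega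
  have l4 := hsΛ 1 (Nat.clog 2 (D ^ (T' - 1))) (by omega) (by omega)
  have l5 : mulCost 4 (max 1 (Nat.clog 2 (D ^ (T' - 1)))) ≤ 10 * X * Λ ^ 2 := by
    refine mulCost_le_mul ?_ hX
    have := size_le_self (max 1 (Nat.clog 2 (D ^ (T' - 1))))
    have h4 : Nat.size 4 = 3 := by decide
    omega
  have l6 := hsΛ (max 1 (Nat.clog 2 (D ^ (T' - 1)))) (Nat.clog 2 (D ^ T')) (by omega) (by omega)
  have l7 := hsΛ (max 1 (Nat.clog 2 (D ^ (T' - 1))) + Nat.clog 2 (D ^ T')) 1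
    (by omega) (by omega)
  have l8 := hsΛ (4 * max 1 (Nat.clog 2 (D ^ (T' - 1))))
    (max 1 (Nat.clog 2 (D ^ (T' - 1))) + Nat.clog 2 (D ^ T') - 1) (by omega) (by omega)
  simp only [params, bitOps_bind, val_natSub, val_natPow, val_natClog, val_natMax, val_natMul,
    val_natAdd, bitOps_natSub, bitOps_natClog, bitOps_natMax, bitOps_natMul, bitOps_natAdd,
    bitOps_pure]
  have e1 : T * (4 * (X * Λ ^ 2)) = 4 * (T * X * Λ ^ 2) := by ring
  have e2 : Λ ^ 2 ≤ X * Λ ^ 2 := Nat.le_mul_of_pos_left _ (by omega)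
  have e3 : X * Λ ^ 2 ≤ T * X * Λ ^ 2 := by
    rw [mul_assoc]; exact Nat.le_mul_of_pos_left _ hT
  have e4 : 10 * X * Λ ^ 2 = 10 * (X * Λ ^ 2) := by ring
  have e5 : X + 3 ≤ X * Λ ^ 2 := by
    calc X + 3 ≤ X * 4 := by omega
      _ ≤ X * Λ ^ 2 := Nat.mul_le_mul_left _
        ((by omega : 4 ≤ Λ).trans (Nat.le_self_pow (by norm_num) Λ))
  omega

@[simp] theorem ringOps_crtPrimes (D : ℕ) (ps : List ℕ) (A : ℕ) :
    (crtPrimes D ps A).ringOps = 0 := by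
  induction ps generalizing A with
  | nil => rfl
  | cons q ps ih =>
    simp only [crtPrimes, ringOps_bind, val_natLt, ringOps_natLt, decide_eq_true_eq]
    split_ifs
    · simp [ih]
    · simp

theorem bitOps_crtPrimes_le {Λ ℓ D : ℕ} (hΛ : 1000 ≤ Λ) (hℓ : 1 ≤ ℓ)
    (hW : (10 * (ℓ * Λ)).size ≤ Λ) (hD : D.size ≤ ℓ) (ps : List ℕ) (hps : ∀ p ∈ ps, p.size ≤ Λ)
    (A : ℕ) (hA : A.size ≤ ℓ + Λ) :
    (crtPrimes D ps A).bitOps ≤ ((crtPrimes D ps A).val.length + 1) * (14 * (ℓ * Λ ^ 3)) := by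
  induction ps generalizing A with
  | nil => simp [crtPrimes]
  | cons q ps ih =>
    have hΛℓ : Λ ≤ ℓ * Λ := Nat.le_mul_of_pos_left _ hℓ
    have hℓΛ : ℓ ≤ ℓ * Λ := Nat.le_mul_of_pos_right _ (by omega)
    have c1 : linCost A D ≤ 4 * (ℓ * Λ) := by unfold linCost; omega
    have c2 : 4 * (ℓ * Λ) ≤ 4 * (ℓ * Λ ^ 3) :=
      Nat.mul_le_mul_left _ (Nat.mul_le_mul_left _ (Nat.le_self_pow (by norm_num) Λ))
    simp only [crtPrimes, bitOps_bind, val_bind, val_natLt, bitOps_natLt, decide_eq_true_eq]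
    split_ifs with h
    · have hA' : A.size ≤ ℓ := (Nat.size_le_size h.le).trans hD
      have hq := hps q (by simp)
      have c3 : mulCost A q ≤ 10 * (ℓ * Λ) * Λ ^ 2 := mulCost_le_mul (by omega) hW
      have c4 : 10 * (ℓ * Λ) * Λ ^ 2 = 10 * (ℓ * Λ ^ 3) := by ring
      have c5 := size_mul_le A q
      have := ih (fun p hp => hps p (by simp [hp])) (A * q) (by omega)
      simp only [bitOps_bind, val_natMul, bitOps_natMul, bitOps_pure, val_bind, val_pure,
        List.length_cons]
      rw [add_mul (_ + 1), one_mul]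
      omega
    · simp only [bitOps_pure, val_pure, List.length_nil]
      omega

end Parameters

/-! ### The scale of the cost estimates -/

/-- The quantities in terms of which all costs are estimated: `ℓ` bounds the bit length of `D`, and
`Λ` is a large multiple of the bit length of `T * ℓ`, so that it exceeds the bit lengths of the
primes, of the indices and of all other numbers that are polynomially bounded in `T * ℓ`. Exponents
have up to `ℓ` bits. -/
structure IsScale (T D ℓ Λ : ℕ) : Prop where
  one_le_T : 1 ≤ T
  one_le_ℓ : 1 ≤ ℓ
  size_D : D.size ≤ ℓ
  eq : Λ = 1000 * (T * ℓ).size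

namespace IsScale

variable {T D ℓ Λ : ℕ}

theorem one_le_mul (hs : IsScale T D ℓ Λ) : 1 ≤ T * ℓ :=
  Nat.mul_pos hs.one_le_T hs.one_le_ℓ

theorem le_Λ (hs : IsScale T D ℓ Λ) : 1000 ≤ Λ := by
  have := Nat.size_pos.2 hs.one_le_mul
  rw [hs.eq]
  omega

theorem size_le (hs : IsScale T D ℓ Λ) {n : ℕ} (hn : n ≤ 1000 * ((T * ℓ) ^ 2 * Λ ^ 5)) :
    n.size ≤ Λ := by
  refine (Nat.size_le_size hn).trans ?_
  have h0 := Nat.size_pos.2 hs.one_le_mul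
  have h1 : Λ.size ≤ 10 + (T * ℓ).size := by
    rw [hs.eq]
    refine (size_mul_le _ _).trans ?_
    have h2 : Nat.size 1000 = 10 := by decide
    have h3 := size_le_self (T * ℓ).size
    omega
  have h2 : Nat.size 1000 = 10 := by decide
  have h3 := size_mul_le 1000 ((T * ℓ) ^ 2 * Λ ^ 5)
  have h4 := size_mul_le ((T * ℓ) ^ 2) (Λ ^ 5)
  have h5 := size_pow_le (le_refl (T * ℓ).size) 2
  have h6 := size_pow_le h1 5
  have h7 := hs.eq
  omega

theorem size_le_of_le (hs : IsScale T D ℓ Λ) {n : ℕ} (hn : n ≤ 1000 * (T * ℓ)) : n.size ≤ Λ := by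
  refine hs.size_le (hn.trans (Nat.mul_le_mul_left _ ?_))
  calc T * ℓ = T * ℓ * 1 := (mul_one _).symm
    _ ≤ (T * ℓ) ^ 2 * Λ ^ 5 := Nat.mul_le_mul (Nat.le_self_pow (by norm_num) _)
      (Nat.one_le_pow _ _ (by have := hs.le_Λ; omega))

theorem size_le_of_le_mul (hs : IsScale T D ℓ Λ) {n : ℕ} (hn : n ≤ 1000 * (T * ℓ * Λ)) :
    n.size ≤ Λ :=
  hs.size_le (hn.trans (Nat.mul_le_mul_left _ (Nat.mul_le_mul (Nat.le_self_pow (by norm_num) _)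
    (Nat.le_self_pow (by norm_num) _))))

theorem ℓ_le (hs : IsScale T D ℓ Λ) : ℓ ≤ T * ℓ := Nat.le_mul_of_pos_left _ hs.one_le_T

theorem T_le (hs : IsScale T D ℓ Λ) : T ≤ T * ℓ := Nat.le_mul_of_pos_right _ hs.one_le_ℓ

theorem size_ℓΛ (hs : IsScale T D ℓ Λ) : (10 * (ℓ * Λ)).size ≤ Λ := by
  have := Nat.mul_le_mul_right Λ hs.ℓ_le
  exact hs.size_le_of_le_mul (by omega)

theorem paramN_le (hs : IsScale T D ℓ Λ) {T' : ℕ} (hT' : T' ≤ T) (hD : 1 ≤ D) :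
    paramN T' D ≤ 4 * (T * ℓ) :=
  (paramN_mono hD hT').trans (UIPoly.paramN_le hs.size_D hs.one_le_mul)

/-- The primes have at most `Λ` bits, and their sizes are quasi-linear in their number. -/
theorem prime_le (hs : IsScale T D ℓ Λ) {n p : ℕ} (hn : n ≤ 4 * (T * ℓ)) (hp : p ∈ primeList n) :
    p.size ≤ Λ ∧ p ≤ (n + 1) * Λ := by
  obtain ⟨i, hi, rfl⟩ := List.mem_map.1 hp
  rw [List.mem_range] at hi
  have h1 := hs.one_le_mul
  have h2 := size_nth_prime_le i
  have h3 : (i + 2).size ≤ (T * ℓ).size + 4 := by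
    have h4 : i + 2 ≤ 8 * (T * ℓ) := by omega
    refine (Nat.size_le_size h4).trans ((size_mul_le _ _).trans ?_)
    have h5 : Nat.size 8 = 4 := by decide
    omega
  have h4 : (Nat.nth Nat.Prime i).size ≤ Λ := by
    have := Nat.size_pos.2 h1
    have := hs.eq
    omega
  refine ⟨h4, (nth_prime_le i).trans (Nat.mul_le_mul (by omega) h4)⟩

/-- The primes for Chinese remaindering are the first `K` primes for some `K ≤ ℓ`. -/
theorem crtPrimes_eq (hs : IsScale T D ℓ Λ) (n : ℕ) : ∃ K ≤ ℓ,
    (crtPrimes D (primeList n) 1).val = primeList K := by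
  obtain ⟨m, hm, _⟩ := val_crtPrimes D (primeList n) 1
  have h1 : (primeList n).take m = primeList (min m n) := by
    rw [← take_primeList (min_le_right m n), ← length_primeList n, List.take_eq_take_min,
      length_primeList]
  refine ⟨min m n, ?_, hm.trans h1⟩
  rcases two_pow_length_crtPrimes (D := D) (A := 1)
    (fun p hp => (prime_of_mem_primeList hp).two_le) le_rfl with h2 | h2
  · rw [hm, h1] at h2
    have h3 := congrArg List.length h2
    rw [length_primeList, List.length_nil] at h3
    omega
  · rw [hm, h1, length_primeList, one_mul] at h2
    have h3 := (Nat.pow_lt_pow_iff_right (by norm_num)).1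
      (h2.trans (Nat.size_le.1 hs.size_D))
    omega

variable {R : Type u} [Ring R] [DecidableEq R]

theorem bitOps_residues_le (hs : IsScale T D ℓ Λ) (g : R[X]) {n e : ℕ} (hn : n ≤ 4 * (T * ℓ))
    (he : e.size ≤ ℓ) :
    (residues e (imageTree ((primeList n).map (imageOf g))).val []).bitOps ≤
      41 * (T * ℓ * Λ ^ 4) := by
  have hΛ := hs.le_Λ
  have hlen : ((primeList n).map (imageOf g)).map Image.p = primeList n := by
    rw [List.map_map]; exact List.map_id _
  have h1 : n * Λ ≤ 4 * (T * ℓ * Λ) := by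
    rw [← mul_assoc 4]
    exact Nat.mul_le_mul_right _ hn
  have h2 : ℓ ≤ T * ℓ * Λ := hs.ℓ_le.trans (Nat.le_mul_of_pos_right _ (by omega))
  have h4 := hs.one_le_ℓ
  have h3 := UIPoly.bitOps_residues_le (Λ := Λ) (V := 5 * (T * ℓ * Λ)) (k := Λ)
    (fuel := ((primeList n).map (imageOf g)).length) (u := ℓ) (e := e) hΛ
    (hs.size_le_of_le_mul (by omega)) (l := primeList n) (by simp)
    (fun p hp => (prime_of_mem_primeList hp).pos) (fun p hp => (hs.prime_le hn hp).1)
    (by rw [length_primeList]; omega)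
    (by
      rw [length_primeList]
      have := hs.size_le_of_le (n := n) (by omega)
      exact (Nat.lt_size_self n).le.trans (Nat.pow_le_pow_right (by norm_num) this))
    he (by omega) []
  rw [imageTree, hlen]
  refine h3.trans ?_
  rw [length_primeList]
  calc (2 * ℓ + n * ((Λ + 1) * (5 * Λ))) * Λ ^ 2
      ≤ (T * ℓ * Λ ^ 2 + 4 * (T * ℓ) * ((2 * Λ) * (5 * Λ))) * Λ ^ 2 := by
        refine Nat.mul_le_mul_right _ (Nat.add_le_add ?_ (Nat.mul_le_mul hn
          (Nat.mul_le_mul_right _ (by omega))))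
        calc 2 * ℓ = ℓ * 2 := mul_comm _ _
          _ ≤ T * ℓ * Λ ^ 2 := Nat.mul_le_mul hs.ℓ_le
            ((by omega : 2 ≤ Λ).trans (Nat.le_self_pow (by norm_num) Λ))
    _ = 41 * (T * ℓ * Λ ^ 4) := by ring

theorem bitOps_imageTree_le (hs : IsScale T D ℓ Λ) (g : R[X]) {n : ℕ} (hn : n ≤ 4 * (T * ℓ)) :
    (imageTree ((primeList n).map (imageOf g))).bitOps ≤ 12 * (T * ℓ * Λ ^ 4) := by
  have hΛ := hs.le_Λ
  have hlen : ((primeList n).map (imageOf g)).map Image.p = primeList n := by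
    rw [List.map_map]; exact List.map_id _
  have h1 : n * Λ ≤ 4 * (T * ℓ * Λ) := by
    rw [← mul_assoc 4]
    exact Nat.mul_le_mul_right _ hn
  have h2 : ℓ ≤ T * ℓ * Λ := hs.ℓ_le.trans (Nat.le_mul_of_pos_right _ (by omega))
  have h4 := hs.one_le_ℓ
  have h3 := bitOps_prodTree_le (Λ := Λ) (V := 5 * (T * ℓ * Λ)) (k := Λ)
    (fuel := ((primeList n).map (imageOf g)).length) hΛ
    (hs.size_le_of_le_mul (by omega)) (l := primeList n) (by simp)
    (fun p hp => (hs.prime_le hn hp).1) (by rw [length_primeList]; omega)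
    (by
      rw [length_primeList]
      have := hs.size_le_of_le (n := n) (by omega)
      exact (Nat.lt_size_self n).le.trans (Nat.pow_le_pow_right (by norm_num) this))
  rw [imageTree, hlen]
  refine h3.trans ?_
  rw [length_primeList]
  calc n * (Λ * (3 * Λ ^ 3)) ≤ 4 * (T * ℓ) * (Λ * (3 * Λ ^ 3)) := Nat.mul_le_mul_right _ hn
    _ = 12 * (T * ℓ * Λ ^ 4) := by ring

end IsScale

/-! ### Bit operations of a round -/

namespace IsScale

variable {T D ℓ Λ : ℕ}

theorem pow_le_budget (hs : IsScale T D ℓ Λ) {k : ℕ} (hk : k ≤ 5) :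
    Λ ^ k ≤ Λ ^ 5 := Nat.pow_le_pow_right (by have := hs.le_Λ; omega) hk

theorem sq_mul_le_budget (hs : IsScale T D ℓ Λ) {k : ℕ} (hk : k ≤ 5) :
    T * (T * ℓ) * Λ ^ k ≤ (T * ℓ ^ 2 + T ^ 2 * ℓ) * Λ ^ 5 :=
  Nat.mul_le_mul (by nlinarith) (hs.pow_le_budget hk)

theorem mul_sq_le_budget (hs : IsScale T D ℓ Λ) {k : ℕ} (hk : k ≤ 5) :
    T * ℓ ^ 2 * Λ ^ k ≤ (T * ℓ ^ 2 + T ^ 2 * ℓ) * Λ ^ 5 :=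
  Nat.mul_le_mul (Nat.le_add_right _ _) (hs.pow_le_budget hk)

theorem mul_le_budget (hs : IsScale T D ℓ Λ) {k : ℕ} (hk : k ≤ 5) :
    T * ℓ * Λ ^ k ≤ (T * ℓ ^ 2 + T ^ 2 * ℓ) * Λ ^ 5 :=
  (Nat.mul_le_mul_right _ (Nat.le_mul_of_pos_left _ hs.one_le_T)).trans (hs.sq_mul_le_budget hk)

end IsScale

section Rounds

variable {T D ℓ Λ : ℕ}

variable {R : Type u} [Ring R] [DecidableEq R]

omit [DecidableEq R] in
theorem IsPart.length_le {f : R[X]} {h : List (ℕ × R)} (hh : IsPart f h) :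
    h.length ≤ f.support.card := by
  have := hh.card_support_sub
  omega

omit [DecidableEq R] in
theorem IsPart.lt {f : R[X]} {D : ℕ} (hf : ∀ e, f.coeff e ≠ 0 → e < D) {h : List (ℕ × R)}
    (hh : IsPart f h) {w : ℕ × R} (hw : w ∈ h) : w.1 < D := by
  refine hf _ ?_
  rw [(hh.2 w hw).2]
  exact (hh.2 w hw).1

theorem IsRound.length_le {g : R[X]} {T D : ℕ} {qs : List ℕ} {p : ℕ} {U s : List (ℕ × R)}
    (h : IsRound g T D qs p U s) (hg : g.support.card ≤ T) : U.length ≤ T := by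
  rw [h.candidates]
  exact (length_uTerms_le _ _ _ _).trans ((terms_le_card_support g p).trans hg)

theorem IsRound.lt {g : R[X]} {T D : ℕ} {qs : List ℕ} {p : ℕ} {U s : List (ℕ × R)}
    (h : IsRound g T D qs p U s) {w : ℕ × R} (hw : w ∈ U) : w.1 < D := by
  rw [h.candidates, mem_uTerms] at hw
  obtain ⟨_, _, _, _, h6, _⟩ := hw
  exact h6

theorem IsRound.subset {g : R[X]} {T D : ℕ} {qs : List ℕ} {p : ℕ} {U s : List (ℕ × R)}
    (h : IsRound g T D qs p U s) : s ⊆ U := by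
  rw [h.found]
  exact List.filter_sublist.subset

theorem IsRound.length_found_le {g : R[X]} {T D : ℕ} {qs : List ℕ} {p : ℕ} {U s : List (ℕ × R)}
    (h : IsRound g T D qs p U s) : s.length ≤ U.length := by
  rw [h.found]
  exact List.length_filter_le _ _

/-- The primes for Chinese remaindering, of which there are at most `ℓ`, are of size
`O(ℓ * Λ)`. -/
theorem IsScale.prime_crt (hs : IsScale T D ℓ Λ) {K : ℕ} (hK : K ≤ ℓ) {q : ℕ}
    (hq : q ∈ primeList K) : 0 < q ∧ q.size ≤ Λ ∧ q ≤ 2 * (ℓ * Λ) := by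
  have h1 := hs.ℓ_le
  have h2 := hs.one_le_ℓ
  obtain ⟨q1, q2⟩ := hs.prime_le (by omega : K ≤ 4 * (T * ℓ)) hq
  refine ⟨(prime_of_mem_primeList hq).pos, q1, q2.trans ?_⟩
  rw [← mul_assoc]
  exact Nat.mul_le_mul_right _ (by omega)

theorem IsScale.size_terms_le (hs : IsScale T D ℓ Λ) {n : ℕ} (hn : n ≤ 4 * (T * ℓ)) (g : R[X])
    {f : Image R} (hf : f ∈ (primeList n).map (imageOf g)) : f.terms.size ≤ Λ := by
  obtain ⟨q, hq, rfl⟩ := List.mem_map.1 hf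
  exact (Nat.size_le_size (terms_imageOf_le _ q)).trans (hs.prime_le hn hq).1

theorem IsScale.bitOps_best_le (hs : IsScale T D ℓ Λ) {n : ℕ} (hn : n ≤ 4 * (T * ℓ)) (g : R[X])
    {f₀ : Image R} {fs : List (Image R)} (hfs : f₀ :: fs = (primeList n).map (imageOf g)) :
    (best f₀ fs).bitOps ≤ 4 * ((T * ℓ ^ 2 + T ^ 2 * ℓ) * Λ ^ 5) := by
  have hlen : fs.length + 1 = n := by
    have := congrArg List.length hfs
    rwa [List.length_cons, List.length_map, length_primeList] at this
  calc (best f₀ fs).bitOps ≤ fs.length * Λ ^ 2 := UIPoly.bitOps_best_le hs.le_Λ f₀ fs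
        fun f hf => hs.size_terms_le hn g (hfs ▸ hf)
    _ ≤ 4 * (T * ℓ) * Λ ^ 2 := Nat.mul_le_mul_right _ (by omega)
    _ = 4 * (T * ℓ * Λ ^ 2) := by ring
    _ ≤ _ := Nat.mul_le_mul_left _ (hs.mul_le_budget (by norm_num))

omit [DecidableEq R] in
theorem IsScale.bitOps_cofactorImages_le (hs : IsScale T D ℓ Λ) (M : ∀ p : ℕ, CyclicMul.{u} p)
    {L : ℕ} (P : SLP R Unit L) {h : List (ℕ × R)} (hlen : h.length ≤ T)
    (hh : ∀ w ∈ h, w.1.size ≤ ℓ) {p : ℕ} (hp0 : 0 < p) (hp : p.size ≤ Λ) {K : ℕ} (hK : K ≤ ℓ) :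
    (cofactorImages M P h p (primeList K)).bitOps ≤
      12 * ((T * ℓ ^ 2 + T ^ 2 * ℓ) * Λ ^ 5) := by
  have h1 := UIPoly.bitOps_cofactorImages_le hs.le_Λ hs.one_le_ℓ hs.size_ℓΛ M P h hh hp0 hp
    (primeList K) fun q hq => ⟨(hs.prime_crt hK hq).1, (hs.prime_crt hK hq).2.1⟩
  rw [length_primeList] at h1
  refine h1.trans ?_
  calc K * (Λ ^ 4 + h.length * (11 * (ℓ * Λ ^ 3)))
      ≤ ℓ * (Λ ^ 4 + T * (11 * (ℓ * Λ ^ 3))) := Nat.mul_le_mul hK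
        (Nat.add_le_add_left (Nat.mul_le_mul_right _ hlen) _)
    _ = ℓ * Λ ^ 4 + 11 * (T * ℓ ^ 2 * Λ ^ 3) := by ring
    _ ≤ T * ℓ * Λ ^ 4 + 11 * (T * ℓ ^ 2 * Λ ^ 3) :=
        Nat.add_le_add_right (Nat.mul_le_mul_right _ hs.ℓ_le) _
    _ ≤ _ + 11 * _ := Nat.add_le_add (hs.mul_le_budget (by norm_num))
        (Nat.mul_le_mul_left _ (hs.mul_sq_le_budget (by norm_num)))
    _ = _ := by ring

theorem IsScale.bitOps_uTerms_le (hs : IsScale T D ℓ Λ) {g : R[X]} (hg : g.support.card ≤ T)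
    {n p : ℕ} (hn : n ≤ 4 * (T * ℓ)) (hp : p ∈ primeList n) {K : ℕ} (hK : K ≤ ℓ) :
    (uTerms D (imageOf g p) ((primeList K).map fun q => (q, wrap (p * q) g)) p).bitOps ≤
      18 * ((T * ℓ ^ 2 + T ^ 2 * ℓ) * Λ ^ 5) := by
  obtain ⟨hp1, hp2⟩ := hs.prime_le hn hp
  have hX := hs.one_le_mul
  have hnz : ((Finset.range p).filter fun i => (imageOf g p).coeff i ≠ 0).card ≤ T :=
    (terms_le_card_support _ p).trans hg
  have h1 := UIPoly.bitOps_uTerms_le (T := T) hs.le_Λ hs.one_le_ℓ hs.size_ℓΛ hs.size_D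
    (f := imageOf g p) hp1 ((primeList K).map fun q => (q, wrap (p * q) g)) (by
      intro w hw
      obtain ⟨q, hq, rfl⟩ := List.mem_map.1 hw
      exact hs.prime_crt hK hq) (by rwa [List.length_map, length_primeList]) p le_rfl hnz
  refine h1.trans ?_
  have hp5 : p ≤ 5 * (T * ℓ) * Λ := hp2.trans (Nat.mul_le_mul_right _ (by omega))
  calc _ ≤ 5 * (T * ℓ) * Λ * Λ ^ 2 + T * (10 * (ℓ ^ 2 * Λ ^ 5) + 3 * (T * ℓ)) :=
        Nat.add_le_add (Nat.mul_le_mul_right _ hp5) (Nat.mul_le_mul_right _ hnz)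
    _ = 5 * (T * ℓ * Λ ^ 3) + 10 * (T * ℓ ^ 2 * Λ ^ 5) + 3 * (T * (T * ℓ) * Λ ^ 0) := by ring
    _ ≤ 5 * _ + 10 * _ + 3 * _ := Nat.add_le_add (Nat.add_le_add
        (Nat.mul_le_mul_left _ (hs.mul_le_budget (by norm_num)))
        (Nat.mul_le_mul_left _ (hs.mul_sq_le_budget (by norm_num))))
        (Nat.mul_le_mul_left _ (hs.sq_mul_le_budget (by norm_num)))
    _ = _ := by ring

theorem IsScale.bitOps_select_le (hs : IsScale T D ℓ Λ) (g : R[X]) {n N₂ : ℕ}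
    (hn : n ≤ 4 * (T * ℓ)) (hN₂ : N₂ ≤ 4 * (T * ℓ)) {U : List (ℕ × R)} (hlen : U.length ≤ T)
    (hU : ∀ w ∈ U, w.1.size ≤ ℓ) :
    (select ((primeList n).map (imageOf g)) (imageTree ((primeList n).map (imageOf g))).val
      N₂ U).bitOps ≤ 54 * ((T * ℓ ^ 2 + T ^ 2 * ℓ) * Λ ^ 5) := by
  have h1 := UIPoly.bitOps_select_le (N := 4 * (T * ℓ)) (N₂ := N₂)
    (ρ := 41 * (T * ℓ * Λ ^ 4)) hs.le_Λ ((primeList n).map (imageOf g))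
    (fun f hf => hs.size_terms_le hn g hf)
    (by rwa [List.length_map, length_primeList]) (hs.size_le_of_le (by omega))
    (hs.size_le_of_le (by omega)) (val_imageTree g _).2 (by
      rw [(val_imageTree _ _).1]
      intro q hq
      exact ⟨(prime_of_mem_primeList hq).pos, (hs.prime_le hn hq).1⟩) U
    (fun w hw => hs.bitOps_residues_le _ hn (hU w hw))
  refine h1.trans ?_
  calc _ ≤ T * (41 * (T * ℓ * Λ ^ 4) + 4 * (T * ℓ) * (3 * Λ ^ 2) + T * ℓ * Λ ^ 2) :=
        Nat.mul_le_mul hlen (Nat.add_le_add_left (Nat.le_mul_of_pos_left _ hs.one_le_mul) _)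
    _ = 41 * (T * (T * ℓ) * Λ ^ 4) + 13 * (T * (T * ℓ) * Λ ^ 2) := by ring
    _ ≤ 41 * _ + 13 * _ := Nat.add_le_add
        (Nat.mul_le_mul_left _ (hs.sq_mul_le_budget (by norm_num)))
        (Nat.mul_le_mul_left _ (hs.sq_mul_le_budget (by norm_num)))
    _ = _ := by ring

theorem IsScale.bitOps_update_le (hs : IsScale T D ℓ Λ) (g : R[X]) {n : ℕ}
    (hn : n ≤ 4 * (T * ℓ)) {s : List (ℕ × R)} (hlen : s.length ≤ T)
    (hU : ∀ w ∈ s, w.1.size ≤ ℓ) :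
    (update (imageTree ((primeList n).map (imageOf g))).val s
      ((primeList n).map (imageOf g))).bitOps ≤ 49 * ((T * ℓ ^ 2 + T ^ 2 * ℓ) * Λ ^ 5) := by
  have h1 := UIPoly.bitOps_update_le (N := 4 * (T * ℓ)) (ρ := 41 * (T * ℓ * Λ ^ 4)) hs.le_Λ
    (fun q hq => ⟨(prime_of_mem_primeList hq).pos, (hs.prime_le hn hq).1⟩)
    (by rwa [length_primeList]) (val_imageTree g (primeList n)).2 (val_imageTree g _).1 s
    (fun w hw => hs.bitOps_residues_le _ hn (hU w hw)) g
  refine h1.trans ?_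
  calc _ ≤ T * (41 * (T * ℓ * Λ ^ 4) + 4 * (T * ℓ) * (2 * Λ ^ 2)) :=
        Nat.mul_le_mul_right _ hlen
    _ = 41 * (T * (T * ℓ) * Λ ^ 4) + 8 * (T * (T * ℓ) * Λ ^ 2) := by ring
    _ ≤ 41 * _ + 8 * _ := Nat.add_le_add
        (Nat.mul_le_mul_left _ (hs.sq_mul_le_budget (by norm_num)))
        (Nat.mul_le_mul_left _ (hs.sq_mul_le_budget (by norm_num)))
    _ = _ := by ring

omit [Ring R] [DecidableEq R] in
theorem IsScale.linCost_le_budget (hs : IsScale T D ℓ Λ) {a b : ℕ} (ha : a.size ≤ Λ)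
    (hb : b.size ≤ Λ) : linCost a b ≤ (T * ℓ ^ 2 + T ^ 2 * ℓ) * Λ ^ 5 := by
  refine (linCost_le_sq hs.le_Λ (by omega) (by omega)).trans ?_
  exact (Nat.le_mul_of_pos_left _ hs.one_le_mul).trans (hs.mul_le_budget (by norm_num))

theorem exists_eq_cons (T : ℕ) (g : R[X]) :
    ∃ f₀ fs, f₀ :: fs = (primeList (paramN T D)).map (imageOf g) := by
  cases hl : (primeList (paramN T D)).map (imageOf g) with
  | nil =>
    have h1 := congrArg List.length hl
    rw [List.length_map, length_primeList] at h1
    have := four_le_paramN T D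
    simp only [List.length_nil] at h1
    omega
  | cons a l => exact ⟨a, l, rfl⟩

/-- The bit operations of one round of the main loop. -/
theorem bitOps_loop_succ_le (M : ∀ p : ℕ, CyclicMul.{u} p) {L : ℕ} (P : SLP R Unit L)
    {T' K : ℕ} (hs : IsScale T D ℓ Λ) (hD : 1 ≤ D) (hT' : T' ≤ T) (hK : K ≤ ℓ)
    (hf : P.toPoly.support.card ≤ T) {h : List (ℕ × R)}
    (H : LoopInv P.toPoly T' D (primeList K) h) (fuel : ℕ)
    (hg : 0 < (P.toPoly - listPoly h).support.card) :
    ∃ s : List (ℕ × R), LoopInv P.toPoly (T' - s.length) D (primeList K) (h ++ s) ∧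
      2 * (P.toPoly - listPoly (h ++ s)).support.card ≤ (P.toPoly - listPoly h).support.card ∧
      (loop M P D (primeList K) (fuel + 1)
        ((primeList (paramN T' D)).map (imageOf (P.toPoly - listPoly h))) T' (paramN₁ T' D)
        (paramN₂ T' D) h).bitOps ≤ 200 * ((T * ℓ ^ 2 + T ^ 2 * ℓ) * Λ ^ 5) +
          (loop M P D (primeList K) fuel ((primeList (paramN (T' - s.length) D)).map
            (imageOf (P.toPoly - listPoly (h ++ s)))) (T' - s.length)
            (paramN₁ (T' - s.length) D) (paramN₂ (T' - s.length) D) (h ++ s)).bitOps := by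
  obtain ⟨f₀, fs, hfs⟩ := exists_eq_cons (D := D) T' (P.toPoly - listPoly h)
  obtain ⟨p, U, s, hr, hbest, hU, hcof, hsel, hupd, _⟩ := exists_round M P H hg fuel hfs
  obtain ⟨H', h1, h2⟩ := H.round hg hr
  refine ⟨s, H', by omega, ?_⟩
  have hterms : (imageOf (P.toPoly - listPoly h) p).terms ≠ 0 := (hr.terms_pos (by omega)).ne'
  rw [← hfs]
  have hX := hs.one_le_mul
  have hTX := hs.T_le
  have hN := hs.paramN_le hT' hD
  have hNs := hs.paramN_le (T' := T' - s.length) (by omega) hD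
  have hm : paramN₁ T' D + paramN₂ T' D - 1 ≤ paramN T' D := le_max_right _ _
  have hm₁ : 4 * paramN₁ T' D ≤ paramN T' D := le_max_left _ _
  have hm₂ := one_le_paramN₁ T' D
  have hcard := H.card_le
  have hhlen := H.isPart.length_le.trans hf
  have hUlen : U.length ≤ T := (hr.length_le hcard).trans hT'
  have hslen : s.length ≤ T := hr.length_found_le.trans hUlen
  have hDℓ : ∀ e, e < D → e.size ≤ ℓ := fun e he => (Nat.size_le_size he.le).trans hs.size_D
  have htake₁ : (f₀ :: fs).take (paramN₁ T' D + paramN₂ T' D - 1) =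
      (primeList (paramN₁ T' D + paramN₂ T' D - 1)).map (imageOf (P.toPoly - listPoly h)) := by
    rw [hfs, ← List.map_take, take_primeList hm]
  have htake₂ : (f₀ :: fs).take (paramN (T' - s.length) D) =
      (primeList (paramN (T' - s.length) D)).map (imageOf (P.toPoly - listPoly h)) := by
    rw [hfs, ← List.map_take, take_primeList (paramN_mono hD (Nat.sub_le _ _))]
  have hsz : ∀ n, n ≤ 1000 * (T * ℓ) → n.size ≤ Λ := fun n hn => hs.size_le_of_le hn
  have c1 := hs.bitOps_best_le hN _ hfs
  have c2 := hs.linCost_le_budget (a := (imageOf (P.toPoly - listPoly h) p).terms) (b := 0)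
    (hs.size_terms_le hN _ (List.mem_map_of_mem hr.mem)) (by simp)
  have c3 := hs.bitOps_cofactorImages_le M P hhlen (fun w hw => hDℓ _ (H.isPart.lt H.lt hw))
    (prime_of_mem_primeList hr.mem).pos (hs.prime_le hN hr.mem).1 hK
  have c4 := hs.bitOps_uTerms_le (hcard.trans hT') hN hr.mem hK
  have c5 := hs.linCost_le_budget (a := paramN₁ T' D) (b := paramN₂ T' D) (hsz _ (by omega))
    (hsz _ (by omega))
  have c6 := hs.linCost_le_budget (a := paramN₁ T' D + paramN₂ T' D) (b := 1)
    (hsz _ (by omega)) (hsz _ (by omega))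
  have c7 := (hs.bitOps_imageTree_le (P.toPoly - listPoly h) (hm.trans hN)).trans
    (Nat.mul_le_mul_left 12 (hs.mul_le_budget (by norm_num)))
  have c8 := hs.bitOps_select_le (P.toPoly - listPoly h) (hm.trans hN)
    (N₂ := paramN₂ T' D) (by omega) hUlen fun w hw => hDℓ _ (hr.lt hw)
  have c9 := hs.linCost_le_budget (a := T') (b := s.length) (hsz _ (by omega)) (hsz _ (by omega))
  have c10 := (bitOps_params_le (T' := T' - s.length) hs.le_Λ hs.size_D hs.one_le_ℓ hs.one_le_T
    (by omega) (hsz _ (by omega))).trans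
    (Nat.mul_le_mul_left 30 (hs.sq_mul_le_budget (by norm_num)))
  have c11 := (hs.bitOps_imageTree_le (P.toPoly - listPoly h) hNs).trans
    (Nat.mul_le_mul_left 12 (hs.mul_le_budget (by norm_num)))
  have c12 := hs.bitOps_update_le (P.toPoly - listPoly h) hNs hslen
    fun w hw => hDℓ _ (hr.lt (hr.subset hw))
  have c13 : s.length + 1 ≤ 2 * ((T * ℓ ^ 2 + T ^ 2 * ℓ) * Λ ^ 5) := by
    have := hs.mul_le_budget (k := 0) (by norm_num)
    rw [pow_zero, mul_one] at this
    omega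
  -- all costs are now multiples of one bound, which is treated as an atom
  rw [← htake₁] at c7 c8
  rw [← htake₂] at c11 c12
  generalize (T * ℓ ^ 2 + T ^ 2 * ℓ) * Λ ^ 5 = Z at *
  have hfp : (imageOf (P.toPoly - listPoly h) p).p = p := rfl
  simp only [loop, bitOps_bind, hbest, val_natEq, bitOps_natEq, decide_eq_true_eq, hterms,
    if_false, hfp, hcof, hU, val_natAdd, val_natSub, bitOps_natAdd, bitOps_natSub, val_numTerms,
    bitOps_numTerms, val_params, hsel, hupd]
  omega

end Rounds

/-! ### Ring operations and total costs -/

namespace IsScale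

variable {T D ℓ Λ L : ℕ}

theorem sq_mul_sq_le_ringBudget (hs : IsScale T D ℓ Λ) (hL : 1 ≤ L) {k : ℕ} (hk : k ≤ 11) :
    T ^ 2 * ℓ ^ 2 * Λ ^ k ≤ L * (T ^ 2 * ℓ ^ 2 + T * ℓ ^ 3) * Λ ^ 11 := by
  refine Nat.mul_le_mul ?_ (Nat.pow_le_pow_right (by have := hs.le_Λ; omega) hk)
  exact (Nat.le_add_right _ _).trans (Nat.le_mul_of_pos_left _ hL)

theorem mul_sq_le_ringBudget (hs : IsScale T D ℓ Λ) (hL : 1 ≤ L) {k : ℕ} (hk : k ≤ 11) :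
    T * ℓ ^ 2 * Λ ^ k ≤ L * (T ^ 2 * ℓ ^ 2 + T * ℓ ^ 3) * Λ ^ 11 :=
  (Nat.mul_le_mul_right _ (Nat.mul_le_mul_right _ (Nat.le_self_pow (by norm_num) T))).trans
    (hs.sq_mul_sq_le_ringBudget hL hk)

theorem sq_mul_le_ringBudget (hs : IsScale T D ℓ Λ) (hL : 1 ≤ L) {k : ℕ} (hk : k ≤ 11) :
    T ^ 2 * ℓ * Λ ^ k ≤ L * (T ^ 2 * ℓ ^ 2 + T * ℓ ^ 3) * Λ ^ 11 :=
  (Nat.mul_le_mul_right _ (Nat.mul_le_mul_left _ (Nat.le_self_pow (by norm_num) ℓ))).trans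
    (hs.sq_mul_sq_le_ringBudget hL hk)

theorem mul_le_ringBudget (hs : IsScale T D ℓ Λ) (hL : 1 ≤ L) {k : ℕ} (hk : k ≤ 11) :
    T * ℓ * Λ ^ k ≤ L * (T ^ 2 * ℓ ^ 2 + T * ℓ ^ 3) * Λ ^ 11 :=
  (Nat.mul_le_mul_right _ (Nat.mul_le_mul_right _ (Nat.le_self_pow (by norm_num) T))).trans
    (hs.sq_mul_le_ringBudget hL hk)

/-- The cost of a multiplication modulo `X ^ m - 1`, where `m` is a number of word size. -/
theorem size_cyclicMul_le (hs : IsScale T D ℓ Λ) {m B : ℕ} {M : CyclicMul.{u} m}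
    (hM : M.size ≤ 10 ^ 9 * m * m.size ^ 6) (hm : m ≤ B) (hsize : m.size ≤ Λ) :
    m ≤ B * Λ ^ 9 ∧ M.size ≤ B * Λ ^ 9 := by
  have hΛ := hs.le_Λ
  constructor
  · calc m ≤ B := hm
      _ ≤ B * Λ ^ 9 := Nat.le_mul_of_pos_right _ (Nat.pow_pos (by omega))
  · calc M.size ≤ 10 ^ 9 * m * m.size ^ 6 := hM
      _ ≤ Λ ^ 3 * B * Λ ^ 6 := by
        refine Nat.mul_le_mul (Nat.mul_le_mul ?_ hm) (Nat.pow_le_pow_left hsize 6)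
        calc 10 ^ 9 = 1000 ^ 3 := by norm_num
          _ ≤ Λ ^ 3 := Nat.pow_le_pow_left hΛ 3
      _ = B * Λ ^ 9 := by ring

end IsScale

section Rounds

variable {R : Type u} [Ring R] [DecidableEq R] {T D ℓ Λ L : ℕ}

omit [DecidableEq R] in
theorem IsScale.ringOps_cofactorImages_le (hs : IsScale T D ℓ Λ) {M : ∀ p : ℕ, CyclicMul.{u} p}
    (hM : ∀ p, (M p).size ≤ 10 ^ 9 * p * p.size ^ 6) (hL : 1 ≤ L) (P : SLP R Unit L)
    {h : List (ℕ × R)} (hlen : h.length ≤ T) {n p : ℕ} (hn : n ≤ 4 * (T * ℓ))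
    (hp : p ∈ primeList n) {K : ℕ} (hK : K ≤ ℓ) :
    (cofactorImages M P h p (primeList K)).ringOps ≤
      11 * (L * (T ^ 2 * ℓ ^ 2 + T * ℓ ^ 3) * Λ ^ 11) := by
  have hX := hs.one_le_mul
  have hp2 : p ≤ 5 * (T * ℓ) * Λ :=
    (hs.prime_le hn hp).2.trans (Nat.mul_le_mul_right _ (by omega))
  have h1 := UIPoly.ringOps_cofactorImages_le (M := M) P h (p := p)
    (μ := 10 * (T * ℓ ^ 2) * Λ ^ 2 * Λ ^ 9) (primeList K) (by
      intro q hq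
      have h1 : p * q ≤ 10 * (T * ℓ ^ 2) * Λ ^ 2 := by
        calc p * q ≤ 5 * (T * ℓ) * Λ * (2 * (ℓ * Λ)) :=
              Nat.mul_le_mul hp2 (hs.prime_crt hK hq).2.2
          _ = 10 * (T * ℓ ^ 2) * Λ ^ 2 := by ring
      refine hs.size_cyclicMul_le (hM _) h1 (hs.size_le (h1.trans ?_))
      calc 10 * (T * ℓ ^ 2) * Λ ^ 2 ≤ 1000 * (T ^ 2 * ℓ ^ 2) * Λ ^ 5 :=
            Nat.mul_le_mul (Nat.mul_le_mul (by norm_num)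
              (Nat.mul_le_mul_right _ (Nat.le_self_pow (by norm_num) T)))
              (hs.pow_le_budget (by norm_num))
        _ = 1000 * ((T * ℓ) ^ 2 * Λ ^ 5) := by ring)
  rw [length_primeList] at h1
  refine h1.trans ?_
  calc K * (L * (10 * (T * ℓ ^ 2) * Λ ^ 2 * Λ ^ 9) + h.length)
      ≤ ℓ * (L * (10 * (T * ℓ ^ 2) * Λ ^ 2 * Λ ^ 9) + T) := Nat.mul_le_mul hK
        (Nat.add_le_add_left hlen _)
    _ = 10 * (L * (T * ℓ ^ 3) * Λ ^ 11) + T * ℓ * Λ ^ 0 := by ring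
    _ ≤ 10 * (L * (T ^ 2 * ℓ ^ 2 + T * ℓ ^ 3) * Λ ^ 11) +
        L * (T ^ 2 * ℓ ^ 2 + T * ℓ ^ 3) * Λ ^ 11 := Nat.add_le_add
        (Nat.mul_le_mul_left _ (Nat.mul_le_mul_right _ (Nat.mul_le_mul_left _
          (Nat.le_add_left _ _)))) (hs.mul_le_ringBudget hL (by norm_num))
    _ = _ := by ring

theorem IsScale.ringOps_uTerms_le (hs : IsScale T D ℓ Λ) (hL : 1 ≤ L) {g : R[X]}
    (hg : g.support.card ≤ T) {n p : ℕ} (hn : n ≤ 4 * (T * ℓ)) (hp : p ∈ primeList n) {K : ℕ}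
    (hK : K ≤ ℓ) :
    (uTerms D (imageOf g p) ((primeList K).map fun q => (q, wrap (p * q) g)) p).ringOps ≤
      9 * (L * (T ^ 2 * ℓ ^ 2 + T * ℓ ^ 3) * Λ ^ 11) := by
  have hX := hs.one_le_mul
  have hp2 : p ≤ 5 * (T * ℓ) * Λ :=
    (hs.prime_le hn hp).2.trans (Nat.mul_le_mul_right _ (by omega))
  have hnz : ((Finset.range p).filter fun i => (imageOf g p).coeff i ≠ 0).card ≤ T :=
    (terms_le_card_support _ p).trans hg
  have h1 := UIPoly.ringOps_uTerms_le (K := ℓ) (Q := 2 * (ℓ * Λ)) (T := T) (D := D)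
    (f := imageOf g p) ((primeList K).map fun q => (q, wrap (p * q) g)) (by
      intro w hw
      obtain ⟨q, hq, rfl⟩ := List.mem_map.1 hw
      exact (hs.prime_crt hK hq).2.2) (by rwa [List.length_map, length_primeList]) p hnz
  refine h1.trans ?_
  calc _ ≤ 5 * (T * ℓ) * Λ + T * (ℓ * (2 * (ℓ * Λ) + 1) + T * ℓ) := Nat.add_le_add hp2
        (Nat.mul_le_mul hnz (Nat.add_le_add_left hs.T_le _))
    _ = 5 * (T * ℓ * Λ ^ 1) + 2 * (T * ℓ ^ 2 * Λ ^ 1) + T * ℓ * Λ ^ 0 + T ^ 2 * ℓ * Λ ^ 0 := by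
        ring
    _ ≤ 5 * _ + 2 * _ + _ + _ := Nat.add_le_add (Nat.add_le_add (Nat.add_le_add
        (Nat.mul_le_mul_left _ (hs.mul_le_ringBudget hL (by norm_num)))
        (Nat.mul_le_mul_left _ (hs.mul_sq_le_ringBudget hL (by norm_num))))
        (hs.mul_le_ringBudget hL (by norm_num))) (hs.sq_mul_le_ringBudget hL (by norm_num))
    _ = _ := by ring

/-- The ring operations of one round of the main loop. -/
theorem ringOps_loop_succ_le {M : ∀ p : ℕ, CyclicMul.{u} p}
    (hM : ∀ p, (M p).size ≤ 10 ^ 9 * p * p.size ^ 6) (hL : 1 ≤ L) (P : SLP R Unit L)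
    {T' K : ℕ} (hs : IsScale T D ℓ Λ) (hD : 1 ≤ D) (hT' : T' ≤ T) (hK : K ≤ ℓ)
    (hf : P.toPoly.support.card ≤ T) {h : List (ℕ × R)}
    (H : LoopInv P.toPoly T' D (primeList K) h) (fuel : ℕ)
    (hg : 0 < (P.toPoly - listPoly h).support.card) :
    ∃ s : List (ℕ × R), LoopInv P.toPoly (T' - s.length) D (primeList K) (h ++ s) ∧
      2 * (P.toPoly - listPoly (h ++ s)).support.card ≤ (P.toPoly - listPoly h).support.card ∧
      (loop M P D (primeList K) (fuel + 1)
        ((primeList (paramN T' D)).map (imageOf (P.toPoly - listPoly h))) T' (paramN₁ T' D)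
        (paramN₂ T' D) h).ringOps ≤ 50 * (L * (T ^ 2 * ℓ ^ 2 + T * ℓ ^ 3) * Λ ^ 11) +
          (loop M P D (primeList K) fuel ((primeList (paramN (T' - s.length) D)).map
            (imageOf (P.toPoly - listPoly (h ++ s)))) (T' - s.length)
            (paramN₁ (T' - s.length) D) (paramN₂ (T' - s.length) D) (h ++ s)).ringOps := by
  obtain ⟨f₀, fs, hfs⟩ := exists_eq_cons (D := D) T' (P.toPoly - listPoly h)
  obtain ⟨p, U, s, hr, hbest, hU, hcof, hsel, hupd, _⟩ := exists_round M P H hg fuel hfs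
  obtain ⟨H', h1, h2⟩ := H.round hg hr
  refine ⟨s, H', by omega, ?_⟩
  have hterms : (imageOf (P.toPoly - listPoly h) p).terms ≠ 0 := (hr.terms_pos (by omega)).ne'
  rw [← hfs]
  have hN := hs.paramN_le hT' hD
  have hNs := hs.paramN_le (T' := T' - s.length) (by omega) hD
  have hm : paramN₁ T' D + paramN₂ T' D - 1 ≤ paramN T' D := le_max_right _ _
  have hcard := H.card_le
  have hhlen := H.isPart.length_le.trans hf
  have hUlen : U.length ≤ T := (hr.length_le hcard).trans hT'
  have hslen : s.length ≤ T := hr.length_found_le.trans hUlen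
  have htake₂ : (f₀ :: fs).take (paramN (T' - s.length) D) =
      (primeList (paramN (T' - s.length) D)).map (imageOf (P.toPoly - listPoly h)) := by
    rw [hfs, ← List.map_take, take_primeList (paramN_mono hD (Nat.sub_le _ _))]
  have c3 := hs.ringOps_cofactorImages_le hM hL P hhlen hN hr.mem hK
  have c4 := hs.ringOps_uTerms_le hL (hcard.trans hT') hN hr.mem hK
  have c8 := ringOps_select_le (N := 4 * (T * ℓ)) (N₂ := paramN₂ T' D)
    ((f₀ :: fs).take (paramN₁ T' D + paramN₂ T' D - 1)) (by
      rw [List.length_take]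
      omega)
    (imageTree ((f₀ :: fs).take (paramN₁ T' D + paramN₂ T' D - 1))).val U
  have c12 := ringOps_update_le (N := 4 * (T * ℓ))
    (fun q hq => (prime_of_mem_primeList hq).pos)
    (by rwa [length_primeList]) (val_imageTree (P.toPoly - listPoly h)
      (primeList (paramN (T' - s.length) D))).2
    (val_imageTree (P.toPoly - listPoly h) _).1 s (P.toPoly - listPoly h)
  rw [← htake₂] at c12
  have d : ∀ l : List (ℕ × R), l.length ≤ T → l.length * (4 * (T * ℓ) * 3) ≤
      12 * (L * (T ^ 2 * ℓ ^ 2 + T * ℓ ^ 3) * Λ ^ 11) := fun l hl => by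
    calc l.length * (4 * (T * ℓ) * 3) ≤ T * (4 * (T * ℓ) * 3) := Nat.mul_le_mul_right _ hl
      _ = 12 * (T ^ 2 * ℓ * Λ ^ 0) := by ring
      _ ≤ _ := Nat.mul_le_mul_left _ (hs.sq_mul_le_ringBudget hL (by norm_num))
  have d8 := d U hUlen
  have d12 := d s hslen
  generalize L * (T ^ 2 * ℓ ^ 2 + T * ℓ ^ 3) * Λ ^ 11 = Z at *
  have hfp : (imageOf (P.toPoly - listPoly h) p).p = p := rfl
  have htree : ∀ fs : List (Image R), (imageTree fs).ringOps = 0 := fun fs =>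
    ringOps_prodTree _ _
  simp only [loop, ringOps_bind, ringOps_best, hbest, val_natEq, ringOps_natEq,
    decide_eq_true_eq, hterms, if_false, hfp, hcof, hU, val_natAdd, val_natSub, ringOps_natAdd,
    ringOps_natSub, val_numTerms, ringOps_numTerms, val_params, ringOps_params, hsel, hupd, htree]
  omega

end Rounds

section Total

variable {R : Type u} [Ring R] [DecidableEq R] {T D ℓ Λ L : ℕ}

/-- The last round, in which no terms are missing, only looks for an image with terms. -/
theorem loop_eq_of_card_eq_zero (M : ∀ p : ℕ, CyclicMul.{u} p) (P : SLP R Unit L) {qs : List ℕ}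
    {T' N₁ N₂ : ℕ} {h : List (ℕ × R)} (fuel : ℕ)
    (hg : (P.toPoly - listPoly h).support.card = 0) {f₀ : Image R} {fs : List (Image R)}
    (hfs : f₀ :: fs = (primeList (paramN T' D)).map (imageOf (P.toPoly - listPoly h))) :
    (loop M P D qs (fuel + 1) (f₀ :: fs) T' N₁ N₂ h).ringOps = 0 ∧
    (loop M P D qs (fuel + 1) (f₀ :: fs) T' N₁ N₂ h).bitOps =
      (best f₀ fs).bitOps + linCost 0 0 := by
  obtain ⟨p, _, hbest, _⟩ := exists_best hfs
  simp only [loop, ringOps_bind, bitOps_bind, ringOps_best, hbest, val_natEq, ringOps_natEq,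
    bitOps_natEq, terms_eq_zero hg, decide_true, if_true, ringOps_pure, bitOps_pure, add_zero,
    and_self]

/-- In every round the number of terms of `f - h` is halved, so that there are at most `σ + 1`
rounds if `f - h` has less than `2 ^ σ` terms. -/
theorem bitOps_loop_le (M : ∀ p : ℕ, CyclicMul.{u} p) (P : SLP R Unit L) {K : ℕ}
    (hs : IsScale T D ℓ Λ) (hD : 1 ≤ D) (hK : K ≤ ℓ) (hf : P.toPoly.support.card ≤ T)
    (σ fuel T' : ℕ) (hT' : T' ≤ T) (h : List (ℕ × R))
    (H : LoopInv P.toPoly T' D (primeList K) h)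
    (hσ : (P.toPoly - listPoly h).support.card < 2 ^ σ) :
    (loop M P D (primeList K) fuel
      ((primeList (paramN T' D)).map (imageOf (P.toPoly - listPoly h))) T' (paramN₁ T' D)
      (paramN₂ T' D) h).bitOps ≤ (σ + 1) * (200 * ((T * ℓ ^ 2 + T ^ 2 * ℓ) * Λ ^ 5)) := by
  induction σ generalizing fuel T' h with
  | zero =>
    cases fuel with
    | zero => simp [loop]
    | succ fuel =>
      obtain ⟨f₀, fs, hfs⟩ := exists_eq_cons (D := D) T' (P.toPoly - listPoly h)
      have h1 := hs.bitOps_best_le (hs.paramN_le hT' hD) _ hfs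
      have h2 := hs.linCost_le_budget (a := 0) (b := 0) (by simp) (by simp)
      rw [← hfs, (loop_eq_of_card_eq_zero M P fuel (by simpa using hσ) hfs).2]
      omega
  | succ σ ih =>
    cases fuel with
    | zero => simp [loop]
    | succ fuel =>
      rcases Nat.eq_zero_or_pos (P.toPoly - listPoly h).support.card with h0 | h0
      · obtain ⟨f₀, fs, hfs⟩ := exists_eq_cons (D := D) T' (P.toPoly - listPoly h)
        have h1 := hs.bitOps_best_le (hs.paramN_le hT' hD) _ hfs
        have h2 := hs.linCost_le_budget (a := 0) (b := 0) (by simp) (by simp)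
        rw [← hfs, (loop_eq_of_card_eq_zero M P fuel h0 hfs).2, add_mul _ 1, one_mul]
        omega
      · obtain ⟨s, H', h1, h2⟩ := bitOps_loop_succ_le M P hs hD hT' hK hf H fuel h0
        have h3 := ih fuel (T' - s.length) (by omega) (h ++ s) H' (by rw [pow_succ] at hσ; omega)
        rw [add_mul _ 1, one_mul]
        omega

theorem ringOps_loop_le {M : ∀ p : ℕ, CyclicMul.{u} p}
    (hM : ∀ p, (M p).size ≤ 10 ^ 9 * p * p.size ^ 6) (hL : 1 ≤ L) (P : SLP R Unit L) {K : ℕ}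
    (hs : IsScale T D ℓ Λ) (hD : 1 ≤ D) (hK : K ≤ ℓ) (hf : P.toPoly.support.card ≤ T)
    (σ fuel T' : ℕ) (hT' : T' ≤ T) (h : List (ℕ × R))
    (H : LoopInv P.toPoly T' D (primeList K) h)
    (hσ : (P.toPoly - listPoly h).support.card < 2 ^ σ) :
    (loop M P D (primeList K) fuel
      ((primeList (paramN T' D)).map (imageOf (P.toPoly - listPoly h))) T' (paramN₁ T' D)
      (paramN₂ T' D) h).ringOps ≤
        σ * (50 * (L * (T ^ 2 * ℓ ^ 2 + T * ℓ ^ 3) * Λ ^ 11)) := by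
  induction σ generalizing fuel T' h with
  | zero =>
    cases fuel with
    | zero => simp [loop]
    | succ fuel =>
      obtain ⟨f₀, fs, hfs⟩ := exists_eq_cons (D := D) T' (P.toPoly - listPoly h)
      rw [← hfs, (loop_eq_of_card_eq_zero M P fuel (by simpa using hσ) hfs).1]
      omega
  | succ σ ih =>
    cases fuel with
    | zero => simp [loop]
    | succ fuel =>
      rcases Nat.eq_zero_or_pos (P.toPoly - listPoly h).support.card with h0 | h0
      · obtain ⟨f₀, fs, hfs⟩ := exists_eq_cons (D := D) T' (P.toPoly - listPoly h)
        rw [← hfs, (loop_eq_of_card_eq_zero M P fuel h0 hfs).1]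
        omega
      · obtain ⟨s, H', h1, h2⟩ := ringOps_loop_succ_le hM hL P hs hD hT' hK hf H fuel h0
        have h3 := ih fuel (T' - s.length) (by omega) (h ++ s) H' (by rw [pow_succ] at hσ; omega)
        rw [add_mul σ 1, one_mul]
        omega

/-- The cost of the list of primes: trial division of the numbers up to `5 T ℓ Λ` by the numbers
up to `O((T + ℓ) Λ)`. -/
theorem IsScale.bitOps_firstPrimes_le (hs : IsScale T D ℓ Λ) {n : ℕ} (hn : n ≤ 4 * (T * ℓ)) :
    (firstPrimes n).bitOps ≤ 4400 * ((T * ℓ ^ 2 + T ^ 2 * ℓ) * Λ ^ 5) := by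
  have hΛ := hs.le_Λ
  have hX := hs.one_le_mul
  have hT := hs.one_le_T
  have hXΛ : 1000 ≤ T * ℓ * Λ := hΛ.trans (Nat.le_mul_of_pos_left _ hX)
  have h1 := UIPoly.bitOps_firstPrimes_le (N := n) (B := 5 * (T * ℓ * Λ)) (σ := Λ)
    (hs.size_le_of_le_mul (by omega)) (hs.size_le_of_le (by omega)) (by omega) (by
      intro i hi
      have := (hs.prime_le hn (List.mem_map.2 ⟨i, List.mem_range.2 hi, rfl⟩)).2
      refine this.trans ?_
      rw [← mul_assoc]
      exact Nat.mul_le_mul_right _ (by omega))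
  have h2 : (5 * (T * ℓ * Λ)).sqrt + 1 ≤ 4 * ((T + ℓ) * Λ) := by
    have h3 : (5 * (T * ℓ * Λ)).sqrt ≤ 3 * ((T + ℓ) * Λ) := by
      refine (Nat.sqrt_le_sqrt ?_).trans_eq (Nat.sqrt_eq' (3 * ((T + ℓ) * Λ)))
      calc 5 * (T * ℓ * Λ) ≤ 5 * ((T + ℓ) ^ 2 * Λ ^ 2) := Nat.mul_le_mul_left _
            (Nat.mul_le_mul (by nlinarith) (Nat.le_self_pow (by norm_num) Λ))
        _ ≤ 9 * ((T + ℓ) ^ 2 * Λ ^ 2) := Nat.mul_le_mul_right _ (by norm_num)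
        _ = (3 * ((T + ℓ) * Λ)) ^ 2 := by ring
    have h4 : 1 ≤ (T + ℓ) * Λ := Nat.mul_pos (by omega) (by omega)
    omega
  calc (firstPrimes n).bitOps ≤ _ := h1
    _ ≤ 5 * (T * ℓ * Λ) * (4 * ((T + ℓ) * Λ) * (220 * Λ ^ 3)) :=
        Nat.mul_le_mul_left _ (Nat.mul_le_mul_right _ h2)
    _ = 4400 * ((T * ℓ ^ 2 + T ^ 2 * ℓ) * Λ ^ 5) := by ring

/-- The bit operations of the algorithm. The factor `Λ ^ 2` beyond the cost of a round pays for the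
number of rounds and for the constant. -/
theorem bitOps_uiPoly_le (M : ∀ p : ℕ, CyclicMul.{u} p) (P : SLP R Unit L)
    (hs : IsScale T D ℓ Λ) (hD : 1 ≤ D) (hT : P.toPoly.support.card ≤ T)
    (hdeg : P.toPoly.degree < D) :
    (uiPoly M P T D).bitOps ≤ (T * ℓ ^ 2 + T ^ 2 * ℓ) * Λ ^ 7 := by
  have hΛ := hs.le_Λ
  have hX := hs.one_le_mul
  have hN := hs.paramN_le le_rfl hD
  have hinv := loopInv_init hT hdeg
  obtain ⟨K, hK, hKeq⟩ := hs.crtPrimes_eq (paramN T D)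
  have h1 : (firstPrimes (paramN T D)).val = primeList (paramN T D) := val_firstPrimes _
  have h2 := val_images M P (primeList (paramN T D))
    fun p hp => (prime_of_mem_primeList hp).pos
  have c1 := (bitOps_params_le (T' := T) hΛ hs.size_D hs.one_le_ℓ hs.one_le_T le_rfl
    (hs.size_le_of_le (by omega))).trans
    (Nat.mul_le_mul_left 30 (hs.sq_mul_le_budget (by norm_num)))
  have c2 := hs.bitOps_firstPrimes_le hN
  have c3 : (crtPrimes D (primeList (paramN T D)) 1).bitOps ≤
      28 * ((T * ℓ ^ 2 + T ^ 2 * ℓ) * Λ ^ 5) := by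
    have h3 := bitOps_crtPrimes_le hΛ hs.one_le_ℓ hs.size_ℓΛ hs.size_D (primeList (paramN T D))
      (fun p hp => (hs.prime_le hN hp).1) 1 (by rw [Nat.size_one]; omega)
    rw [hKeq, length_primeList] at h3
    calc _ ≤ (K + 1) * (14 * (ℓ * Λ ^ 3)) := h3
      _ ≤ (2 * ℓ) * (14 * (T * ℓ * Λ ^ 3)) := Nat.mul_le_mul (by have := hs.one_le_ℓ; omega)
          (Nat.mul_le_mul_left _ (Nat.mul_le_mul_right _ hs.ℓ_le))
      _ = 28 * (T * ℓ ^ 2 * Λ ^ 3) := by ring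
      _ ≤ _ := Nat.mul_le_mul_left _ (hs.mul_sq_le_budget (by norm_num))
  have c4 : (images M P (primeList (paramN T D))).bitOps ≤
      4 * ((T * ℓ ^ 2 + T ^ 2 * ℓ) * Λ ^ 5) := by
    have h3 := bitOps_images_le hΛ M P hT (primeList (paramN T D))
      fun p hp => ⟨(prime_of_mem_primeList hp).pos, (hs.prime_le hN hp).1⟩
    rw [length_primeList] at h3
    calc _ ≤ 4 * (T * ℓ) * (T * Λ ^ 2) := h3.trans (Nat.mul_le_mul_right _ hN)
      _ = 4 * (T * (T * ℓ) * Λ ^ 2) := by ring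
      _ ≤ _ := Nat.mul_le_mul_left _ (hs.sq_mul_le_budget (by norm_num))
  rw [hKeq] at hinv
  have c5 := bitOps_loop_le M P hs hD hK hT Λ (T + 1) T le_rfl [] hinv (by
    rw [support_card_listPoly_nil]
    have h3 := hs.size_le_of_le (n := T) (by have := hs.T_le; omega)
    exact hT.trans_lt ((Nat.lt_size_self T).trans_le (Nat.pow_le_pow_right (by norm_num) h3)))
  rw [listPoly_nil, sub_zero] at c5
  simp only [uiPoly, bitOps_bind, val_params, h1, h2, hKeq]
  have e : (Λ + 1) * (200 * ((T * ℓ ^ 2 + T ^ 2 * ℓ) * Λ ^ 5)) +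
      4462 * ((T * ℓ ^ 2 + T ^ 2 * ℓ) * Λ ^ 5) ≤ (T * ℓ ^ 2 + T ^ 2 * ℓ) * Λ ^ 7 := by
    calc _ = ((Λ + 1) * 200 + 4462) * ((T * ℓ ^ 2 + T ^ 2 * ℓ) * Λ ^ 5) := by ring
      _ ≤ (Λ * Λ) * ((T * ℓ ^ 2 + T ^ 2 * ℓ) * Λ ^ 5) :=
        Nat.mul_le_mul_right _ (by nlinarith)
      _ = _ := by ring
  omega

/-- The ring operations of the algorithm, for multiplication programs of quasi-linear size. -/
theorem ringOps_uiPoly_le {M : ∀ p : ℕ, CyclicMul.{u} p}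
    (hM : ∀ p, (M p).size ≤ 10 ^ 9 * p * p.size ^ 6) (hL : 1 ≤ L) (P : SLP R Unit L)
    (hs : IsScale T D ℓ Λ) (hD : 1 ≤ D) (hT : P.toPoly.support.card ≤ T)
    (hdeg : P.toPoly.degree < D) :
    (uiPoly M P T D).ringOps ≤ L * (T ^ 2 * ℓ ^ 2 + T * ℓ ^ 3) * Λ ^ 13 := by
  have hΛ := hs.le_Λ
  have hX := hs.one_le_mul
  have hN := hs.paramN_le le_rfl hD
  have hinv := loopInv_init hT hdeg
  obtain ⟨K, hK, hKeq⟩ := hs.crtPrimes_eq (paramN T D)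
  have h1 : (firstPrimes (paramN T D)).val = primeList (paramN T D) := val_firstPrimes _
  have h2 := val_images M P (primeList (paramN T D))
    fun p hp => (prime_of_mem_primeList hp).pos
  have c4 : (images M P (primeList (paramN T D))).ringOps ≤
      40 * (L * (T ^ 2 * ℓ ^ 2 + T * ℓ ^ 3) * Λ ^ 11) := by
    have h3 := ringOps_images_le (M := M) (μ := 5 * (T * ℓ) * Λ * Λ ^ 9) P
      (primeList (paramN T D)) fun p hp => by
        obtain ⟨p1, p2⟩ := hs.prime_le hN hp
        exact hs.size_cyclicMul_le (hM p) (p2.trans (Nat.mul_le_mul_right _ (by omega))) p1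
    rw [length_primeList] at h3
    calc _ ≤ 4 * (T * ℓ) * (L * (5 * (T * ℓ) * Λ * Λ ^ 9) + L * (5 * (T * ℓ) * Λ * Λ ^ 9)) :=
          h3.trans (Nat.mul_le_mul hN (Nat.add_le_add_left (Nat.le_mul_of_pos_left _ hL) _))
      _ = 40 * (L * (T ^ 2 * ℓ ^ 2) * Λ ^ 10) := by ring
      _ ≤ _ := Nat.mul_le_mul_left _ (Nat.mul_le_mul
          (Nat.mul_le_mul_left _ (Nat.le_add_right _ _))
          (Nat.pow_le_pow_right (by omega) (by norm_num)))
  rw [hKeq] at hinv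
  have c5 := ringOps_loop_le hM hL P hs hD hK hT Λ (T + 1) T le_rfl [] hinv (by
    rw [support_card_listPoly_nil]
    have h3 := hs.size_le_of_le (n := T) (by have := hs.T_le; omega)
    exact hT.trans_lt ((Nat.lt_size_self T).trans_le (Nat.pow_le_pow_right (by norm_num) h3)))
  rw [listPoly_nil, sub_zero] at c5
  simp only [uiPoly, ringOps_bind, val_params, ringOps_params, ringOps_firstPrimes,
    ringOps_crtPrimes, h1, h2, hKeq]
  have e : Λ * (50 * (L * (T ^ 2 * ℓ ^ 2 + T * ℓ ^ 3) * Λ ^ 11)) +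
      40 * (L * (T ^ 2 * ℓ ^ 2 + T * ℓ ^ 3) * Λ ^ 11) ≤
        L * (T ^ 2 * ℓ ^ 2 + T * ℓ ^ 3) * Λ ^ 13 := by
    calc _ = (Λ * 50 + 40) * (L * (T ^ 2 * ℓ ^ 2 + T * ℓ ^ 3) * Λ ^ 11) := by ring
      _ ≤ (Λ * Λ) * (L * (T ^ 2 * ℓ ^ 2 + T * ℓ ^ 3) * Λ ^ 11) :=
        Nat.mul_le_mul_right _ (by nlinarith)
      _ = _ := by ring
  omega

end Total

/-! ### From bit lengths to logarithms -/

theorem size_sub_one_mul_log_two_le {n : ℕ} (hn : 1 ≤ n) :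
    ((n.size : ℝ) - 1) * Real.log 2 ≤ Real.log n := by
  have h1 : 0 < n.size := Nat.size_pos.2 hn
  have h2 : 2 ^ (n.size - 1) ≤ n := Nat.lt_size.1 (by omega)
  have h3 : (2 : ℝ) ^ (n.size - 1) ≤ n := by exact_mod_cast h2
  have h4 := Real.log_le_log (by positivity) h3
  rwa [Real.log_pow, Nat.cast_sub (by omega), Nat.cast_one] at h4

theorem size_le_three_mul_log {D : ℕ} (hD : 2 ≤ D) : (D.size : ℝ) ≤ 3 * Real.log D := by
  have h1 := size_sub_one_mul_log_two_le (show 1 ≤ D by omega)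
  have h2 := Real.log_two_gt_d9
  have h3 : Real.log 2 ≤ Real.log D := Real.log_le_log (by norm_num) (by exact_mod_cast hD)
  have h4 : (D.size : ℝ) * Real.log 2 ≤ 2 * Real.log D := by linarith
  nlinarith [(Nat.cast_nonneg D.size : (0 : ℝ) ≤ D.size)]

/-- Passage to the soft-Oh bound: `Z` is the main term in bit lengths, `φ` the one in logarithms,
and `X`, which stands for `T * ℓ`, is at most `Z`, so that its bit length is `O(log (φ + 3))`. -/
theorem le_softBound {c Z X k : ℕ} {φ : ℝ} (hφ : 0 ≤ φ) (hX1 : 1 ≤ X) (hX : X ≤ Z)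
    (hZ : (Z : ℝ) ≤ 27 * φ) (hk : k ≤ 13) (hc : c ≤ Z * (1000 * X.size) ^ k) :
    (c : ℝ) ≤ softBound (27 * 7000 ^ 13) 13 φ := by
  have hlg : 1 ≤ Real.log (φ + 3) := by
    rw [Real.le_log_iff_exp_le (by linarith)]
    have := Real.exp_one_lt_d9
    linarith
  have hX0 : (0 : ℝ) < X := by exact_mod_cast hX1
  have hXφ : (X : ℝ) ≤ 27 * (φ + 3) := by
    have : (X : ℝ) ≤ Z := by exact_mod_cast hX
    linarith
  have hlogX : Real.log X ≤ 4 * Real.log (φ + 3) := by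
    calc Real.log X ≤ Real.log (27 * (φ + 3)) := Real.log_le_log hX0 hXφ
      _ = 3 * Real.log 3 + Real.log (φ + 3) := by
        rw [Real.log_mul (by norm_num) (by linarith), show (27 : ℝ) = 3 ^ 3 by norm_num,
          Real.log_pow]
        norm_num
      _ ≤ 3 * Real.log (φ + 3) + Real.log (φ + 3) := by
        have := Real.log_le_log (by norm_num : (0 : ℝ) < 3) (show (3 : ℝ) ≤ φ + 3 by linarith)
        linarith
      _ = 4 * Real.log (φ + 3) := by ring
  have hsize : (X.size : ℝ) ≤ 7 * Real.log (φ + 3) := by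
    have h1 := size_sub_one_mul_log_two_le hX1
    have h2 := Real.log_two_gt_d9
    have h3 : (1 : ℝ) ≤ X.size := by exact_mod_cast Nat.size_pos.2 hX1
    nlinarith
  have hΛ : (1000 * X.size : ℝ) ≤ 7000 * Real.log (φ + 3) := by linarith
  calc (c : ℝ) ≤ Z * (1000 * X.size) ^ k := by exact_mod_cast hc
    _ ≤ 27 * φ * (7000 * Real.log (φ + 3)) ^ k := by gcongr
    _ ≤ 27 * φ * (7000 * Real.log (φ + 3)) ^ 13 := by
      gcongr
      linarith
    _ = softBound (27 * 7000 ^ 13) 13 φ := by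
      unfold softBound
      push_cast
      ring

theorem mul_le_ringBudget {T ℓ L : ℕ} (hL : 1 ≤ L) :
    T * ℓ ≤ L * (T ^ 2 * ℓ ^ 2 + T * ℓ ^ 3) :=
  calc T * ℓ ≤ T ^ 2 * ℓ ^ 2 := Nat.mul_le_mul (Nat.le_self_pow (by norm_num) T)
        (Nat.le_self_pow (by norm_num) ℓ)
    _ ≤ T ^ 2 * ℓ ^ 2 + T * ℓ ^ 3 := Nat.le_add_right _ _
    _ ≤ L * (T ^ 2 * ℓ ^ 2 + T * ℓ ^ 3) := Nat.le_mul_of_pos_left _ hL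

theorem mul_le_bitBudget {T ℓ : ℕ} : T * ℓ ≤ T * ℓ ^ 2 + T ^ 2 * ℓ :=
  (Nat.mul_le_mul_left _ (Nat.le_self_pow (by norm_num) ℓ)).trans (Nat.le_add_right _ _)

theorem ringBudget_le {T ℓ L : ℕ} {x : ℝ} (hℓ : (ℓ : ℝ) ≤ 3 * x) :
    ((L * (T ^ 2 * ℓ ^ 2 + T * ℓ ^ 3) : ℕ) : ℝ) ≤ 27 * (L * T ^ 2 * x ^ 2 + L * T * x ^ 3) := by
  have p2 := pow_le_pow_left₀ (Nat.cast_nonneg ℓ) hℓ 2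
  have p3 := pow_le_pow_left₀ (Nat.cast_nonneg ℓ) hℓ 3
  have q2 := mul_le_mul_of_nonneg_left p2 (show (0 : ℝ) ≤ L * T ^ 2 by positivity)
  have q3 := mul_le_mul_of_nonneg_left p3 (show (0 : ℝ) ≤ L * T by positivity)
  have q4 : (0 : ℝ) ≤ L * T ^ 2 * x ^ 2 := by positivity
  push_cast
  linarith

theorem bitBudget_le {T ℓ : ℕ} {x : ℝ} (hx : 0 ≤ x) (hℓ : (ℓ : ℝ) ≤ 3 * x) :
    ((T * ℓ ^ 2 + T ^ 2 * ℓ : ℕ) : ℝ) ≤ 27 * (T * x ^ 2 + T ^ 2 * x) := by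
  have p2 := pow_le_pow_left₀ (Nat.cast_nonneg ℓ) hℓ 2
  have q2 := mul_le_mul_of_nonneg_left p2 (Nat.cast_nonneg T : (0 : ℝ) ≤ T)
  have q3 := mul_le_mul_of_nonneg_left hℓ (show (0 : ℝ) ≤ (T : ℝ) ^ 2 by positivity)
  have q4 : (0 : ℝ) ≤ T * x ^ 2 := by positivity
  have q5 : (0 : ℝ) ≤ T ^ 2 * x := by positivity
  push_cast
  linarith

theorem isScale {T D : ℕ} (hT : 1 ≤ T) (hD : 2 ≤ D) :
    IsScale T D D.size (1000 * (T * D.size).size) :=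
  ⟨hT, Nat.size_pos.2 (by omega), le_rfl, rfl⟩

end UIPoly

theorem theorem4p4 :
    ∃ (M : ∀ p : ℕ, CyclicMul.{u} p) (C k : ℕ),
      ∀ (R : Type u) [Ring R] [DecidableEq R] (L : ℕ) (P : SLP R Unit L) (T D : ℕ),
        P.toPoly.support.card ≤ T → P.toPoly.degree < D →
          (((uiPoly M P T D).val.map Prod.fst).Nodup ∧
            ∀ (e : ℕ) (c : R),
              (e, c) ∈ (uiPoly M P T D).val ↔ c ≠ 0 ∧ P.toPoly.coeff e = c) ∧
          (1 ≤ L → 1 ≤ T → 2 ≤ D →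
            ((uiPoly M P T D).ringOps : ℝ) ≤
                softBound C k (L * T ^ 2 * Real.log D ^ 2 + L * T * Real.log D ^ 3) ∧
            ((uiPoly M P T D).bitOps : ℝ) ≤
                softBound C k (T * Real.log D ^ 2 + T ^ 2 * Real.log D)) := by
  choose M hM using exists_cyclicMul.{u}
  refine ⟨M, 27 * 7000 ^ 13, 13, fun R _ _ L P T D hT hdeg =>
    ⟨UIPoly.uiPoly_correct M P hT hdeg, fun hL hT1 hD => ?_⟩⟩
  have hs := UIPoly.isScale hT1 hD
  have hlog0 : 0 ≤ Real.log D := Real.log_natCast_nonneg D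
  have hlog := UIPoly.size_le_three_mul_log hD
  exact ⟨UIPoly.le_softBound (by positivity) hs.one_le_mul (UIPoly.mul_le_ringBudget hL)
      (UIPoly.ringBudget_le hlog) le_rfl (UIPoly.ringOps_uiPoly_le hM hL P hs (by omega) hT hdeg),
    UIPoly.le_softBound (by positivity) hs.one_le_mul UIPoly.mul_le_bitBudget
      (UIPoly.bitBudget_le hlog0 hlog) (by norm_num)
      (UIPoly.bitOps_uiPoly_le M P hs (by omega) hT hdeg)⟩
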